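/- Let $k$ be a field of characteristic $0$, $\mathfrak g$ a Lie algebra over $k$ and $\mathfrak h\subset\mathfrak g$ a finite-dimensional Lie subalgebra which is equipped with a Lie bialgebra structure with cobracket $\nu:\mathfrak h\to\wedge^2\mathfrak h$. Elements of $\wedge^n$ of a vector space are identified with skew-symmetric tensors, with $a\wedge b=\frac12(a\otimes b-b\otimes a)$. *The double.* Let $\mathfrak h^*_{op}$ be the dual space of $\mathfrak h$ with the opposite of the Lie bracket dual to $\nu$, and let $\mathfrak D\mathfrak h=\mathfrak h\bowtie\mathfrak h^*_{op}$ be the double Lie algebra. Let $\{h_i\}\subset\mathfrak h$ and $\{\eta^i\}\subset\mathfrak h^*$ be dual bases and $\theta=\frac12\sum_i(h_i\otimes\eta^i+\eta^i\otimes h_i)$. *Base algebra.* A Poisson $\mathfrak h$-base algebra is a commutative $k$-algebra $\mathcal L_0$ with an action $\triangleright$ of $\mathfrak D\mathfrak h$ by derivations such that $\theta$ vanishes on $\mathcal L_0$, that is, $\sum_i\bigl((h_i\triangleright f)(\eta^i\triangleright g)+(\eta^i\triangleright f)(h_i\triangleright g)\bigr)=0$ for all $f,g\in\mathcal L_0$.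 Let $J_0$ be the ideal of the action Lie algebroid $\mathcal L_0\rtimes\mathfrak D\mathfrak h$ that is generated over $\mathcal L_0$ by the sections $\sum_i\bigl((\eta^i\triangleright f)\otimes h_i+(h_i\triangleright f)\otimes\eta^i\bigr)$, $f\in\mathcal L_0$, and put $$(\mathfrak g\oplus\mathfrak D\mathfrak h)_{\mathcal L_0}=(\mathcal L_0\otimes\mathfrak g)\oplus(\mathcal L_0\rtimes\mathfrak D\mathfrak h)/J_0 ,$$ a Lie algebroid over $\mathcal L_0$ in which $\mathfrak g$ commutes with $\mathfrak D\mathfrak h$ and acts trivially on $\mathcal L_0$. *Classical dynamical r-matrix.* This is an element $r\in\mathcal L_0\otimes\wedge^2\mathfrak g$ such that $$h\triangleright r+[h\otimes1+1\otimes h,r]=\nu(h)\quad(h\in\mathfrak h),\qquad \sum_i\mathrm{Alt}\bigl(h_i\otimes\eta^i\triangleright r\bigr)-\mathrm{CYB}(r)=\varphi$$ for some $\varphi\in(\mathcal L_0\otimes\wedge^3\mathfrak g)^{\mathfrak g\oplus\mathfrak D\mathfrak h}$. Here $\triangleright$ is applied to the factor $\mathcal L_0$, $\mathrm{Alt}(a\otimes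 b\otimes c)=a\otimes b\otimes c-b\otimes a\otimes c+b\otimes c\otimes a$, $\mathrm{CYB}(r)=[r_{12},r_{13}]+[r_{13},r_{23}]+[r_{12},r_{23}]$, and in the invariance $\mathfrak g$ acts on $\wedge^3\mathfrak g$ and $\mathfrak D\mathfrak h$ acts on $\mathcal L_0$. *Coboundary Lie bialgebroids.* Let $\wedge^\bullet B$ be the exterior algebra over $\mathcal L_0$ of a Lie algebroid $B$, with its Schouten bracket. An element $\Lambda\in\wedge^2B$ with $[[\Lambda,\Lambda],\Lambda]=0$ defines a coboundary Lie bialgebroid on $B$ if $d=[\Lambda,\cdot]$ is a zero-square graded derivation of degree $1$ of the algebra $\wedge^\bullet B$ that satisfies $d[x,y]=[dx,y]+[x,dy]$ for $x,y\in B$ and is dual to a Lie algebroid structure on $B^*=\mathrm{Hom}_{\mathcal L_0}(B,\mathcal L_0)$, that is, $\langle df,\alpha\rangle=\alpha\triangleright f$ and $(dx)(\alpha,\beta)=\alpha\triangleright\beta(x)-\beta\triangleright\alpha(x)-[\alpha,\beta](x)$. In $\wedge^2(\mathfrak g\oplus\mathfrak D\mathfrak h)_{\mathcal L_0}$ put $\varpi=\sum_i\eta^i\wedge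 h_i$ with $h_i,\eta^i\in\mathfrak D\mathfrak h$, $\varpi'=\sum_i\eta^i\wedge h_i$ with $\eta^i\in\mathfrak D\mathfrak h$ and $h_i\in\mathfrak g$, and $\Lambda_0=\varpi+2\varpi'$. For $r\in\mathcal L_0\otimes\wedge^2\mathfrak g$ put $\Lambda=r+\Lambda_0$. **Theorem.** (a) If $r$ is a classical dynamical r-matrix over $\mathcal L_0$, then $[\Lambda,[\Lambda,Q]]=0$ for all $Q\in\wedge^\bullet(\mathfrak g\oplus\mathfrak D\mathfrak h)_{\mathcal L_0}$, and $\Lambda$ defines a coboundary Lie bialgebroid on $(\mathfrak g\oplus\mathfrak D\mathfrak h)_{\mathcal L_0}$. (b) Suppose that $\mathfrak h^*_{op}$ acts effectively on $\mathcal L_0$, in the sense that the map $\mathcal L_0\otimes\mathfrak h^*_{op}\to\mathrm{Der}(\mathcal L_0)$, $f\otimes\eta\mapsto f\,(\eta\triangleright\cdot\,)$, is injective. If $r\in\mathcal L_0\otimes\wedge^2\mathfrak g$ is such that $\Lambda=r+\Lambda_0$ defines a coboundary Lie bialgebroid on $(\mathfrak g\oplus\mathfrak D\mathfrak h)_{\mathcal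 L_0}$, then $r$ is a classical dynamical r-matrix. Consequently $r\mapsto r+\Lambda_0$ is a bijection from the set of classical dynamical r-matrices over $\mathcal L_0$ with values in $\wedge^2\mathfrak g$ to the set of those $\Lambda\in\Lambda_0+\mathcal L_0\otimes\wedge^2\mathfrak g$ that define a coboundary Lie bialgebroid. -/

import Mathlib

open scoped TensorProduct
set_option linter.unusedSectionVars false
set_option linter.unusedSimpArgs false

namespace DynR

/-! ### The Schouten bracket of a Lie algebroid

A Lie algebroid over the commutative `k`-algebra `L` is a Lie-Rinehart algebra `(L, B)`; the bracket
`⁅x, f⁆` of `x : B` with `f : L` is the anchor of `x` applied to `f`. The Schouten bracket on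
`ExteriorAlgebra L B` is the extension of the bracket of `B` and of the anchor by the graded
Leibniz rule. -/

section Schouten
variable {k L B : Type*} [CommRing k] [CommRing L] [Algebra k L] [AddCommGroup B] [Module k B]
  [Module L B] [IsScalarTower k L B]

/-- A `k`-linear `τ`-derivation of the exterior algebra with prescribed values on `L` and `B`. -/
theorem exists_twistedDerivation (τ : ExteriorAlgebra L B →ₐ[L] ExteriorAlgebra L B)
    (D₀ : Derivation k L (ExteriorAlgebra L B)) (D₁ : B →ₗ[k] ExteriorAlgebra L B)
    (h₁ : ∀ f x, D₁ (f • x) = f • D₁ x + D₀ f * ExteriorAlgebra.ι L x)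
    (h₂ : ∀ f x, τ (ExteriorAlgebra.ι L x) * D₀ f = D₀ f * ExteriorAlgebra.ι L x)
    (h₃ : ∀ x, D₁ x * ExteriorAlgebra.ι L x + τ (ExteriorAlgebra.ι L x) * D₁ x = 0) :
    ∃ D : ExteriorAlgebra L B →ₗ[k] ExteriorAlgebra L B,
      (∀ f, D (algebraMap L _ f) = D₀ f) ∧ (∀ x, D (ExteriorAlgebra.ι L x) = D₁ x) ∧
      ∀ P Q, D (P * Q) = D P * Q + τ P * D Q := by
  let φ₀ : L →+* Matrix (Fin 2) (Fin 2) (ExteriorAlgebra L B) :=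
    { toFun := fun f => !![algebraMap L (ExteriorAlgebra L B) f, D₀ f; 0, algebraMap L (ExteriorAlgebra L B) f]
      map_one' := by simp [Matrix.one_fin_two]
      map_zero' := by ext i j; fin_cases i <;> fin_cases j <;> simp
      map_add' := by intro f g; simp
      map_mul' := by
        intro f g
        simp only [Matrix.mul_fin_two, map_mul, Derivation.leibniz, Algebra.smul_def, mul_zero,
          zero_mul, add_zero, zero_add]
        rw [Algebra.commutes g (D₀ f)] }
  let T := Subring.centralizer (Set.range φ₀)
  have hφ₀ : ∀ f, φ₀ f ∈ T := by
    intro f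
    rw [Subring.mem_centralizer_iff]
    rintro _ ⟨g, rfl⟩
    rw [← map_mul, ← map_mul, mul_comm]
  let φ₁ : L →+* T := φ₀.codRestrict T hφ₀
  let _ : Algebra L T := φ₁.toAlgebra' (by
    rintro f ⟨t, ht⟩
    apply Subtype.ext
    exact (Subring.mem_centralizer_iff.1 ht) _ ⟨f, rfl⟩)
  let ψ : B →ₗ[L] T :=
    { toFun := fun x => ⟨!![τ (ExteriorAlgebra.ι L x), D₁ x; 0, ExteriorAlgebra.ι L x], by
        rw [Subring.mem_centralizer_iff]
        rintro _ ⟨f, rfl⟩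
        change !![algebraMap L (ExteriorAlgebra L B) f, D₀ f; 0, algebraMap L (ExteriorAlgebra L B) f] * _ =
          _ * !![algebraMap L (ExteriorAlgebra L B) f, D₀ f; 0, algebraMap L (ExteriorAlgebra L B) f]
        simp only [Matrix.mul_fin_two, mul_zero, zero_mul, add_zero, zero_add, h₂]
        simp only [Algebra.commutes f, add_comm]⟩
      map_add' := by
        intro x y
        apply Subtype.ext
        change _ = Matrix.of _ + Matrix.of _
        simp
      map_smul' := by
        intro f x
        apply Subtype.ext
        change _ = !![algebraMap L (ExteriorAlgebra L B) f, D₀ f; 0, algebraMap L (ExteriorAlgebra L B) f] * Matrix.of _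
        rw [show (Matrix.of ![![τ (ExteriorAlgebra.ι L x), D₁ x], ![0, ExteriorAlgebra.ι L x]]) = 
          !![τ (ExteriorAlgebra.ι L x), D₁ x; 0, ExteriorAlgebra.ι L x] from rfl]
        simp only [Matrix.mul_fin_two, mul_zero, zero_mul, add_zero, zero_add, h₁,
          map_smul, ← Algebra.smul_def] }
  have hψ : ∀ x, ψ x * ψ x = 0 := by
    intro x
    apply Subtype.ext
    change !![τ (ExteriorAlgebra.ι L x), D₁ x; 0, ExteriorAlgebra.ι L x] *
      !![τ (ExteriorAlgebra.ι L x), D₁ x; 0, ExteriorAlgebra.ι L x] = 0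
    have : τ (ExteriorAlgebra.ι L x) * τ (ExteriorAlgebra.ι L x) = 0 := by
      rw [← map_mul, ExteriorAlgebra.ι_sq_zero, map_zero]
    simp only [Matrix.mul_fin_two, mul_zero, zero_mul, add_zero, ExteriorAlgebra.ι_sq_zero, this]
    rw [add_comm, h₃]
    ext i j; fin_cases i <;> fin_cases j <;> rfl
  let Φ : ExteriorAlgebra L B →ₐ[L] T := ExteriorAlgebra.lift L ⟨ψ, hψ⟩
  have hΦι : ∀ x, (Φ (ExteriorAlgebra.ι L x)).1 =
      !![τ (ExteriorAlgebra.ι L x), D₁ x; 0, ExteriorAlgebra.ι L x] := by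
    intro x
    rw [show Φ (ExteriorAlgebra.ι L x) = ψ x from ExteriorAlgebra.lift_ι_apply L ψ hψ x]
    rfl
  have hΦf : ∀ f, (Φ (algebraMap L (ExteriorAlgebra L B) f)).1 =
      !![algebraMap L (ExteriorAlgebra L B) f, D₀ f; 0, algebraMap L (ExteriorAlgebra L B) f] := by
    intro f
    rw [AlgHom.commutes]
    rfl
  have hmul : ∀ P Q, (Φ (P * Q)).1 = (Φ P).1 * (Φ Q).1 := by
    intro P Q; rw [map_mul]; rfl
  have hadd : ∀ P Q, (Φ (P + Q)).1 = (Φ P).1 + (Φ Q).1 := by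
    intro P Q; rw [map_add]; rfl
  have hdiag : ∀ P, (Φ P).1 = !![τ P, (Φ P).1 0 1; 0, P] := by
    intro P
    induction P using ExteriorAlgebra.induction with
    | algebraMap f => rw [hΦf]; simp
    | ι x => rw [hΦι]; simp
    | mul P Q hP hQ =>
      rw [hmul, hP, hQ]
      simp
    | add P Q hP hQ =>
      rw [hadd, hP, hQ]
      simp
  have hmul' : ∀ P Q, (Φ (P * Q)).1 0 1 = (Φ P).1 0 1 * Q + τ P * (Φ Q).1 0 1 := by
    intro P Q
    rw [hmul, hdiag P, hdiag Q]
    simp [add_comm]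
  refine ⟨{ toFun := fun P => (Φ P).1 0 1
            map_add' := fun P Q => by rw [hadd]; rfl
            map_smul' := fun c P => ?_ }, ?_, ?_, ?_⟩
  · have : c • P = algebraMap L (ExteriorAlgebra L B) (algebraMap k L c) * P := by
      rw [← Algebra.smul_def, algebraMap_smul]
    rw [this, hmul', hΦf, AlgHom.commutes, ← Algebra.smul_def, algebraMap_smul]
    simp
  · intro f
    change (Φ _).1 0 1 = _
    rw [hΦf]
    rfl
  · intro x; simp [hΦι]
  · exact hmul'


end Schouten
section Exterior
variable {L B : Type*} [CommRing L] [AddCommGroup B] [Module L B]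

open CliffordAlgebra in
theorem ι_mul_eq_involute_mul (x : B) (P : ExteriorAlgebra L B) :
    ExteriorAlgebra.ι L x * P = involute P * ExteriorAlgebra.ι L x := by
  induction P using ExteriorAlgebra.induction with
  | algebraMap f => rw [AlgHom.commutes, Algebra.commutes]
  | ι y =>
    have h : ∀ z : B, involute (ExteriorAlgebra.ι L z) = -ExteriorAlgebra.ι L z :=
      fun z => involute_ι z
    rw [h, neg_mul, eq_neg_iff_add_eq_zero, ExteriorAlgebra.ι_add_mul_swap]
  | mul P Q hP hQ => rw [← mul_assoc, hP, mul_assoc, hQ, map_mul, mul_assoc]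
  | add P Q hP hQ => rw [mul_add, hP, hQ, map_add, add_mul]

open CliffordAlgebra in
theorem involute_contractLeft (α : Module.Dual L B) (P : ExteriorAlgebra L B) :
    involute (contractLeft α P) = -contractLeft α (involute P) := by
  induction P using CliffordAlgebra.left_induction with
  | algebraMap f => simp [contractLeft_algebraMap]
  | add P Q hP hQ => simp only [map_add, hP, hQ, neg_add]
  | ι_mul P y hP =>
    rw [contractLeft_ι_mul]
    simp only [map_sub, map_mul, map_smul, involute_ι, hP, neg_mul, map_neg, contractLeft_ι_mul]
    simp

end Exterior

section Schouten
variable (k : Type*) {L B : Type*} [CommRing k] [CommRing L] [Algebra k L] [LieRing B]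
  [LieAlgebra k B] [Module L B] [LieRingModule B L] [LieRinehartRing L B]
  [LieRinehartAlgebra k L B]

theorem exists_lieDeriv (x : B) : ∃ D : ExteriorAlgebra L B →ₗ[k] ExteriorAlgebra L B,
    (∀ f : L, D (algebraMap L _ f) = algebraMap L _ ⁅x, f⁆) ∧
    (∀ y, D (ExteriorAlgebra.ι L y) = ExteriorAlgebra.ι L ⁅x, y⁆) ∧
    ∀ P Q, D (P * Q) = D P * Q + P * D Q := by
  obtain ⟨D, h0, h1, h2⟩ := exists_twistedDerivation (k := k) (AlgHom.id L (ExteriorAlgebra L B))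
    ((Algebra.linearMap L (ExteriorAlgebra L B)).compDer (LieRinehartAlgebra.anchor k L B x))
    (((ExteriorAlgebra.ι L).restrictScalars k) ∘ₗ (LieModule.toEnd k B B x))
    (fun f y => by simp [Algebra.smul_def])
    (fun f y => by simp [Algebra.commutes])
    (fun y => by simp [ExteriorAlgebra.ι_add_mul_swap])
  exact ⟨D, fun f => by simp [h0], fun y => by simp [h1], h2⟩

/-- The Lie derivative `L_x` on the exterior algebra: the derivation of degree zero with
`L_x f = ⁅x, f⁆` for `f : L` and `L_x y = ⁅x, y⁆` for `y : B`. -/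
noncomputable def lieDeriv (x : B) : ExteriorAlgebra L B →ₗ[k] ExteriorAlgebra L B :=
  (exists_lieDeriv k x).choose

theorem lieDeriv_algebraMap (x : B) (f : L) :
    lieDeriv k x (algebraMap L (ExteriorAlgebra L B) f) = algebraMap L _ ⁅x, f⁆ :=
  (exists_lieDeriv k x).choose_spec.1 f

theorem lieDeriv_ι (x y : B) :
    lieDeriv k x (ExteriorAlgebra.ι L y) = ExteriorAlgebra.ι L ⁅x, y⁆ :=
  (exists_lieDeriv k x).choose_spec.2.1 y

theorem lieDeriv_mul (x : B) (P Q : ExteriorAlgebra L B) :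
    lieDeriv k x (P * Q) = lieDeriv k x P * Q + P * lieDeriv k x Q :=
  (exists_lieDeriv k x).choose_spec.2.2 P Q

variable (B) in
/-- The differential of a function, `(df)(x) = ⁅x, f⁆`. -/
def anchorDiff (f : L) : Module.Dual L B where
  toFun x := ⁅x, f⁆
  map_add' x y := add_lie x y f
  map_smul' g x := by simp

open CliffordAlgebra in
theorem involute_lieDeriv (x : B) (P : ExteriorAlgebra L B) :
    involute (lieDeriv k x P) = lieDeriv k x (involute P) := by
  induction P using ExteriorAlgebra.induction with
  | algebraMap f => simp only [lieDeriv_algebraMap, AlgHom.commutes]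
  | ι y =>
    have h : ∀ z : B, involute (ExteriorAlgebra.ι L z) = -ExteriorAlgebra.ι L z :=
      fun z => involute_ι z
    rw [lieDeriv_ι, h, h, map_neg, lieDeriv_ι]
  | mul P Q hP hQ => simp only [lieDeriv_mul, map_mul, map_add, hP, hQ]
  | add P Q hP hQ => simp only [map_add, hP, hQ]

theorem lieDeriv_ext (D D' : ExteriorAlgebra L B →ₗ[k] ExteriorAlgebra L B)
    (h₀ : ∀ f : L, D (algebraMap L _ f) = D' (algebraMap L _ f))
    (h₁ : ∀ x, D (ExteriorAlgebra.ι L x) = D' (ExteriorAlgebra.ι L x))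
    (h₂ : ∀ P Q, D (P * Q) = D P * Q + P * D Q) (h₂' : ∀ P Q, D' (P * Q) = D' P * Q + P * D' Q) :
    D = D' := by
  ext P
  induction P using ExteriorAlgebra.induction with
  | algebraMap f => exact h₀ f
  | ι y => exact h₁ y
  | mul P Q hP hQ => rw [h₂, h₂', hP, hQ]
  | add P Q hP hQ => rw [map_add, map_add, hP, hQ]

theorem lieDeriv_add (x y : B) :
    (lieDeriv k (x + y) : ExteriorAlgebra L B →ₗ[k] _) = lieDeriv k x + lieDeriv k y :=
  lieDeriv_ext k _ _ (fun f => by simp [lieDeriv_algebraMap]) (fun z => by simp [lieDeriv_ι])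
    (fun P Q => lieDeriv_mul k _ P Q)
    (fun P Q => by simp only [LinearMap.add_apply, lieDeriv_mul, add_mul, mul_add]; abel)

theorem lieDeriv_ksmul (c : k) (x : B) :
    (lieDeriv k (c • x) : ExteriorAlgebra L B →ₗ[k] _) = c • lieDeriv k x :=
  lieDeriv_ext k _ _
    (fun f => by
      simp only [lieDeriv_algebraMap, smul_lie, LinearMap.smul_apply]
      rw [Algebra.smul_def c ⁅x, f⁆, map_mul, ← Algebra.smul_def, algebraMap_smul])
    (fun z => by
      simp only [lieDeriv_ι, smul_lie, LinearMap.smul_apply]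
      rw [← algebraMap_smul L c ⁅x, z⁆, map_smul, algebraMap_smul])
    (fun P Q => lieDeriv_mul k _ P Q)
    (fun P Q => by
      simp only [LinearMap.smul_apply, lieDeriv_mul, smul_add, smul_mul_assoc, mul_smul_comm])

open CliffordAlgebra in
theorem lieDeriv_smul (f : L) (x : B) (P : ExteriorAlgebra L B) :
    lieDeriv k (f • x) P =
      f • lieDeriv k x P - ExteriorAlgebra.ι L x * contractLeft (anchorDiff B f) P := by
  induction P using CliffordAlgebra.left_induction with
  | algebraMap g => 
    erw [lieDeriv_algebraMap, lieDeriv_algebraMap, contractLeft_algebraMap]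
    simp [Algebra.smul_def]
  | add P Q hP hQ => simp only [map_add, hP, hQ, smul_add, mul_add]; abel
  | ι_mul P y hP =>
    have e : CliffordAlgebra.ι (0 : QuadraticForm L B) y = ExteriorAlgebra.ι L y := rfl
    rw [contractLeft_ι_mul, e, lieDeriv_mul, lieDeriv_mul, hP, lieDeriv_ι, lieDeriv_ι]
    have h1 : ⁅f • x, y⁆ = f • ⁅x, y⁆ - (anchorDiff B f y) • x := by
      rw [← lie_skew, LieRinehartRing.leibniz_smul_right, ← lie_skew x y]
      simp only [anchorDiff, LinearMap.coe_mk, AddHom.coe_mk, smul_neg]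
      abel
    have h2 := ι_mul_eq_involute_mul x (ExteriorAlgebra.ι L y)
    have h3 : involute (ExteriorAlgebra.ι L y) = -ExteriorAlgebra.ι L y := involute_ι y
    rw [h3] at h2
    rw [h1, map_sub, map_smul, map_smul, sub_mul, mul_sub, mul_sub, ← mul_assoc, ← mul_assoc, h2]
    simp only [smul_mul_assoc, mul_smul_comm, smul_add, neg_mul]
    abel


open CliffordAlgebra in
/-- The derivation `f ↦ ι_{df} P`. -/
noncomputable def contractDer (P : ExteriorAlgebra L B) : Derivation k L (ExteriorAlgebra L B) :=
  Derivation.mk'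
    { toFun := fun f : L => contractLeft (anchorDiff B f) P
      map_add' := fun f g => by
        rw [show anchorDiff B (f + g) = anchorDiff B f + anchorDiff B g by
          ext x; exact lie_add x f g, map_add, LinearMap.add_apply]
      map_smul' := fun c f => by
        rw [show anchorDiff B (c • f) = (algebraMap k L c) • anchorDiff B f by
          ext x; simp only [anchorDiff, LinearMap.coe_mk, AddHom.coe_mk, LinearMap.smul_apply, algebraMap_smul]; exact lie_smul c x f, map_smul, LinearMap.smul_apply, algebraMap_smul,
          RingHom.id_apply] }
    (fun f g => by
      rw [LinearMap.coe_mk, AddHom.coe_mk,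
        show anchorDiff B (f * g) = f • anchorDiff B g + g • anchorDiff B f by
          ext x; simp [anchorDiff, mul_comm], map_add, map_smul, map_smul]
      simp only [LinearMap.add_apply, LinearMap.smul_apply])

open CliffordAlgebra in
theorem contractDer_apply (P : ExteriorAlgebra L B) (f : L) :
    contractDer k P f = contractLeft (anchorDiff B f) P := rfl

/-- The map `x ↦ L_x P`. -/
noncomputable def lieDerivFlip (P : ExteriorAlgebra L B) : B →ₗ[k] ExteriorAlgebra L B where
  toFun x := lieDeriv k x P
  map_add' x y := by rw [lieDeriv_add, LinearMap.add_apply]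
  map_smul' c x := by rw [lieDeriv_ksmul, LinearMap.smul_apply, RingHom.id_apply]

theorem lieDerivFlip_apply (P : ExteriorAlgebra L B) (x : B) :
    lieDerivFlip k P x = lieDeriv k x P := rfl

open CliffordAlgebra in
theorem exists_schouten_even (P : ExteriorAlgebra L B) (hP : involute P = P) :
    ∃ D : ExteriorAlgebra L B →ₗ[k] ExteriorAlgebra L B,
      (∀ f : L, D (algebraMap L _ f) = -contractLeft (anchorDiff B f) P) ∧
      (∀ x : B, D (ExteriorAlgebra.ι L x) = -lieDeriv k x P) ∧
      ∀ Q R, D (Q * R) = D Q * R + involute Q * D R := by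
  have h (f : L) : involute (contractLeft (anchorDiff B f) P) = -contractLeft (anchorDiff B f) P := by
    rw [involute_contractLeft, hP]
  have h' (x : B) : involute (lieDeriv k x P) = lieDeriv k x P := by rw [involute_lieDeriv, hP]
  have hι (x : B) : involute (ExteriorAlgebra.ι L x) = -ExteriorAlgebra.ι L x := involute_ι x
  refine exists_twistedDerivation (k := k) involute (-contractDer k P) (-lieDerivFlip k P)
    (fun f x => ?_) (fun f x => ?_) (fun x => ?_)
  · simp only [LinearMap.neg_apply, lieDerivFlip_apply, lieDeriv_smul, Derivation.neg_apply,
      contractDer_apply, ι_mul_eq_involute_mul, h, smul_neg, neg_mul]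
    abel
  · simp only [Derivation.neg_apply, contractDer_apply, hι, neg_mul_neg, ι_mul_eq_involute_mul, h]
  · simp only [LinearMap.neg_apply, lieDerivFlip_apply, hι, neg_mul_neg, ι_mul_eq_involute_mul, h']
    simp

open CliffordAlgebra in
theorem exists_schouten_odd (P : ExteriorAlgebra L B) (hP : involute P = -P) :
    ∃ D : ExteriorAlgebra L B →ₗ[k] ExteriorAlgebra L B,
      (∀ f : L, D (algebraMap L _ f) = contractLeft (anchorDiff B f) P) ∧
      (∀ x : B, D (ExteriorAlgebra.ι L x) = -lieDeriv k x P) ∧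
      ∀ Q R, D (Q * R) = D Q * R + Q * D R := by
  have h (f : L) : involute (contractLeft (anchorDiff B f) P) = contractLeft (anchorDiff B f) P := by
    rw [involute_contractLeft, hP, map_neg, neg_neg]
  have h' (x : B) : involute (lieDeriv k x P) = -lieDeriv k x P := by
    rw [involute_lieDeriv, hP, map_neg]
  refine exists_twistedDerivation (k := k) (AlgHom.id L _) (contractDer k P) (-lieDerivFlip k P)
    (fun f x => ?_) (fun f x => ?_) (fun x => ?_)
  · simp only [LinearMap.neg_apply, lieDerivFlip_apply, lieDeriv_smul,
      contractDer_apply, ι_mul_eq_involute_mul, h, smul_neg]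
    abel
  · simp only [contractDer_apply, ι_mul_eq_involute_mul, h, AlgHom.id_apply]
  · simp only [LinearMap.neg_apply, lieDerivFlip_apply, mul_neg, ι_mul_eq_involute_mul, h',
      AlgHom.id_apply]
    simp

/-- The Schouten bracket `[P, ·]` with an element `P` of even degree: the odd derivation with
`[P, f] = -ι_{df} P` and `[P, x] = -L_x P`. -/
noncomputable def schoutenEven (P : ExteriorAlgebra L B) (hP : CliffordAlgebra.involute P = P) :
    ExteriorAlgebra L B →ₗ[k] ExteriorAlgebra L B :=
  (exists_schouten_even k P hP).choose

theorem schoutenEven_algebraMap (P : ExteriorAlgebra L B) (hP : CliffordAlgebra.involute P = P)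
    (f : L) : schoutenEven k P hP (algebraMap L _ f) =
      -CliffordAlgebra.contractLeft (anchorDiff B f) P :=
  (exists_schouten_even k P hP).choose_spec.1 f

theorem schoutenEven_ι (P : ExteriorAlgebra L B) (hP : CliffordAlgebra.involute P = P)
    (x : B) : schoutenEven k P hP (ExteriorAlgebra.ι L x) = -lieDeriv k x P :=
  (exists_schouten_even k P hP).choose_spec.2.1 x

theorem schoutenEven_mul (P : ExteriorAlgebra L B) (hP : CliffordAlgebra.involute P = P)
    (Q R : ExteriorAlgebra L B) : schoutenEven k P hP (Q * R) =
      schoutenEven k P hP Q * R + CliffordAlgebra.involute Q * schoutenEven k P hP R :=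
  (exists_schouten_even k P hP).choose_spec.2.2 Q R

/-- The Schouten bracket `[P, ·]` with an element `P` of odd degree: the even derivation with
`[P, f] = ι_{df} P` and `[P, x] = -L_x P`. -/
noncomputable def schoutenOdd (P : ExteriorAlgebra L B) (hP : CliffordAlgebra.involute P = -P) :
    ExteriorAlgebra L B →ₗ[k] ExteriorAlgebra L B :=
  (exists_schouten_odd k P hP).choose

theorem schoutenOdd_algebraMap (P : ExteriorAlgebra L B) (hP : CliffordAlgebra.involute P = -P)
    (f : L) : schoutenOdd k P hP (algebraMap L _ f) =
      CliffordAlgebra.contractLeft (anchorDiff B f) P :=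
  (exists_schouten_odd k P hP).choose_spec.1 f

theorem schoutenOdd_ι (P : ExteriorAlgebra L B) (hP : CliffordAlgebra.involute P = -P)
    (x : B) : schoutenOdd k P hP (ExteriorAlgebra.ι L x) = -lieDeriv k x P :=
  (exists_schouten_odd k P hP).choose_spec.2.1 x

theorem schoutenOdd_mul (P : ExteriorAlgebra L B) (hP : CliffordAlgebra.involute P = -P)
    (Q R : ExteriorAlgebra L B) : schoutenOdd k P hP (Q * R) =
      schoutenOdd k P hP Q * R + Q * schoutenOdd k P hP R :=
  (exists_schouten_odd k P hP).choose_spec.2.2 Q R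

/-- The component of `P` of parity `i`. -/
noncomputable def parityPart (i : ZMod 2) (P : ExteriorAlgebra L B) : ExteriorAlgebra L B :=
  (DirectSum.decompose (CliffordAlgebra.evenOdd (0 : QuadraticForm L B)) P) i

/-- The Schouten bracket `[P, ·]` on the exterior algebra of a Lie algebroid. -/
noncomputable def schouten (P : ExteriorAlgebra L B) :
    ExteriorAlgebra L B →ₗ[k] ExteriorAlgebra L B :=
  schoutenEven k (parityPart 0 P) (CliffordAlgebra.involute_eq_of_mem_even (SetLike.coe_mem _)) +
    schoutenOdd k (parityPart 1 P) (CliffordAlgebra.involute_eq_of_mem_odd (SetLike.coe_mem _))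
end Schouten

/-! ### Lie bialgebroids -/

section Bialgebroid

/-- A Lie algebroid structure on an `L`-module `E`, given by an anchor and a bracket. -/
structure IsLieAlgebroid {k L E : Type*} [CommRing k] [CommRing L] [Algebra k L] [AddCommGroup E]
    [Module k E] [Module L E] (ρ : E →ₗ[L] Derivation k L L) (br : E →ₗ[k] E →ₗ[k] E) : Prop where
  self : ∀ a, br a a = 0
  jacobi : ∀ a b c, br a (br b c) = br (br a b) c + br b (br a c)
  anchor_lie : ∀ a b, ρ (br a b) = ⁅ρ a, ρ b⁆
  leibniz : ∀ a b (f : L), br a (f • b) = f • br a b + ρ a f • b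

variable (k : Type*) {L B : Type*} [CommRing k] [CommRing L] [Algebra k L] [LieRing B]
  [LieAlgebra k B] [Module L B] [LieRingModule B L] [LieRinehartRing L B]
  [LieRinehartAlgebra k L B]

/-- A Lie bialgebroid structure on the Lie algebroid `B` over `L`, given by its differential `d` on
the exterior algebra of `B`: `d` is a derivation of degree one and of zero square, it is compatible
with the bracket of `B`, and it is dual to a Lie algebroid structure on `B^* = Hom_L(B, L)`, that is
`⟨df, α⟩ = α ▹ f` and `(dx)(α, β) = α ▹ β(x) - β ▹ α(x) - ⁅α, β⁆(x)`. -/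
structure IsLieBialgebroid (d : ExteriorAlgebra L B →ₗ[k] ExteriorAlgebra L B) : Prop where
  degree : ∀ n : ℕ, ∀ P ∈ ⋀[L]^n B, d P ∈ ⋀[L]^(n + 1) B
  leibniz : ∀ P Q, d (P * Q) = d P * Q + CliffordAlgebra.involute P * d Q
  sq_zero : ∀ P, d (d P) = 0
  compat : ∀ x y : B, d (ExteriorAlgebra.ι L ⁅x, y⁆) =
    schouten k (d (ExteriorAlgebra.ι L x)) (ExteriorAlgebra.ι L y) +
      schouten k (ExteriorAlgebra.ι L x) (d (ExteriorAlgebra.ι L y))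
  dual : ∃ (ρ : Module.Dual L B →ₗ[L] Derivation k L L)
      (br : Module.Dual L B →ₗ[k] Module.Dual L B →ₗ[k] Module.Dual L B),
    IsLieAlgebroid ρ br ∧
    (∀ α f, CliffordAlgebra.contractLeft α (d (algebraMap L (ExteriorAlgebra L B) f)) =
      algebraMap L (ExteriorAlgebra L B) (ρ α f)) ∧
    (∀ α β x, CliffordAlgebra.contractLeft β (CliffordAlgebra.contractLeft α
        (d (ExteriorAlgebra.ι L x))) =
      algebraMap L (ExteriorAlgebra L B) (ρ α (β x) - ρ β (α x) - br α β x))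

/-- The bivector `Λ` defines a coboundary Lie bialgebroid on `B`: the differential of the Lie
bialgebroid is `[Λ, ·]`. -/
structure IsCoboundaryLieBialgebroid (Λ : ExteriorAlgebra L B) : Prop where
  mem : Λ ∈ ⋀[L]^2 B
  bracket_bracket : schouten k (schouten k Λ Λ) Λ = 0
  isLieBialgebroid : IsLieBialgebroid k (schouten k Λ)

end Bialgebroid

/-! ### Lie bialgebras and the double -/

section LieBialgebra

/-- A Lie bialgebra: a Lie algebra with a skew-symmetric cobracket that satisfies the co-Jacobi
identity and the cocycle condition. -/
class LieBialgebra (k 𝔥 : Type*) [Field k] [LieRing 𝔥] [LieAlgebra k 𝔥] where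
  cobracket : 𝔥 →ₗ[k] 𝔥 ⊗[k] 𝔥
  skew : ∀ x, TensorProduct.comm k 𝔥 𝔥 (cobracket x) = -cobracket x
  coJacobi : ∀ x,
    let t := TensorProduct.assoc k 𝔥 𝔥 𝔥 (cobracket.rTensor 𝔥 (cobracket x))
    t + TensorProduct.assoc k 𝔥 𝔥 𝔥 (TensorProduct.comm k 𝔥 (𝔥 ⊗[k] 𝔥) t) +
      TensorProduct.comm k (𝔥 ⊗[k] 𝔥) 𝔥 ((TensorProduct.assoc k 𝔥 𝔥 𝔥).symm t) = 0
  cocycle : ∀ x y : 𝔥, cobracket ⁅x, y⁆ = ⁅x, cobracket y⁆ - ⁅y, cobracket x⁆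

variable {k 𝔥 : Type*} [Field k] [LieRing 𝔥] [LieAlgebra k 𝔥]

/-- `(ξ ⊗ η)(t)`. -/
noncomputable def pairTensor (ξ η : Module.Dual k 𝔥) : 𝔥 ⊗[k] 𝔥 →ₗ[k] k :=
  LinearMap.mul' k k ∘ₗ TensorProduct.map ξ η

/-- `(ξ ⊗ id)(t)`. -/
noncomputable def contractTensor (ξ : Module.Dual k 𝔥) : 𝔥 ⊗[k] 𝔥 →ₗ[k] 𝔥 :=
  (TensorProduct.lid k 𝔥).toLinearMap ∘ₗ ξ.rTensor 𝔥

variable [CharZero k] [LieBialgebra k 𝔥]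

open LieBialgebra

/-- The Lie bracket on `𝔥^*`, dual to the cobracket. -/
noncomputable def dualBracket (ξ η : Module.Dual k 𝔥) : Module.Dual k 𝔥 :=
  pairTensor ξ η ∘ₗ cobracket

theorem pairTensor_tmul (ξ η : Module.Dual k 𝔥) (a b : 𝔥) :
  pairTensor ξ η (a ⊗ₜ b) = ξ a * η b := rfl

theorem contractTensor_tmul (ξ : Module.Dual k 𝔥) (a b : 𝔥) :
  contractTensor ξ (a ⊗ₜ b) = ξ a • b := rfl

theorem apply_contractTensor (ξ η : Module.Dual k 𝔥) (t : 𝔥 ⊗[k] 𝔥) : η (contractTensor ξ t) = pairTensor ξ η t := by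
  induction t with
  | zero => simp
  | tmul a b => simp [pairTensor_tmul, contractTensor_tmul]
  | add s t hs ht => simp [hs, ht]

theorem dualBracket_apply (ξ η : Module.Dual k 𝔥) (x : 𝔥) :
  dualBracket ξ η x = pairTensor ξ η (cobracket x) := rfl

theorem dualBracket_skew (ξ η : Module.Dual k 𝔥) : dualBracket ξ η = - dualBracket η ξ := by
  ext x
  have h : ∀ t, pairTensor ξ η (TensorProduct.comm k 𝔥 𝔥 t) = pairTensor η ξ t := by
    intro t
    induction t with
    | zero => simp
    | tmul a b => simp [pairTensor_tmul, mul_comm]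
    | add s t hs ht => simp only [map_add, hs, ht]
  have := h (cobracket x)
  rw [skew, map_neg] at this
  rw [LinearMap.neg_apply, dualBracket_apply, dualBracket_apply, ← this, neg_neg]

theorem dualBracket_lie (ξ η : Module.Dual k 𝔥) (x y : 𝔥) :
    dualBracket ξ η ⁅x, y⁆ = -dualBracket ⁅x, ξ⁆ η y - dualBracket ξ ⁅x, η⁆ y
      + dualBracket ⁅y, ξ⁆ η x + dualBracket ξ ⁅y, η⁆ x := by
  have h : ∀ (z : 𝔥) t, pairTensor ξ η ⁅z, t⁆ = - pairTensor ⁅z, ξ⁆ η t - pairTensor ξ ⁅z, η⁆ t := by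
    intro z t
    induction t with
    | zero => simp
    | tmul a b => simp [pairTensor_tmul, TensorProduct.LieModule.lie_tmul_right]
    | add s t hs ht => rw [lie_add, map_add, hs, ht]; simp only [map_add]; ring
  simp only [dualBracket_apply, cocycle, map_sub, h]
  ring

theorem dualBracket_jacobi (ξ η ζ : Module.Dual k 𝔥) :
    dualBracket (dualBracket ξ η) ζ + dualBracket (dualBracket η ζ) ξ +
      dualBracket (dualBracket ζ ξ) η = 0 := by
  ext x
  have h1 : ∀ (α β γ : Module.Dual k 𝔥) t, pairTensor (dualBracket α β) γ t =
      LinearMap.mul' k k (TensorProduct.map α (pairTensor β γ)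
        (TensorProduct.assoc k 𝔥 𝔥 𝔥 (cobracket.rTensor 𝔥 t))) := by
    intro α β γ t
    induction t with
    | zero => simp
    | tmul a b =>
      simp only [pairTensor_tmul, LinearMap.rTensor_tmul, dualBracket_apply]
      generalize (cobracket a : 𝔥 ⊗[k] 𝔥) = s
      induction s with
      | zero => simp
      | tmul c d => simp [pairTensor_tmul, mul_assoc]
      | add s t hs ht => simp only [map_add, add_mul, hs, ht, TensorProduct.add_tmul]
    | add s t hs ht => simp only [map_add, hs, ht]
  have h2 : ∀ (α β γ : Module.Dual k 𝔥) (t : 𝔥 ⊗[k] (𝔥 ⊗[k] 𝔥)), 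
      LinearMap.mul' k k (TensorProduct.map α (pairTensor β γ)
        (TensorProduct.assoc k 𝔥 𝔥 𝔥 (TensorProduct.comm k 𝔥 (𝔥 ⊗[k] 𝔥) t))) = 
      LinearMap.mul' k k (TensorProduct.map γ (pairTensor α β) t) := by
    intro α β γ t
    induction t with
    | zero => simp
    | tmul a s =>
      induction s with
      | zero => simp
      | tmul c d => simp [pairTensor_tmul]; ring
      | add s t hs ht => simp only [map_add, hs, ht, TensorProduct.tmul_add]
    | add s t hs ht => simp only [map_add, hs, ht]
  have h3 : ∀ (α β γ : Module.Dual k 𝔥) (t : 𝔥 ⊗[k] (𝔥 ⊗[k] 𝔥)), 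
      LinearMap.mul' k k (TensorProduct.map α (pairTensor β γ)
        (TensorProduct.comm k (𝔥 ⊗[k] 𝔥) 𝔥 ((TensorProduct.assoc k 𝔥 𝔥 𝔥).symm t))) = 
      LinearMap.mul' k k (TensorProduct.map β (pairTensor γ α) t) := by
    intro α β γ t
    induction t with
    | zero => simp
    | tmul a s =>
      induction s with
      | zero => simp
      | tmul c d => simp [pairTensor_tmul]; ring
      | add s t hs ht => simp only [map_add, hs, ht, TensorProduct.tmul_add]
    | add s t hs ht => simp only [map_add, hs, ht]
  have h := congrArg (fun t => LinearMap.mul' k k (TensorProduct.map ξ (pairTensor η ζ) t))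
    (coJacobi (k := k) x)
  simp only [map_add, h2, h3, map_zero] at h
  simp only [LinearMap.add_apply, LinearMap.zero_apply]
  rw [dualBracket_apply, dualBracket_apply, dualBracket_apply, h1, h1, h1]
  rw [← h]
  ring

variable (k 𝔥) in
/-- The underlying space `𝔥 ⊕ 𝔥^*` of the double `𝔇𝔥 = 𝔥 ⋈ 𝔥^*_{op}` of the Lie bialgebra `𝔥`. -/
def LieDouble : Type _ := 𝔥 × Module.Dual k 𝔥

namespace LieDouble

noncomputable instance : AddCommGroup (LieDouble k 𝔥) :=
  inferInstanceAs (AddCommGroup (𝔥 × Module.Dual k 𝔥))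
noncomputable instance : Module k (LieDouble k 𝔥) :=
  inferInstanceAs (Module k (𝔥 × Module.Dual k 𝔥))

/-- The bracket of the double, for which `𝔥` and `𝔥^*_{op}` (the dual with the opposite of
`dualBracket`) are subalgebras and the natural pairing on `𝔥 ⊕ 𝔥^*` is invariant. -/
noncomputable instance : Bracket (LieDouble k 𝔥) (LieDouble k 𝔥) where
  bracket u v :=
    (⁅u.1, v.1⁆ - contractTensor v.2 (cobracket u.1) + contractTensor u.2 (cobracket v.1),
     ⁅u.1, v.2⁆ - ⁅v.1, u.2⁆ - dualBracket u.2 v.2)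

@[simp] theorem bracket_fst (u v : LieDouble k 𝔥) : (⁅u, v⁆ : LieDouble k 𝔥).1 =
  ⁅u.1, v.1⁆ - contractTensor v.2 (cobracket u.1) + contractTensor u.2 (cobracket v.1) := rfl
@[simp] theorem bracket_snd (u v : LieDouble k 𝔥) : (⁅u, v⁆ : LieDouble k 𝔥).2 =
  ⁅u.1, v.2⁆ - ⁅v.1, u.2⁆ - dualBracket u.2 v.2 := rfl
@[simp] theorem add_fst (u v : LieDouble k 𝔥) : (u + v).1 = u.1 + v.1 := rfl
@[simp] theorem add_snd (u v : LieDouble k 𝔥) : (u + v).2 = u.2 + v.2 := rfl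
@[simp] theorem smul_fst (c : k) (v : LieDouble k 𝔥) : (c • v).1 = c • v.1 := rfl
@[simp] theorem smul_snd (c : k) (v : LieDouble k 𝔥) : (c • v).2 = c • v.2 := rfl

theorem ext_iff' {u v : LieDouble k 𝔥} (h₁ : ∀ ω : Module.Dual k 𝔥, ω u.1 = ω v.1)
    (h₂ : ∀ x, u.2 x = v.2 x) : u = v := by
  refine Prod.ext ?_ (LinearMap.ext h₂)
  rw [← sub_eq_zero, ← Module.forall_dual_apply_eq_zero_iff k]
  intro ω
  rw [map_sub, h₁, sub_self]

theorem db_add_left (ξ η ζ : Module.Dual k 𝔥) :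
    dualBracket (ξ + η) ζ = dualBracket ξ ζ + dualBracket η ζ := by
  ext x; simp [dualBracket, pairTensor, TensorProduct.map_add_left]
theorem db_add_right (ξ η ζ : Module.Dual k 𝔥) :
    dualBracket ξ (η + ζ) = dualBracket ξ η + dualBracket ξ ζ := by
  ext x; simp [dualBracket, pairTensor, TensorProduct.map_add_right]
theorem db_smul_right (c : k) (ξ η : Module.Dual k 𝔥) :
    dualBracket ξ (c • η) = c • dualBracket ξ η := by
  ext x; simp [dualBracket, pairTensor, TensorProduct.map_smul_right]
theorem db_smul_left (c : k) (ξ η : Module.Dual k 𝔥) :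
    dualBracket (c • ξ) η = c • dualBracket ξ η := by
  ext x; simp [dualBracket, pairTensor, TensorProduct.map_smul_left]
theorem db_neg_left (ξ η : Module.Dual k 𝔥) :
    dualBracket (-ξ) η = - dualBracket ξ η := by
  rw [eq_neg_iff_add_eq_zero, ← db_add_left, neg_add_cancel]
  ext x; simp [dualBracket, pairTensor]
theorem db_neg_right (ξ η : Module.Dual k 𝔥) :
    dualBracket ξ (-η) = - dualBracket ξ η := by
  rw [eq_neg_iff_add_eq_zero, ← db_add_right, neg_add_cancel]
  ext x; simp [dualBracket, pairTensor]
theorem db_sub_left (ξ η ζ : Module.Dual k 𝔥) :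
    dualBracket (ξ - η) ζ = dualBracket ξ ζ - dualBracket η ζ := by
  rw [sub_eq_add_neg, db_add_left, db_neg_left, ← sub_eq_add_neg]
theorem db_sub_right (ξ η ζ : Module.Dual k 𝔥) :
    dualBracket ξ (η - ζ) = dualBracket ξ η - dualBracket ξ ζ := by
  rw [sub_eq_add_neg, db_add_right, db_neg_right, ← sub_eq_add_neg]

theorem apply_contract (ξ η : Module.Dual k 𝔥) (x : 𝔥) :
    η (contractTensor ξ (cobracket x)) = dualBracket ξ η x := apply_contractTensor ξ η _

theorem apply_lie (ξ : Module.Dual k 𝔥) (x y : 𝔥) : ξ ⁅x, y⁆ = -⁅x, ξ⁆ y := by simp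

theorem apply_lie_contract (ω η : Module.Dual k 𝔥) (x y : 𝔥) :
    ω ⁅x, contractTensor η (cobracket y)⁆ = -dualBracket η ⁅x, ω⁆ y := by
  rw [apply_lie, apply_contract]

theorem apply_contract_lie (ω η : Module.Dual k 𝔥) (x y : 𝔥) :
    ω ⁅contractTensor η (cobracket y), x⁆ = dualBracket η ⁅x, ω⁆ y := by
  rw [← lie_skew, map_neg, apply_lie_contract, neg_neg]

theorem apply_db_contract (ω η ζ : Module.Dual k 𝔥) (y : 𝔥) :
    dualBracket ζ ω (contractTensor η (cobracket y)) = dualBracket η (dualBracket ζ ω) y :=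
  apply_contract _ _ _

theorem db_leibniz (α β ω : Module.Dual k 𝔥) (x : 𝔥) : dualBracket (dualBracket α β) ω x =
    dualBracket α (dualBracket β ω) x - dualBracket β (dualBracket α ω) x := by
  have h := LinearMap.congr_fun (dualBracket_jacobi α β ω) x
  rw [dualBracket_skew (dualBracket β ω) α, dualBracket_skew ω α, db_neg_left,
    dualBracket_skew (dualBracket α ω) β] at h
  simp only [LinearMap.add_apply, LinearMap.neg_apply, LinearMap.zero_apply, neg_neg] at h
  linear_combination h

theorem lie_db_apply (η ζ : Module.Dual k 𝔥) (x t : 𝔥) :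
    (⁅x, dualBracket η ζ⁆ : Module.Dual k 𝔥) t = -dualBracket η ζ ⁅x, t⁆ := rfl

theorem contract_lie_apply (ξ ζ : Module.Dual k 𝔥) (y t : 𝔥) :
    (⁅contractTensor ζ (cobracket y), ξ⁆ : Module.Dual k 𝔥) t = -dualBracket ζ ⁅t, ξ⁆ y := by
  rw [Module.Dual.lie_apply, apply_contract_lie]

noncomputable instance : LieRing (LieDouble k 𝔥) where
  add_lie u v w := by
    refine ext_iff' (fun ω => ?_) (fun x => ?_)
    · simp only [bracket_fst, add_fst, add_snd, map_add, map_sub, apply_contract, db_add_left, LinearMap.add_apply, add_lie]; ring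
    · simp only [bracket_snd, add_fst, add_snd, db_add_left, LinearMap.add_apply, LinearMap.sub_apply, add_lie, lie_add]; ring
  lie_add u v w := by
    refine ext_iff' (fun ω => ?_) (fun x => ?_)
    · simp only [bracket_fst, add_fst, add_snd, map_add, map_sub, apply_contract, db_add_left, LinearMap.add_apply, lie_add]; ring
    · simp only [bracket_snd, add_fst, add_snd, db_add_right, LinearMap.add_apply, LinearMap.sub_apply, add_lie, lie_add]; ring
  lie_self u := by
    have h : dualBracket u.2 u.2 = 0 := LinearMap.ext fun x => self_eq_neg.1 (LinearMap.congr_fun (dualBracket_skew u.2 u.2) x)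
    refine ext_iff' (fun ω => ?_) (fun x => ?_)
    · simp only [bracket_fst, lie_self, zero_sub, neg_add_cancel]; rfl
    · simp only [bracket_snd, h, sub_self]; rfl
  leibniz_lie u v w := by
    refine ext_iff' (fun ω => ?_) (fun t => ?_)
    · simp only [bracket_fst, bracket_snd, add_fst, map_add, map_sub, lie_add, lie_sub, add_lie,
        sub_lie, apply_contract, db_add_left, db_sub_left, LinearMap.add_apply, LinearMap.sub_apply,
        dualBracket_lie, apply_lie_contract, apply_contract_lie, apply_db_contract]
      have j1 := congrArg ω (leibniz_lie u.1 v.1 w.1)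
      rw [map_add] at j1
      linear_combination j1 + db_leibniz v.2 w.2 ω u.1 + db_leibniz u.2 v.2 ω w.1
        - db_leibniz u.2 w.2 ω v.1
    · simp only [bracket_fst, bracket_snd, add_snd, lie_sub, lie_add, add_lie,
        sub_lie, apply_contract, db_add_left, db_sub_left, db_add_right, db_sub_right, LinearMap.add_apply, LinearMap.sub_apply,
        lie_db_apply, contract_lie_apply]
      have j1 := congrArg (fun f : Module.Dual k 𝔥 => f t) (leibniz_lie u.1 v.1 w.2)
      have j2 := congrArg (fun f : Module.Dual k 𝔥 => f t) (leibniz_lie u.1 w.1 v.2)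
      have j3 := congrArg (fun f : Module.Dual k 𝔥 => f t) (leibniz_lie v.1 w.1 u.2)
      simp only [LinearMap.add_apply] at j1 j2 j3
      have sk (α β : Module.Dual k 𝔥) (y : 𝔥) := LinearMap.congr_fun (dualBracket_skew α β) y
      simp only [LinearMap.neg_apply] at sk
      rw [dualBracket_lie v.2 w.2, dualBracket_lie u.2 v.2, dualBracket_lie u.2 w.2]
      linear_combination j1 - j2 + j3 - db_leibniz u.2 v.2 w.2 t + sk ⁅t, v.2⁆ w.2 u.1
        - sk ⁅t, u.2⁆ w.2 v.1 + sk ⁅t, u.2⁆ v.2 w.1 - sk ⁅w.1, u.2⁆ v.2 t 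

noncomputable instance : LieAlgebra k (LieDouble k 𝔥) where
  lie_smul c u v := by
    refine ext_iff' (fun ω => ?_) (fun t => ?_)
    · simp only [bracket_fst, smul_fst, smul_snd, lie_smul, map_smul, map_add, map_sub,
        apply_contract, db_smul_left, LinearMap.smul_apply, smul_eq_mul]
      ring
    · simp only [bracket_snd, smul_fst, smul_snd, smul_lie, db_smul_right,
        LinearMap.smul_apply, LinearMap.sub_apply, smul_eq_mul, Module.Dual.lie_apply]
      ring

variable (k 𝔥) in
/-- The inclusion of `𝔥` in the double. -/
def ofLie : 𝔥 →ₗ[k] LieDouble k 𝔥 := LinearMap.inl k 𝔥 (Module.Dual k 𝔥)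

variable (k 𝔥) in
/-- The inclusion of `𝔥^*_{op}` in the double. -/
def ofDual : Module.Dual k 𝔥 →ₗ[k] LieDouble k 𝔥 := LinearMap.inr k 𝔥 (Module.Dual k 𝔥)

variable [FiniteDimensional k 𝔥]


variable (k 𝔥) in
/-- The canonical symmetric tensor `θ = 1/2 ∑ (h_i ⊗ η^i + η^i ⊗ h_i)` of the double. -/
noncomputable def canonicalTensor : LieDouble k 𝔥 ⊗[k] LieDouble k 𝔥 :=
  (2⁻¹ : k) • ∑ i, (ofLie k 𝔥 (Module.finBasis k 𝔥 i) ⊗ₜ ofDual k 𝔥 ((Module.finBasis k 𝔥).coord i) +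
    ofDual k 𝔥 ((Module.finBasis k 𝔥).coord i) ⊗ₜ ofLie k 𝔥 (Module.finBasis k 𝔥 i))

theorem lie_canonicalTensor (u : LieDouble k 𝔥) : ⁅u, canonicalTensor k 𝔥⁆ = 0 := by
  set b := Module.finBasis k 𝔥 with hb
  have H1 (A : 𝔥 →ₗ[k] 𝔥) : ∑ i, ofLie k 𝔥 (A (b i)) ⊗ₜ[k] ofDual k 𝔥 (b.coord i) =
      ∑ i, ofLie k 𝔥 (b i) ⊗ₜ[k] ofDual k 𝔥 (b.coord i ∘ₗ A) := by
    have h1 (i) : A (b i) = ∑ j, b.coord j (A (b i)) • b j := by simp [b.sum_repr]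
    have h2 (j) : b.coord j ∘ₗ A = ∑ i, b.coord j (A (b i)) • b.coord i :=
      (b.sum_dual_apply_smul_coord (b.coord j ∘ₗ A)).symm
    simp_rw [h2]
    conv_lhs => enter [2, i]; rw [h1]
    simp only [map_sum, map_smul, TensorProduct.sum_tmul, TensorProduct.tmul_sum,
      TensorProduct.smul_tmul, TensorProduct.tmul_smul]
    exact Finset.sum_comm
  have H1' (A : 𝔥 →ₗ[k] 𝔥) : ∑ i, ofDual k 𝔥 (b.coord i) ⊗ₜ[k] ofLie k 𝔥 (A (b i)) =
      ∑ i, ofDual k 𝔥 (b.coord i ∘ₗ A) ⊗ₜ[k] ofLie k 𝔥 (b i) := by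
    have := congrArg (TensorProduct.comm k _ _) (H1 A)
    simpa only [map_sum, TensorProduct.comm_tmul] using this
  have H2 (t : 𝔥 ⊗[k] 𝔥) : ∑ i, b i ⊗ₜ[k] contractTensor (b.coord i) t = t := by
    induction t with
    | zero => simp
    | tmul x y =>
      simp only [contractTensor_tmul, ← TensorProduct.smul_tmul, ← TensorProduct.sum_tmul]
      congr 1
      simp [b.sum_repr]
    | add s t hs ht => simp only [map_add, TensorProduct.tmul_add, Finset.sum_add_distrib, hs, ht]
  have H3 (ξ : Module.Dual k 𝔥) : ∑ i, ofDual k 𝔥 (b.coord i) ⊗ₜ[k] ofDual k 𝔥 ⁅b i, ξ⁆ =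
      - ∑ i, ofDual k 𝔥 ⁅b i, ξ⁆ ⊗ₜ[k] ofDual k 𝔥 (b.coord i) := by
    have h2 (i) : ⁅b i, ξ⁆ = ∑ j, (-ξ ⁅b i, b j⁆) • b.coord j := by
      exact (b.sum_dual_apply_smul_coord (⁅b i, ξ⁆ : Module.Dual k 𝔥)).symm
    simp_rw [h2]
    simp only [map_sum, map_smul, TensorProduct.sum_tmul, TensorProduct.tmul_sum,
      TensorProduct.smul_tmul, TensorProduct.tmul_smul]
    rw [Finset.sum_comm, ← Finset.sum_neg_distrib]
    refine Finset.sum_congr rfl fun i _ => ?_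
    rw [← Finset.sum_neg_distrib]
    refine Finset.sum_congr rfl fun j _ => ?_
    rw [← lie_skew (b j) (b i), map_neg, ← neg_smul]
  have H4 (x : 𝔥) : ∑ i, ofLie k 𝔥 (contractTensor (b.coord i) (cobracket x)) ⊗ₜ[k] ofLie k 𝔥 (b i) =
      - ∑ i, ofLie k 𝔥 (b i) ⊗ₜ[k] ofLie k 𝔥 (contractTensor (b.coord i) (cobracket x)) := by
    have h := congrArg (TensorProduct.map (ofLie k 𝔥) (ofLie k 𝔥)) (skew (k := k) x)
    rw [← H2 (cobracket x)] at h
    simpa only [map_neg, map_sum, TensorProduct.comm_tmul, TensorProduct.map_tmul] using h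
  let A : 𝔥 →ₗ[k] 𝔥 := LieModule.toEnd k 𝔥 𝔥 u.1 + contractTensor u.2 ∘ₗ cobracket
  have K1 (x : 𝔥) : ⁅u, ofLie k 𝔥 x⁆ = ofLie k 𝔥 (A x) - ofDual k 𝔥 ⁅x, u.2⁆ := by
    refine ext_iff' (fun ω => ?_) (fun t => ?_)
    · have e : (ofLie k 𝔥 (A x) - ofDual k 𝔥 ⁅x, u.2⁆).1 = A x - 0 := rfl
      have e1 : (ofLie k 𝔥 x).1 = x := rfl
      have e2 : (ofLie k 𝔥 x).2 = 0 := rfl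
      rw [bracket_fst, e, e1, e2]
      simp [A, contractTensor]
    · have e : (ofLie k 𝔥 (A x) - ofDual k 𝔥 ⁅x, u.2⁆).2 = 0 - ⁅x, u.2⁆ := rfl
      have e1 : (ofLie k 𝔥 x).1 = x := rfl
      have e2 : (ofLie k 𝔥 x).2 = 0 := rfl
      rw [bracket_snd, e, e1, e2]
      simp [dualBracket, pairTensor]
  have K2 (ξ : Module.Dual k 𝔥) : ⁅u, ofDual k 𝔥 ξ⁆ = - ofDual k 𝔥 (ξ ∘ₗ A) -
      ofLie k 𝔥 (contractTensor ξ (cobracket u.1)) := by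
    have e1 : (ofDual k 𝔥 ξ).1 = 0 := rfl
    have e2 : (ofDual k 𝔥 ξ).2 = ξ := rfl
    refine ext_iff' (fun ω => ?_) (fun t => ?_)
    · have e : (- ofDual k 𝔥 (ξ ∘ₗ A) - ofLie k 𝔥 (contractTensor ξ (cobracket u.1))).1 =
        - 0 - contractTensor ξ (cobracket u.1) := rfl
      rw [bracket_fst, e, e1, e2]
      simp
    · have e : (- ofDual k 𝔥 (ξ ∘ₗ A) - ofLie k 𝔥 (contractTensor ξ (cobracket u.1))).2 =
        - (ξ ∘ₗ A) - 0 := rfl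
      rw [bracket_snd, e, e1, e2]
      simp [A, apply_contract]
      ring
  rw [canonicalTensor, lie_smul, lie_sum, ← hb]
  simp only [lie_add, TensorProduct.LieModule.lie_tmul_right, K1, K2, TensorProduct.sub_tmul,
    TensorProduct.tmul_sub, TensorProduct.neg_tmul, TensorProduct.tmul_neg,
    Finset.sum_add_distrib, Finset.sum_sub_distrib, Finset.sum_neg_distrib, H1, H1', H3, H4]
  rw [smul_eq_zero]
  right
  abel

end LieDouble
end LieBialgebra

/-! ### Action Lie algebroids and quotients -/

section ActionAlgebroid
variable {k 𝔞 L : Type*} [CommRing k] [LieRing 𝔞] [LieAlgebra k 𝔞] [CommRing L] [Algebra k L]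

/-- The Lie algebroid `L ⋊ 𝔞` of a Lie algebra `𝔞` acting on `L` by derivations. -/
def ActionAlgebroid (_ρ : 𝔞 →ₗ⁅k⁆ Derivation k L L) : Type _ := L ⊗[k] 𝔞

namespace ActionAlgebroid
variable (ρ : 𝔞 →ₗ⁅k⁆ Derivation k L L)

noncomputable instance : AddCommGroup (ActionAlgebroid ρ) :=
  inferInstanceAs (AddCommGroup (L ⊗[k] 𝔞))
noncomputable instance : Module k (ActionAlgebroid ρ) := inferInstanceAs (Module k (L ⊗[k] 𝔞))
noncomputable instance : Module L (ActionAlgebroid ρ) := inferInstanceAs (Module L (L ⊗[k] 𝔞))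
instance : IsScalarTower k L (ActionAlgebroid ρ) :=
  inferInstanceAs (IsScalarTower k L (L ⊗[k] 𝔞))

/-- The anchor, `f ⊗ ξ ↦ f • ρ ξ`. -/
noncomputable def anchor : L ⊗[k] 𝔞 →ₗ[L] Derivation k L L :=
  LinearMap.liftBaseChange L (ρ : 𝔞 →ₗ[k] Derivation k L L)

theorem anchor_tmul (f : L) (ξ : 𝔞) : anchor ρ (f ⊗ₜ ξ) = f • ρ ξ := by
  simp [anchor]

/-- The action of a derivation of `L` on `L ⊗ 𝔞`. -/
noncomputable def derAct (D : Derivation k L L) : L ⊗[k] 𝔞 →ₗ[k] L ⊗[k] 𝔞 :=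
  (D : L →ₗ[k] L).rTensor 𝔞

theorem derAct_tmul (D : Derivation k L L) (f : L) (ξ : 𝔞) :
    derAct D (f ⊗ₜ[k] ξ) = D f ⊗ₜ ξ := rfl

theorem derAct_add (D E : Derivation k L L) (F : L ⊗[k] 𝔞) :
    derAct (D + E) F = derAct D F + derAct E F := by
  simp [derAct, LinearMap.rTensor_add]

theorem derAct_neg (D : Derivation k L L) (F : L ⊗[k] 𝔞) :
    derAct (-D) F = - derAct D F := by
  simp [derAct, LinearMap.rTensor_neg]

theorem derAct_smul (f : L) (D : Derivation k L L) (F : L ⊗[k] 𝔞) :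
    derAct (f • D) F = f • derAct D F := by
  induction F with
  | zero => simp
  | tmul g ξ => simp [derAct_tmul, TensorProduct.smul_tmul']
  | add F G hF hG => simp only [map_add, hF, hG, smul_add]

theorem derAct_ksmul (c : k) (D : Derivation k L L) (F : L ⊗[k] 𝔞) :
    derAct (c • D) F = c • derAct D F := by
  simp [derAct, LinearMap.rTensor_smul]

theorem derAct_lie (D E : Derivation k L L) (F : L ⊗[k] 𝔞) :
    derAct ⁅D, E⁆ F = derAct D (derAct E F) - derAct E (derAct D F) := by
  induction F with
  | zero => simp
  | tmul g ξ => simp [derAct_tmul, Derivation.commutator_apply, TensorProduct.sub_tmul]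
  | add F G hF hG => simp only [map_add, hF, hG]; abel

theorem derAct_bracket (D : Derivation k L L) (F G : L ⊗[k] 𝔞) :
    derAct D ⁅F, G⁆ = ⁅derAct D F, G⁆ + ⁅F, derAct D G⁆ := by
  induction F with
  | zero => simp
  | add F F' hF hF' => simp only [map_add, add_lie, hF, hF']; abel
  | tmul f ξ =>
    induction G with
    | zero => simp
    | add F F' hF hF' => simp only [map_add, lie_add, hF, hF']; abel
    | tmul g η =>
      simp only [LieAlgebra.ExtendScalars.bracket_tmul, derAct_tmul, Derivation.leibniz,
        TensorProduct.add_tmul, smul_eq_mul, mul_comm g]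
      abel

theorem derAct_mul (D : Derivation k L L) (f : L) (F : L ⊗[k] 𝔞) :
    derAct D (f • F) = f • derAct D F + D f • F := by
  induction F with
  | zero => simp
  | tmul g ξ => simp [derAct_tmul, TensorProduct.smul_tmul', mul_comm g, TensorProduct.add_tmul]
  | add F G hF hG => simp only [map_add, hF, hG, smul_add]; abel

/-- The bracket of `L ⋊ 𝔞`:
`⁅f ⊗ ξ, g ⊗ η⁆ = f g ⊗ ⁅ξ, η⁆ + f (ξ ▹ g) ⊗ η - g (η ▹ f) ⊗ ξ`, see `algBracket_tmul`. -/
noncomputable def algBracket (F G : L ⊗[k] 𝔞) : L ⊗[k] 𝔞 :=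
  ⁅F, G⁆ + derAct (anchor ρ F) G - derAct (anchor ρ G) F

theorem algBracket_tmul (f g : L) (ξ η : 𝔞) :
    algBracket ρ (f ⊗ₜ ξ) (g ⊗ₜ η) =
      (f * g) ⊗ₜ ⁅ξ, η⁆ + (f * ρ ξ g) ⊗ₜ η - (g * ρ η f) ⊗ₜ ξ := by
  simp only [algBracket, LieAlgebra.ExtendScalars.bracket_tmul, anchor_tmul, derAct_tmul,
    Derivation.smul_apply, smul_eq_mul]

theorem algBracket_add_left (F G H : L ⊗[k] 𝔞) :
    algBracket ρ (F + G) H = algBracket ρ F H + algBracket ρ G H := by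
  simp only [algBracket, add_lie, map_add, derAct_add]
  abel

theorem algBracket_self (F : L ⊗[k] 𝔞) : algBracket ρ F F = 0 := by
  simp [algBracket]

theorem algBracket_add_right (F G H : L ⊗[k] 𝔞) :
    algBracket ρ F (G + H) = algBracket ρ F G + algBracket ρ F H := by
  simp only [algBracket, lie_add, map_add, derAct_add]
  abel

theorem anchor_bracket (F G : L ⊗[k] 𝔞) :
    anchor ρ (algBracket ρ F G) = ⁅anchor ρ F, anchor ρ G⁆ := by
  induction F with
  | zero => simp [algBracket, derAct]
  | add F F' hF hF' => rw [algBracket_add_left, map_add, hF, hF', map_add, add_lie]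
  | tmul f ξ =>
    induction G with
    | zero => simp [algBracket, derAct]
    | add F F' hF hF' => rw [algBracket_add_right, map_add, hF, hF', map_add, lie_add]
    | tmul g η =>
      rw [algBracket_tmul]
      simp only [map_add, map_sub, anchor_tmul, LieHom.map_lie]
      ext h
      simp only [Derivation.coe_add, Derivation.coe_sub, Derivation.coe_smul, Pi.add_apply,
        Pi.sub_apply, Pi.smul_apply, Derivation.commutator_apply, smul_eq_mul, Derivation.leibniz]
      ring

theorem algBracket_leibniz (F G H : L ⊗[k] 𝔞) : algBracket ρ F (algBracket ρ G H) =
    algBracket ρ (algBracket ρ F G) H + algBracket ρ G (algBracket ρ F H) := by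
  have h (F G H : L ⊗[k] 𝔞) : algBracket ρ F (algBracket ρ G H) =
      ⁅F, algBracket ρ G H⁆ + derAct (anchor ρ F) (algBracket ρ G H)
        - derAct ⁅anchor ρ G, anchor ρ H⁆ F := by
    rw [← anchor_bracket]; rfl
  have h' (F G H : L ⊗[k] 𝔞) : algBracket ρ (algBracket ρ F G) H =
      ⁅algBracket ρ F G, H⁆ + derAct ⁅anchor ρ F, anchor ρ G⁆ H
        - derAct (anchor ρ H) (algBracket ρ F G) := by
    rw [← anchor_bracket]; rfl
  rw [h, h, h']
  simp only [algBracket, lie_add, lie_sub, add_lie, sub_lie, map_add, map_sub, derAct_lie,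
    derAct_bracket]
  rw [leibniz_lie F G H, ← lie_skew G (derAct (anchor ρ H) F),
    ← lie_skew (derAct (anchor ρ G) F) H, ← lie_skew G (derAct (anchor ρ F) H),
    ← lie_skew F (derAct (anchor ρ H) G)]
  abel

noncomputable instance : LieRing (ActionAlgebroid ρ) where
  bracket F G := algBracket ρ F G
  add_lie F G H := algBracket_add_left ρ F G H
  lie_add F G H := algBracket_add_right ρ F G H
  lie_self F := algBracket_self ρ F
  leibniz_lie F G H := algBracket_leibniz ρ F G H

theorem anchor_ksmul (c : k) (F : L ⊗[k] 𝔞) : anchor ρ (c • F) = c • anchor ρ F := by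
  rw [← algebraMap_smul L c F, map_smul, algebraMap_smul]

theorem algBracket_ksmul (c : k) (F G : L ⊗[k] 𝔞) :
    algBracket ρ F (c • G) = c • algBracket ρ F G := by
  have e : ⁅F, c • G⁆ = c • ⁅F, G⁆ := by
    rw [← algebraMap_smul L c, lie_smul, algebraMap_smul]
  rw [algBracket, anchor_ksmul, e, derAct_ksmul, map_smul, algBracket, smul_sub, smul_add]

theorem algBracket_smul (a : L) (F G : L ⊗[k] 𝔞) :
    algBracket ρ F (a • G) = a • algBracket ρ F G + anchor ρ F a • G := by
  rw [algBracket, lie_smul, derAct_mul, map_smul, derAct_smul, algBracket, smul_sub, smul_add]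
  abel

noncomputable instance : LieAlgebra k (ActionAlgebroid ρ) where
  lie_smul c F G := algBracket_ksmul ρ c F G

noncomputable instance : LieRingModule (ActionAlgebroid ρ) L where
  bracket F f := anchor ρ F f
  add_lie F G f := DFunLike.congr_fun (map_add (anchor ρ) F G) f
  lie_add F f g := map_add (anchor ρ F) f g
  leibniz_lie F G f :=
    eq_add_of_sub_eq (DFunLike.congr_fun (anchor_bracket ρ F G) f).symm

instance : LieRinehartRing L (ActionAlgebroid ρ) where
  lie_smul_eq_mul' a b F := DFunLike.congr_fun (map_smul (anchor ρ) a F) b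
  leibniz_mul_right' F a b :=
    ((anchor ρ F).leibniz a b).trans (congrArg (a • anchor ρ F b + ·) (mul_comm b _))
  leibniz_smul_right' F G a := algBracket_smul ρ a F G

instance : LieRinehartAlgebra k L (ActionAlgebroid ρ) where
  smul_lie c F f := DFunLike.congr_fun (anchor_ksmul ρ c F) f
  lie_smul c F f := (anchor ρ F).map_smul c f

/-- The constant section `1 ⊗ ξ`. -/
noncomputable def const : 𝔞 →ₗ[k] ActionAlgebroid ρ := TensorProduct.mk k L 𝔞 1

@[elab_as_elim]
theorem induction_smul_const {p : ActionAlgebroid ρ → Prop} (x : ActionAlgebroid ρ) (zero : p 0)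
    (add : ∀ x y, p x → p y → p (x + y)) (smul_const : ∀ (f : L) (ξ : 𝔞), p (f • const ρ ξ)) :
    p x := by
  have h (f : L) (ξ : 𝔞) : (f ⊗ₜ[k] ξ : L ⊗[k] 𝔞) = f • ((1 : L) ⊗ₜ[k] ξ) := by
    rw [TensorProduct.smul_tmul', smul_eq_mul, mul_one]
  exact TensorProduct.induction_on (motive := fun t : L ⊗[k] 𝔞 => p t) x zero
    (fun f ξ => by rw [h]; exact smul_const f ξ) (fun x y hx hy => add x y hx hy)

end ActionAlgebroid
end ActionAlgebroid

section QuotientAlgebroid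
variable {k L B : Type*} [CommRing k] [CommRing L] [Algebra k L] [LieRing B]
  [LieAlgebra k B] [Module L B] [LieRingModule B L] [LieRinehartRing L B]
  [LieRinehartAlgebra k L B]

variable (L B) in
/-- An ideal of a Lie algebroid in the kernel of the anchor. -/
structure AlgebroidIdeal extends Submodule L B where
  lie_mem' : ∀ x y : B, y ∈ carrier → ⁅x, y⁆ ∈ carrier
  anchor_eq_zero' : ∀ y ∈ carrier, ∀ f : L, ⁅y, f⁆ = 0

/-- The quotient of a Lie algebroid by such an ideal, again a Lie algebroid. -/
def AlgebroidIdeal.Quotient (J : AlgebroidIdeal L B) : Type _ := B ⧸ J.toSubmodule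

namespace AlgebroidIdeal.Quotient
variable (J : AlgebroidIdeal L B)

instance : AddCommGroup J.Quotient := inferInstanceAs (AddCommGroup (B ⧸ J.toSubmodule))
instance : Module L J.Quotient := inferInstanceAs (Module L (B ⧸ J.toSubmodule))
instance : Module k J.Quotient := inferInstanceAs (Module k (B ⧸ J.toSubmodule))
instance : IsScalarTower k L J.Quotient := inferInstanceAs (IsScalarTower k L (B ⧸ J.toSubmodule))

/-- The projection to the quotient. -/
def mk : B →ₗ[L] J.Quotient := J.toSubmodule.mkQ

theorem mk_surjective : Function.Surjective (mk J) := J.toSubmodule.mkQ_surjective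

theorem mk_eq_iff (x y : B) : mk J x = mk J y ↔ x - y ∈ J.toSubmodule :=
  Submodule.Quotient.eq J.toSubmodule

theorem lie_right_mem (x y : B) (hx : x ∈ J.toSubmodule) : ⁅x, y⁆ ∈ J.toSubmodule := by
  rw [← lie_skew]
  exact J.toSubmodule.neg_mem (J.lie_mem' y x hx)

instance : Bracket J.Quotient J.Quotient where
  bracket := Quotient.map₂ (fun x y => ⁅x, y⁆) (by
    intro x x' hx y y' hy
    have hx' : x - x' ∈ J.toSubmodule := (Submodule.quotientRel_def _).1 hx
    have hy' : y - y' ∈ J.toSubmodule := (Submodule.quotientRel_def _).1 hy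
    refine (Submodule.quotientRel_def _).2 ?_
    have : ⁅x, y⁆ - ⁅x', y'⁆ = ⁅x - x', y⁆ + ⁅x', y - y'⁆ := by
      rw [sub_lie, lie_sub]; abel
    rw [this]
    exact J.toSubmodule.add_mem (lie_right_mem J _ _ hx') (J.lie_mem' _ _ hy'))

theorem mk_lie (x y : B) : mk J ⁅x, y⁆ = ⁅mk J x, mk J y⁆ := rfl

instance : LieRing J.Quotient where
  add_lie x y z := by
    obtain ⟨x, rfl⟩ := mk_surjective J x
    obtain ⟨y, rfl⟩ := mk_surjective J y
    obtain ⟨z, rfl⟩ := mk_surjective J z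
    simp only [← map_add, ← mk_lie, add_lie]
  lie_add x y z := by
    obtain ⟨x, rfl⟩ := mk_surjective J x
    obtain ⟨y, rfl⟩ := mk_surjective J y
    obtain ⟨z, rfl⟩ := mk_surjective J z
    simp only [← map_add, ← mk_lie, lie_add]
  lie_self x := by
    obtain ⟨x, rfl⟩ := mk_surjective J x
    rw [← mk_lie, lie_self, map_zero]
  leibniz_lie x y z := by
    obtain ⟨x, rfl⟩ := mk_surjective J x
    obtain ⟨y, rfl⟩ := mk_surjective J y
    obtain ⟨z, rfl⟩ := mk_surjective J z
    simp only [← map_add, ← mk_lie]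
    rw [leibniz_lie]

theorem mk_ksmul (c : k) (x : B) : mk J (c • x) = c • mk J x := rfl

instance : LieAlgebra k J.Quotient where
  lie_smul c x y := by
    obtain ⟨x, rfl⟩ := mk_surjective J x
    obtain ⟨y, rfl⟩ := mk_surjective J y
    simp only [← mk_ksmul, ← mk_lie, lie_smul]

instance : Bracket J.Quotient L where
  bracket x f := Quotient.liftOn x (fun x => ⁅x, f⁆) (by
    intro x y h
    have h' : x - y ∈ J.toSubmodule := (Submodule.quotientRel_def _).1 h
    have := J.anchor_eq_zero' _ h' f
    rw [sub_lie] at this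
    exact sub_eq_zero.1 this)

theorem mk_anchor (x : B) (f : L) : ⁅mk J x, f⁆ = ⁅x, f⁆ := rfl

instance : LieRingModule J.Quotient L where
  add_lie x y f := by
    obtain ⟨x, rfl⟩ := mk_surjective J x
    obtain ⟨y, rfl⟩ := mk_surjective J y
    simp only [← map_add, mk_anchor, add_lie]
  lie_add x f g := by
    obtain ⟨x, rfl⟩ := mk_surjective J x
    simp only [mk_anchor, lie_add]
  leibniz_lie x y f := by
    obtain ⟨x, rfl⟩ := mk_surjective J x
    obtain ⟨y, rfl⟩ := mk_surjective J y
    simp only [← mk_lie, mk_anchor]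
    rw [leibniz_lie]

instance : LieRinehartRing L J.Quotient where
  lie_smul_eq_mul' a b x := by
    obtain ⟨x, rfl⟩ := mk_surjective J x
    rw [← map_smul, mk_anchor, mk_anchor, LieRinehartRing.lie_smul_eq_mul]
  leibniz_mul_right' x a b := by
    obtain ⟨x, rfl⟩ := mk_surjective J x
    simp only [mk_anchor, LieRinehartRing.leibniz_mul_right]
  leibniz_smul_right' x y a := by
    obtain ⟨x, rfl⟩ := mk_surjective J x
    obtain ⟨y, rfl⟩ := mk_surjective J y
    simp only [← map_smul, ← mk_lie, mk_anchor, LieRinehartRing.leibniz_smul_right, map_add]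

instance : LieRinehartAlgebra k L J.Quotient where
  smul_lie c x f := by
    obtain ⟨x, rfl⟩ := mk_surjective J x
    rw [← mk_ksmul, mk_anchor, mk_anchor, smul_lie]
  lie_smul c x f := by
    obtain ⟨x, rfl⟩ := mk_surjective J x
    rw [mk_anchor, mk_anchor, lie_smul]

end AlgebroidIdeal.Quotient
end QuotientAlgebroid

/-! ### Poisson base algebras, dynamical r-matrices and the bivector -/

section Dynamical

/-- The evaluation `ξ ↦ ξ ▹ f`. -/
def evalAction {k 𝔞 L : Type*} [CommRing k] [LieRing 𝔞] [LieAlgebra k 𝔞] [CommRing L] [Algebra k L]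
    (ρ : 𝔞 →ₗ⁅k⁆ Derivation k L L) (f : L) : 𝔞 →ₗ[k] L where
  toFun ξ := ρ ξ f
  map_add' ξ η := by simp
  map_smul' c ξ := by simp

/-- A structure of Poisson `𝔥`-base algebra on the commutative algebra `L`: an action of the double
`𝔇𝔥` by derivations on which the canonical symmetric tensor vanishes,
`(θ₁ ▹ f) (θ₂ ▹ g) = 0` for all `f` and `g`. -/
structure PoissonBaseAlgebra (k 𝔥 L : Type*) [Field k] [CharZero k] [LieRing 𝔥] [LieAlgebra k 𝔥]
    [LieBialgebra k 𝔥] [FiniteDimensional k 𝔥] [CommRing L] [Algebra k L] where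
  action : LieDouble k 𝔥 →ₗ⁅k⁆ Derivation k L L
  canonicalTensor_vanishes : ∀ f g : L,
    LinearMap.mul' k L (TensorProduct.map (evalAction action f) (evalAction action g)
      (LieDouble.canonicalTensor k 𝔥)) = 0

namespace PoissonBaseAlgebra

variable {k 𝔥 L : Type*} [Field k] [CharZero k] [LieRing 𝔥] [LieAlgebra k 𝔥]
  [LieBialgebra k 𝔥] [FiniteDimensional k 𝔥] [CommRing L] [Algebra k L]
  (P : PoissonBaseAlgebra k 𝔥 L)

/-- The action of `u` in the double on `L ⊗ M`, through `L`. -/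
noncomputable def act (u : LieDouble k 𝔥) (M : Type*) [AddCommGroup M] [Module k M] :
    L ⊗[k] M →ₗ[k] L ⊗[k] M :=
  (P.action u : L →ₗ[k] L).rTensor M

/-- `𝔥^*_{op}` acts effectively on `L`: the anchor of `L ⋊ 𝔥^*_{op}` is injective, that is, a section
`∑ f_i ⊗ η^i` of `L ⊗ 𝔥^*` that acts by zero on `L` is zero. -/
def DualActsEffectively : Prop :=
  Function.Injective (LinearMap.liftBaseChange L
    ((P.action : LieDouble k 𝔥 →ₗ[k] Derivation k L L) ∘ₗ LieDouble.ofDual k 𝔥))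

variable (𝔤 : Type*) [LieRing 𝔤] [LieAlgebra k 𝔤]

/-- The action of `𝔤 ⊕ 𝔇𝔥` on `L`, trivial on `𝔤`. -/
noncomputable def totalAction : 𝔤 × LieDouble k 𝔥 →ₗ⁅k⁆ Derivation k L L :=
  P.action.comp (LieHom.snd k 𝔤 (LieDouble k 𝔥))

/-- The map `u ⊗ v ↦ (u ▹ f) ⊗ v` to `L ⋊ (𝔤 ⊕ 𝔇𝔥)`. -/
noncomputable def section₀ (f : L) :
    LieDouble k 𝔥 ⊗[k] LieDouble k 𝔥 →ₗ[k] ActionAlgebroid (P.totalAction 𝔤) :=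
  TensorProduct.map (evalAction P.action f) (LinearMap.inr k 𝔤 (LieDouble k 𝔥))

theorem section₀_anchor (f g : L) (t : LieDouble k 𝔥 ⊗[k] LieDouble k 𝔥) :
    ⁅P.section₀ 𝔤 f t, g⁆ =
      LinearMap.mul' k L (TensorProduct.map (evalAction P.action f) (evalAction P.action g) t) := by
  induction t with
  | zero => simp
  | tmul u v =>
    change ActionAlgebroid.anchor _ _ g = _
    rw [show P.section₀ 𝔤 f (u ⊗ₜ v) = (P.action u f) ⊗ₜ[k] ((0 : 𝔤), v) from rfl,
      ActionAlgebroid.anchor_tmul]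
    rfl
  | add s t hs ht => rw [map_add, add_lie, hs, ht, map_add, map_add]

theorem const_section₀ (f : L) (ξ : 𝔤 × LieDouble k 𝔥) (t : LieDouble k 𝔥 ⊗[k] LieDouble k 𝔥) :
    ⁅ActionAlgebroid.const (P.totalAction 𝔤) ξ, P.section₀ 𝔤 f t⁆ =
      P.section₀ 𝔤 (P.action ξ.2 f) t + P.section₀ 𝔤 f ⁅ξ.2, t⁆ := by
  induction t with
  | zero => simp
  | tmul u v =>
    refine (ActionAlgebroid.algBracket_tmul (P.totalAction 𝔤) 1 (P.action u f) ξ (0, v)).trans ?_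
    rw [TensorProduct.LieModule.lie_tmul_right, map_add]
    change _ = (P.action u (P.action ξ.2 f)) ⊗ₜ[k] ((0 : 𝔤), v) +
      ((P.action ⁅ξ.2, u⁆ f) ⊗ₜ[k] ((0 : 𝔤), v) + (P.action u f) ⊗ₜ[k] ((0 : 𝔤), ⁅ξ.2, v⁆))
    have e : ⁅ξ, ((0 : 𝔤), v)⁆ = ((0 : 𝔤), ⁅ξ.2, v⁆) := Prod.ext (lie_zero _) rfl
    have e' : P.totalAction 𝔤 ξ (P.action u f) = P.action ξ.2 (P.action u f) := rfl
    rw [e, e', one_mul, one_mul, Derivation.map_one_eq_zero, mul_zero, TensorProduct.zero_tmul,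
      sub_zero, LieHom.map_lie, Derivation.commutator_apply, TensorProduct.sub_tmul]
    abel
  | add s t hs ht =>
    rw [map_add, lie_add, hs, ht, lie_add, map_add, map_add]
    abel

/-- The ideal `J₀` of `L ⋊ (𝔤 ⊕ 𝔇𝔥)`: the `L`-submodule generated by the sections
`(θ₁ ▹ f) ⊗ θ₂` of `L ⋊ 𝔇𝔥`. -/
noncomputable def J₀ : AlgebroidIdeal L (ActionAlgebroid (P.totalAction 𝔤)) where
  toSubmodule := Submodule.span L
    (Set.range fun f => P.section₀ 𝔤 f (LieDouble.canonicalTensor k 𝔥))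
  anchor_eq_zero' y hy f := by
    change y ∈ Submodule.span L _ at hy
    induction hy using Submodule.span_induction with
    | mem y hy =>
      obtain ⟨g, rfl⟩ := hy
      rw [section₀_anchor, P.canonicalTensor_vanishes]
    | zero => exact zero_lie _
    | add x y _ _ hx hy => rw [add_lie, hx, hy, add_zero]
    | smul a x _ hx => rw [LieRinehartRing.lie_smul_eq_mul, hx, mul_zero]
  lie_mem' x y hy := by
    change y ∈ Submodule.span L _ at hy
    change _ ∈ Submodule.span L _
    have hgen (x : ActionAlgebroid (P.totalAction 𝔤)) (g : L) :
        ⁅x, P.section₀ 𝔤 g (LieDouble.canonicalTensor k 𝔥)⁆ ∈ Submodule.span L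
          (Set.range fun f => P.section₀ 𝔤 f (LieDouble.canonicalTensor k 𝔥)) := by
      induction x using ActionAlgebroid.induction_smul_const with
      | zero => rw [zero_lie]; exact Submodule.zero_mem _
      | add x y hx hy => rw [add_lie]; exact Submodule.add_mem _ hx hy
      | smul_const f ξ =>
        rw [← lie_skew, LieRinehartRing.leibniz_smul_right, section₀_anchor,
          P.canonicalTensor_vanishes, zero_smul, add_zero, ← smul_neg, lie_skew, const_section₀,
          LieDouble.lie_canonicalTensor, map_zero, add_zero]
        exact Submodule.smul_mem _ _ (Submodule.subset_span ⟨_, rfl⟩)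
    induction hy using Submodule.span_induction with
    | mem y hy =>
      obtain ⟨g, rfl⟩ := hy
      exact hgen x g
    | zero => rw [lie_zero]; exact Submodule.zero_mem _
    | add y z _ _ hy hz => rw [lie_add]; exact Submodule.add_mem _ hy hz
    | smul a y h hy =>
      rw [LieRinehartRing.leibniz_smul_right]
      exact Submodule.add_mem _ (Submodule.smul_mem _ _ hy) (Submodule.smul_mem _ _ h)

/-- The Lie algebroid `(𝔤 ⊕ 𝔇𝔥)_L = (L ⊗ 𝔤) ⊕ (L ⋊ 𝔇𝔥) / J₀`. -/
abbrev Algebroid : Type _ := (P.J₀ 𝔤).Quotient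

/-- The constant section of `(𝔤 ⊕ 𝔇𝔥)_L` given by `ξ`, in the exterior algebra. -/
noncomputable def sec : 𝔤 × LieDouble k 𝔥 →ₗ[k] ExteriorAlgebra L (P.Algebroid 𝔤) :=
  (ExteriorAlgebra.ι L ∘ₗ AlgebroidIdeal.Quotient.mk (P.J₀ 𝔤)).restrictScalars k ∘ₗ
    ActionAlgebroid.const (P.totalAction 𝔤)

/-- The map `f ⊗ (a ⊗ b) ↦ f • (a ∧ b)` from `L ⊗ 𝔤 ⊗ 𝔤` to the exterior algebra of `(𝔤 ⊕ 𝔇𝔥)_L`.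
On skew-symmetric tensors it is the identification for which `a ∧ b` corresponds to
`1/2 (a ⊗ b - b ⊗ a)`. -/
noncomputable def toBivector : L ⊗[k] (𝔤 ⊗[k] 𝔤) →ₗ[k] ExteriorAlgebra L (P.Algebroid 𝔤) :=
  TensorProduct.lift
    ((Algebra.lsmul k k (ExteriorAlgebra L (P.Algebroid 𝔤))).toLinearMap.compl₂
      (LinearMap.mul' k (ExteriorAlgebra L (P.Algebroid 𝔤)) ∘ₗ
        TensorProduct.map (P.sec 𝔤 ∘ₗ LinearMap.inl k 𝔤 (LieDouble k 𝔥))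
          (P.sec 𝔤 ∘ₗ LinearMap.inl k 𝔤 (LieDouble k 𝔥))))

theorem toBivector_tmul (f : L) (a b : 𝔤) :
    P.toBivector 𝔤 (f ⊗ₜ (a ⊗ₜ b)) = f • (P.sec 𝔤 (a, 0) * P.sec 𝔤 (b, 0)) := rfl

end PoissonBaseAlgebra

section RMatrix

variable {k 𝔤 L : Type*} [Field k] [CharZero k] [LieRing 𝔤] [LieAlgebra k 𝔤] [CommRing L]
  [Algebra k L]

/-- The skew-symmetric elements of `L ⊗ 𝔤 ⊗ 𝔤`, that is, the elements of `L ⊗ ⋀²𝔤`. -/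
def IsBivector (r : L ⊗[k] (𝔤 ⊗[k] 𝔤)) : Prop :=
  (TensorProduct.comm k 𝔤 𝔤).toLinearMap.lTensor L r = -r

/-- The skew-symmetric elements of `L ⊗ 𝔤 ⊗ 𝔤 ⊗ 𝔤`, that is, the elements of `L ⊗ ⋀³𝔤`. -/
def IsTrivector (φ : L ⊗[k] (𝔤 ⊗[k] (𝔤 ⊗[k] 𝔤))) : Prop :=
  (TensorProduct.leftComm k 𝔤 𝔤 𝔤).toLinearMap.lTensor L φ = -φ ∧
    ((TensorProduct.comm k 𝔤 𝔤).toLinearMap.lTensor 𝔤).lTensor L φ = -φ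

variable (k 𝔤) in
/-- The Lie bracket of `𝔤` as a bilinear map. -/
def lieBilin : 𝔤 →ₗ[k] 𝔤 →ₗ[k] 𝔤 := LieModule.toEnd k 𝔤 𝔤

variable (k 𝔤) in
/-- `(a ⊗ b, c ⊗ d) ↦ [(a ⊗ b)₁₂, (c ⊗ d)₁₃] = ⁅a, c⁆ ⊗ b ⊗ d`. -/
noncomputable def bracket₁₂₁₃ : 𝔤 ⊗[k] 𝔤 →ₗ[k] 𝔤 ⊗[k] 𝔤 →ₗ[k] 𝔤 ⊗[k] (𝔤 ⊗[k] 𝔤) :=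
  TensorProduct.map₂ (lieBilin k 𝔤) (TensorProduct.mk k 𝔤 𝔤)

variable (k 𝔤) in
/-- `(a ⊗ b, c ⊗ d) ↦ [(a ⊗ b)₁₃, (c ⊗ d)₂₃] = a ⊗ c ⊗ ⁅b, d⁆`. -/
noncomputable def bracket₁₃₂₃ : 𝔤 ⊗[k] 𝔤 →ₗ[k] 𝔤 ⊗[k] 𝔤 →ₗ[k] 𝔤 ⊗[k] (𝔤 ⊗[k] 𝔤) :=
  (TensorProduct.map₂ (TensorProduct.mk k 𝔤 𝔤) (lieBilin k 𝔤)).compr₂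
    (TensorProduct.assoc k 𝔤 𝔤 𝔤).toLinearMap

variable (k 𝔤) in
/-- `(a ⊗ b, c ⊗ d) ↦ [(a ⊗ b)₁₂, (c ⊗ d)₂₃] = a ⊗ ⁅b, c⁆ ⊗ d`. -/
noncomputable def bracket₁₂₂₃ : 𝔤 ⊗[k] 𝔤 →ₗ[k] 𝔤 ⊗[k] 𝔤 →ₗ[k] 𝔤 ⊗[k] (𝔤 ⊗[k] 𝔤) :=
  ((bracket₁₂₁₃ k 𝔤).compr₂ (TensorProduct.leftComm k 𝔤 𝔤 𝔤).toLinearMap) ∘ₗ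
    (TensorProduct.comm k 𝔤 𝔤).toLinearMap

theorem bracket₁₂₁₃_tmul (a b c d : 𝔤) :
    bracket₁₂₁₃ k 𝔤 (a ⊗ₜ b) (c ⊗ₜ d) = ⁅a, c⁆ ⊗ₜ (b ⊗ₜ d) := rfl

theorem bracket₁₃₂₃_tmul (a b c d : 𝔤) :
    bracket₁₃₂₃ k 𝔤 (a ⊗ₜ b) (c ⊗ₜ d) = a ⊗ₜ (c ⊗ₜ ⁅b, d⁆) := rfl

theorem bracket₁₂₂₃_tmul (a b c d : 𝔤) :
    bracket₁₂₂₃ k 𝔤 (a ⊗ₜ b) (c ⊗ₜ d) = a ⊗ₜ (⁅b, c⁆ ⊗ₜ d) := rfl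

/-- The Yang-Baxter operator `CYB(r) = [r₁₂, r₁₃] + [r₁₃, r₂₃] + [r₁₂, r₂₃]`, where functions are
multiplied. -/
noncomputable def CYB (r : L ⊗[k] (𝔤 ⊗[k] 𝔤)) : L ⊗[k] (𝔤 ⊗[k] (𝔤 ⊗[k] 𝔤)) :=
  TensorProduct.map₂ (LinearMap.mul k L)
    (bracket₁₂₁₃ k 𝔤 + bracket₁₃₂₃ k 𝔤 + bracket₁₂₂₃ k 𝔤) r r

variable (k 𝔤) in
/-- `Alt(a ⊗ b ⊗ c) = a ⊗ b ⊗ c - b ⊗ a ⊗ c + b ⊗ c ⊗ a`. -/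
noncomputable def Alt : 𝔤 ⊗[k] (𝔤 ⊗[k] 𝔤) →ₗ[k] 𝔤 ⊗[k] (𝔤 ⊗[k] 𝔤) :=
  LinearMap.id - (TensorProduct.leftComm k 𝔤 𝔤 𝔤).toLinearMap +
    (TensorProduct.assoc k 𝔤 𝔤 𝔤).toLinearMap ∘ₗ (TensorProduct.comm k 𝔤 (𝔤 ⊗[k] 𝔤)).toLinearMap

theorem Alt_tmul (a b c : 𝔤) : Alt k 𝔤 (a ⊗ₜ (b ⊗ₜ c)) =
    a ⊗ₜ (b ⊗ₜ c) - b ⊗ₜ (a ⊗ₜ c) + b ⊗ₜ (c ⊗ₜ a) := rfl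

variable {𝔥 : LieSubalgebra k 𝔤} [FiniteDimensional k 𝔥] [LieBialgebra k 𝔥]
  (P : PoissonBaseAlgebra k 𝔥 L)

/-- The elements of `(L ⊗ ⋀³𝔤)^{𝔤 ⊕ 𝔇𝔥}`: here `𝔤` acts on `⋀³𝔤` and `𝔇𝔥` acts on `L`. -/
structure IsInvariantTrivector (φ : L ⊗[k] (𝔤 ⊗[k] (𝔤 ⊗[k] 𝔤))) : Prop where
  isTrivector : IsTrivector φ
  lie_invariant : ∀ x : 𝔤, (LieModule.toEnd k 𝔤 (𝔤 ⊗[k] (𝔤 ⊗[k] 𝔤)) x).lTensor L φ = 0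
  double_invariant : ∀ u : LieDouble k 𝔥, P.act u _ φ = 0

/-- The term `∑ Alt(h_i ⊗ η^i ▹ r)`. -/
noncomputable def dynamicalTerm (r : L ⊗[k] (𝔤 ⊗[k] 𝔤)) : L ⊗[k] (𝔤 ⊗[k] (𝔤 ⊗[k] 𝔤)) :=
  ∑ i, (Alt k 𝔤 ∘ₗ TensorProduct.mk k 𝔤 (𝔤 ⊗[k] 𝔤) (Module.finBasis k 𝔥 i : 𝔤)).lTensor L
    (P.act (LieDouble.ofDual k 𝔥 ((Module.finBasis k 𝔥).coord i)) _ r)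

/-- Classical dynamical r-matrices over the Poisson base algebra `L` with values in `⋀²𝔤`. -/
structure IsClassicalDynamicalRMatrix (r : L ⊗[k] (𝔤 ⊗[k] 𝔤)) : Prop where
  isBivector : IsBivector r
  equivariance : ∀ h : 𝔥, P.act (LieDouble.ofLie k 𝔥 h) _ r +
      (LieModule.toEnd k 𝔤 (𝔤 ⊗[k] 𝔤) (h : 𝔤)).lTensor L r =
    1 ⊗ₜ TensorProduct.map 𝔥.subtype 𝔥.subtype (LieBialgebra.cobracket (k := k) h)
  yangBaxter : ∃ φ, IsInvariantTrivector P φ ∧ dynamicalTerm P r - CYB r = φ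

/-- `ϖ = ∑ η^i ∧ h_i`, with `h_i` in the double. -/
noncomputable def varpi : ExteriorAlgebra L (P.Algebroid 𝔤) :=
  ∑ i, P.sec 𝔤 (0, LieDouble.ofDual k 𝔥 ((Module.finBasis k 𝔥).coord i)) *
    P.sec 𝔤 (0, LieDouble.ofLie k 𝔥 (Module.finBasis k 𝔥 i))

/-- `ϖ' = ∑ η^i ∧ h_i`, with `h_i` in `𝔤`. -/
noncomputable def varpiPrime : ExteriorAlgebra L (P.Algebroid 𝔤) :=
  ∑ i, P.sec 𝔤 (0, LieDouble.ofDual k 𝔥 ((Module.finBasis k 𝔥).coord i)) *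
    P.sec 𝔤 ((Module.finBasis k 𝔥 i : 𝔤), 0)

/-- `Λ₀ = ϖ + 2 ϖ'`. -/
noncomputable def bivector₀ : ExteriorAlgebra L (P.Algebroid 𝔤) :=
  varpi P + (2 : k) • varpiPrime P

/-- `Λ = r + Λ₀`. -/
noncomputable def bivector (r : L ⊗[k] (𝔤 ⊗[k] 𝔤)) : ExteriorAlgebra L (P.Algebroid 𝔤) :=
  P.toBivector 𝔤 r + bivector₀ P

end RMatrix
end Dynamical

end DynR

open DynR

/-! Write `d` for `[Λ, ·]`. For every bivector `Λ` of a Lie algebroid, `d` is an odd derivation of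
degree one that is compatible with the bracket of sections, and `d²` is an even derivation, hence
determined by its values on functions and sections. If `d² = 0`, the Lie algebroid structure on the
dual module comes for free from Cartan calculus (`IsDifferential.exists_dualLieAlgebroid`). Moreover
`[[Λ, Λ], ·] = 0`, because `ι_{df} [Λ, Λ] = 2 d²f` and `L_x [Λ, Λ] = -2 d²x`
(`contractLeft_schouten_self`, `lieDeriv_schouten_self`). So the theorem is about when `d² = 0`.

On functions, the relations imposed by `J₀` collapse `df` to `-2 ∑ (η^i ▹ f) h_i`, where `h_i` now
stands for the diagonal copy, the sum of the copies in `𝔤` and in `𝔇𝔥`; the coefficient `2` in `ϖ +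
2 ϖ'` gives the two copies equal weight. For diagonal `h`, `[Λ, h]` is minus the diagonal `ν(h)`
minus the defect of equivariance of `r` at `h`. The second derivatives of `f` antisymmetrise to the
bracket of `𝔥^*_{op}`, which is dual to `ν` up to sign, and cancel the diagonal `ν(h_i)`. What is
left is `d²f = 2 ∑ (η^i ▹ f) defect(h_i)` (`schouten_schouten_algebraMap`).

For an equivariant `r`, `[Λ, Λ]` equals `[ϖ, ϖ] - 4/3 (∑ Alt(h_i ⊗ η^i ▹ r) - CYB(r))`
(`schouten_bivector_self`). Constant sections annihilate `[ϖ, ϖ]`, by the Jacobi and co-Jacobi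
identities of `𝔥`. Hence `d²ξ`, for a constant section `ξ`, is `2/3` of `ξ` acting on the left side
of the dynamical Yang-Baxter equation, and invariance of that trivector gives `d² = 0`.

Conversely, skew tensors over `𝔤` embed in the exterior algebra, since `J₀` does not meet the
summand `L ⊗ 𝔤` (`toBivector_injOn`, `toTrivector_injOn`). Effectiveness of the action removes the
factors `η^i ▹ f`. So `d² = 0` on functions gives equivariance, and then `d² = 0` on constant
sections gives invariance of the trivector. -/

namespace DynR

/-! ### Derivations, contractions and parity in the exterior algebra. -/

section ExteriorTools
variable {k L B : Type*} [CommRing k] [CommRing L] [Algebra k L] [AddCommGroup B] [Module L B]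

theorem involute_ι' (x : B) :
    CliffordAlgebra.involute (ExteriorAlgebra.ι L x) = -ExteriorAlgebra.ι L x :=
  CliffordAlgebra.involute_ι x

theorem contractLeft_ι' (α : Module.Dual L B) (x : B) :
    CliffordAlgebra.contractLeft α (ExteriorAlgebra.ι L x) = algebraMap L _ (α x) :=
  CliffordAlgebra.contractLeft_ι _ α x

theorem contractLeft_algebraMap' (α : Module.Dual L B) (f : L) :
    CliffordAlgebra.contractLeft α (algebraMap L (ExteriorAlgebra L B) f) = 0 :=
  CliffordAlgebra.contractLeft_algebraMap _ α f

theorem contractLeft_ι_mul' (α : Module.Dual L B) (x : B) (P : ExteriorAlgebra L B) :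
    CliffordAlgebra.contractLeft α (ExteriorAlgebra.ι L x * P) =
      α x • P - ExteriorAlgebra.ι L x * CliffordAlgebra.contractLeft α P :=
  CliffordAlgebra.contractLeft_ι_mul α x P

/-- Contractions are odd derivations. Identities among contractions, Lie derivatives and brackets
can therefore be checked on generators with `oddDerivation_ext` and `evenDerivation_ext`. -/
theorem contractLeft_mul' (α : Module.Dual L B) (P Q : ExteriorAlgebra L B) :
    CliffordAlgebra.contractLeft α (P * Q) =
      CliffordAlgebra.contractLeft α P * Q +
        CliffordAlgebra.involute P * CliffordAlgebra.contractLeft α Q := by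
  induction P using ExteriorAlgebra.induction generalizing Q with
  | algebraMap f =>
    rw [contractLeft_algebraMap', ← Algebra.smul_def, map_smul, AlgHom.commutes, ← Algebra.smul_def,
      zero_mul, zero_add]
  | ι x =>
    rw [contractLeft_ι_mul', contractLeft_ι', involute_ι', ← Algebra.smul_def, neg_mul,
      sub_eq_add_neg]
  | mul P R hP hR => rw [mul_assoc, hP, hR, hP, map_mul]; noncomm_ring
  | add P R hP hR => simp only [add_mul, map_add, hP, hR]; abel

/-- Two odd derivations of the exterior algebra that agree on generators are equal. -/
theorem oddDerivation_ext {D D' : ExteriorAlgebra L B → ExteriorAlgebra L B}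
    (ha : ∀ P Q, D (P + Q) = D P + D Q) (ha' : ∀ P Q, D' (P + Q) = D' P + D' Q)
    (hm : ∀ P Q, D (P * Q) = D P * Q + CliffordAlgebra.involute P * D Q)
    (hm' : ∀ P Q, D' (P * Q) = D' P * Q + CliffordAlgebra.involute P * D' Q)
    (h₀ : ∀ f : L, D (algebraMap L _ f) = D' (algebraMap L _ f))
    (h₁ : ∀ x, D (ExteriorAlgebra.ι L x) = D' (ExteriorAlgebra.ι L x)) (P) : D P = D' P := by
  induction P using ExteriorAlgebra.induction with
  | algebraMap f => exact h₀ f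
  | ι y => exact h₁ y
  | mul P Q hP hQ => rw [hm, hm', hP, hQ]
  | add P Q hP hQ => rw [ha, ha', hP, hQ]

/-- Two even derivations of the exterior algebra that agree on generators are equal. -/
theorem evenDerivation_ext {D D' : ExteriorAlgebra L B → ExteriorAlgebra L B}
    (ha : ∀ P Q, D (P + Q) = D P + D Q) (ha' : ∀ P Q, D' (P + Q) = D' P + D' Q)
    (hm : ∀ P Q, D (P * Q) = D P * Q + P * D Q)
    (hm' : ∀ P Q, D' (P * Q) = D' P * Q + P * D' Q)
    (h₀ : ∀ f : L, D (algebraMap L _ f) = D' (algebraMap L _ f))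
    (h₁ : ∀ x, D (ExteriorAlgebra.ι L x) = D' (ExteriorAlgebra.ι L x)) (P) : D P = D' P := by
  induction P using ExteriorAlgebra.induction with
  | algebraMap f => exact h₀ f
  | ι y => exact h₁ y
  | mul P Q hP hQ => rw [hm, hm', hP, hQ]
  | add P Q hP hQ => rw [ha, ha', hP, hQ]

theorem ι_mem_pow_one (x : B) : ExteriorAlgebra.ι L x ∈ ⋀[L]^1 B := by
  rw [ExteriorAlgebra.exteriorPower, pow_one]; exact ⟨x, rfl⟩

theorem ι_mul_ι_mem (x y : B) : ExteriorAlgebra.ι L x * ExteriorAlgebra.ι L y ∈ ⋀[L]^2 B := by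
  rw [ExteriorAlgebra.exteriorPower, pow_two]; exact Submodule.mul_mem_mul ⟨x, rfl⟩ ⟨y, rfl⟩

theorem exteriorPower_two_induction {p : ExteriorAlgebra L B → Prop} {P : ExteriorAlgebra L B}
    (hP : P ∈ ⋀[L]^2 B) (mul : ∀ x y : B, p (ExteriorAlgebra.ι L x * ExteriorAlgebra.ι L y))
    (add : ∀ P Q, p P → p Q → p (P + Q)) : p P := by
  rw [ExteriorAlgebra.exteriorPower, pow_two] at hP
  refine Submodule.mul_induction_on hP ?_ add
  rintro _ ⟨x, rfl⟩ _ ⟨y, rfl⟩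
  exact mul x y

/-- `schouten` is a sum over the parity parts of its left argument. Membership in degree one, two or
three decides which summand survives. -/
theorem mem_even_of_mem_two {P : ExteriorAlgebra L B} (hP : P ∈ ⋀[L]^2 B) :
    P ∈ CliffordAlgebra.evenOdd (0 : QuadraticForm L B) 0 :=
  Submodule.mem_iSup_of_mem (⟨2, rfl⟩ : { n : ℕ // ↑n = (0 : ZMod 2) }) hP

theorem mem_odd_of_mem_one {P : ExteriorAlgebra L B} (hP : P ∈ ⋀[L]^1 B) :
    P ∈ CliffordAlgebra.evenOdd (0 : QuadraticForm L B) 1 :=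
  Submodule.mem_iSup_of_mem (⟨1, rfl⟩ : { n : ℕ // ↑n = (1 : ZMod 2) }) hP

theorem mem_odd_of_mem_three {P : ExteriorAlgebra L B} (hP : P ∈ ⋀[L]^3 B) :
    P ∈ CliffordAlgebra.evenOdd (0 : QuadraticForm L B) 1 :=
  Submodule.mem_iSup_of_mem (⟨3, rfl⟩ : { n : ℕ // ↑n = (1 : ZMod 2) }) hP

theorem ι_anticomm (x y : B) : ExteriorAlgebra.ι L x * ExteriorAlgebra.ι L y =
    -(ExteriorAlgebra.ι L y * ExteriorAlgebra.ι L x) :=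
  eq_neg_of_add_eq_zero_left (ExteriorAlgebra.ι_add_mul_swap x y)

theorem involute_involute' (P : ExteriorAlgebra L B) :
    CliffordAlgebra.involute (CliffordAlgebra.involute P) = P :=
  CliffordAlgebra.involute_involute P

/-- The contraction of a bivector is a section. -/
theorem exists_contractLeft_eq_ι (α : Module.Dual L B) {P : ExteriorAlgebra L B}
    (hP : P ∈ ⋀[L]^2 B) : ∃ X : B, CliffordAlgebra.contractLeft α P = ExteriorAlgebra.ι L X := by
  refine exteriorPower_two_induction (p := fun P => ∃ X : B,
    CliffordAlgebra.contractLeft α P = ExteriorAlgebra.ι L X) hP (fun y z => ⟨α y • z - α z • y, ?_⟩) ?_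
  · rw [contractLeft_ι_mul', contractLeft_ι', map_sub, map_smul, map_smul, ← Algebra.commutes,
      ← Algebra.smul_def]
  · rintro P Q ⟨X, hX⟩ ⟨Y, hY⟩
    exact ⟨X + Y, by rw [map_add, hX, hY, map_add]⟩

end ExteriorTools

/-! ### Cartan calculus and the Lie algebroid dual to a differential. -/

section DualAlgebroid
variable {k L B : Type*} [CommRing k] [CommRing L] [Algebra k L] [AddCommGroup B] [Module k B]
  [Module L B] [IsScalarTower k L B]

theorem algebraMap_injective' : Function.Injective (algebraMap L (ExteriorAlgebra L B)) :=
  (ExteriorAlgebra.algebraMap_leftInverse B).injective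

theorem involute_of_mem_one {P : ExteriorAlgebra L B} (hP : P ∈ ⋀[L]^1 B) :
    CliffordAlgebra.involute P = -P := CliffordAlgebra.involute_eq_of_mem_odd (mem_odd_of_mem_one hP)

theorem involute_of_mem_two {P : ExteriorAlgebra L B} (hP : P ∈ ⋀[L]^2 B) :
    CliffordAlgebra.involute P = P := CliffordAlgebra.involute_eq_of_mem_even (mem_even_of_mem_two hP)

theorem exists_contractLeft_eq_algebraMap (α : Module.Dual L B) {P : ExteriorAlgebra L B}
    (hP : P ∈ ⋀[L]^1 B) : ∃ f : L, CliffordAlgebra.contractLeft α P = algebraMap L _ f := by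
  rw [ExteriorAlgebra.exteriorPower, pow_one] at hP
  obtain ⟨x, rfl⟩ := hP
  exact ⟨α x, contractLeft_ι' α x⟩

/-- An odd derivation of degree one of the exterior algebra. -/
structure IsDifferential (d : ExteriorAlgebra L B →ₗ[k] ExteriorAlgebra L B) : Prop where
  map_algebraMap : ∀ f, d (algebraMap L _ f) ∈ ⋀[L]^1 B
  map_ι : ∀ x, d (ExteriorAlgebra.ι L x) ∈ ⋀[L]^2 B
  leibniz : ∀ P Q, d (P * Q) = d P * Q + CliffordAlgebra.involute P * d Q

namespace IsDifferential
variable {d : ExteriorAlgebra L B →ₗ[k] ExteriorAlgebra L B} (hd : IsDifferential d)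
include hd

/-- Conjugating `d` by the grading involution and changing the sign gives another odd derivation.
The degrees of `d f` and `d x` make it agree with `d` on generators. -/
theorem involute_comm (Q : ExteriorAlgebra L B) :
    CliffordAlgebra.involute (d Q) = -d (CliffordAlgebra.involute Q) := by
  have hD := oddDerivation_ext
    (D := fun Q => -CliffordAlgebra.involute (d (CliffordAlgebra.involute Q)))
    (D' := d) (fun P Q => by simp only [map_add]; abel) (map_add _)
    (fun P Q => by simp only [map_mul, map_add, hd.leibniz, involute_involute']; noncomm_ring)
    hd.leibniz
    (fun g => by rw [AlgHom.commutes, involute_of_mem_one (hd.map_algebraMap g), neg_neg])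
    (fun y => by
      rw [involute_ι', map_neg, map_neg, involute_of_mem_two (hd.map_ι y), neg_neg])
    (CliffordAlgebra.involute Q)
  rw [involute_involute'] at hD
  rw [← hD, neg_neg]

omit hd in
/-- The Lie derivative `ι_α d + d ι_α` along the section `α` of the dual. -/
noncomputable def _root_.DynR.dualLieDeriv (d : ExteriorAlgebra L B →ₗ[k] ExteriorAlgebra L B)
    (α : Module.Dual L B) : ExteriorAlgebra L B →ₗ[k] ExteriorAlgebra L B where
  toFun P := CliffordAlgebra.contractLeft α (d P) + d (CliffordAlgebra.contractLeft α P)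
  map_add' P Q := by simp only [map_add]; abel
  map_smul' c P := by
    have e (Q : ExteriorAlgebra L B) : CliffordAlgebra.contractLeft α (c • Q) =
        c • CliffordAlgebra.contractLeft α Q := by
      rw [← algebraMap_smul L c Q, map_smul, algebraMap_smul]
    simp only [map_smul, e, smul_add, RingHom.id_apply]

omit hd in
theorem _root_.DynR.dualLieDeriv_apply (d : ExteriorAlgebra L B →ₗ[k] ExteriorAlgebra L B)
    (α : Module.Dual L B) (P : ExteriorAlgebra L B) : dualLieDeriv d α P =
      CliffordAlgebra.contractLeft α (d P) + d (CliffordAlgebra.contractLeft α P) := rfl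

/-- The graded commutator of the two odd derivations `d` and `ι_α` is an even derivation. -/
theorem dualLieDeriv_mul (α : Module.Dual L B) (P Q : ExteriorAlgebra L B) :
    dualLieDeriv d α (P * Q) = dualLieDeriv d α P * Q + P * dualLieDeriv d α Q := by
  simp only [dualLieDeriv_apply, hd.leibniz, contractLeft_mul', map_add, involute_contractLeft,
    hd.involute_comm, involute_involute']
  noncomm_ring

theorem dualLieDeriv_algebraMap (α : Module.Dual L B) (f : L) :
    dualLieDeriv d α (algebraMap L _ f) =
      CliffordAlgebra.contractLeft α (d (algebraMap L _ f)) := by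
  rw [dualLieDeriv_apply, contractLeft_algebraMap', map_zero, add_zero]

theorem involute_dualLieDeriv (α : Module.Dual L B) (P : ExteriorAlgebra L B) :
    CliffordAlgebra.involute (dualLieDeriv d α P) =
      dualLieDeriv d α (CliffordAlgebra.involute P) := by
  simp only [dualLieDeriv_apply, map_add, involute_contractLeft, hd.involute_comm, map_neg, neg_neg]

/-- The value of the anchor of the dual Lie algebroid. -/
theorem exists_anchor : ∃ ρ : Module.Dual L B →ₗ[L] Derivation k L L, ∀ α f,
    CliffordAlgebra.contractLeft α (d (algebraMap L _ f)) =
      algebraMap L (ExteriorAlgebra L B) (ρ α f) := by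
  have hex (α : Module.Dual L B) (f : L) := exists_contractLeft_eq_algebraMap α (hd.map_algebraMap f)
  choose r hr using hex
  refine ⟨{ toFun := fun α => Derivation.mk' { toFun := r α, map_add' := ?_, map_smul' := ?_ } ?_
            map_add' := ?_, map_smul' := ?_ }, hr⟩
  · intro f g; apply algebraMap_injective' (B := B); simp only [map_add, ← hr]
  · intro c f
    apply algebraMap_injective' (B := B)
    have e (Q : ExteriorAlgebra L B) : CliffordAlgebra.contractLeft α (c • Q) =
        c • CliffordAlgebra.contractLeft α Q := by
      rw [← algebraMap_smul L c Q, map_smul, algebraMap_smul]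
    have e' (g : L) : algebraMap L (ExteriorAlgebra L B) (c • g) = c • algebraMap L _ g := by
      rw [Algebra.smul_def, map_mul, ← Algebra.smul_def, algebraMap_smul]
    rw [RingHom.id_apply, e', ← hr, ← hr, e', map_smul, e]
  · intro f g
    apply algebraMap_injective' (B := B)
    have e1 := exists_contractLeft_eq_algebraMap α (hd.map_algebraMap f)
    simp only [LinearMap.coe_mk, AddHom.coe_mk, map_add, smul_eq_mul, map_mul, ← hr, hd.leibniz,
      AlgHom.commutes]
    rw [← Algebra.commutes, ← Algebra.smul_def, ← Algebra.smul_def, map_smul, map_smul,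
      Algebra.smul_def, Algebra.smul_def, add_comm]
  · intro α β; ext f; apply algebraMap_injective' (B := B)
    change algebraMap L _ (r (α + β) f) = algebraMap L _ (r α f + r β f)
    rw [map_add, ← hr, ← hr, ← hr, map_add, LinearMap.add_apply]
  · intro g α; ext f; apply algebraMap_injective' (B := B)
    change algebraMap L _ (r (g • α) f) = algebraMap L _ (g * r α f)
    rw [map_mul, ← hr, ← hr, map_smul, LinearMap.smul_apply, Algebra.smul_def]

/-- The commutator `[L_α, ι_β]` is an odd derivation that kills functions and sends sections to
functions. By the Leibniz rule its restriction to sections is `L`-linear, so it is a contraction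
`ι_δ`. No finiteness or projectivity of `B` is involved. -/
theorem exists_bracket_value (α β : Module.Dual L B) : ∃ δ : Module.Dual L B, ∀ P,
    CliffordAlgebra.contractLeft δ P =
      dualLieDeriv d α (CliffordAlgebra.contractLeft β P) -
        CliffordAlgebra.contractLeft β (dualLieDeriv d α P) := by
  set C : ExteriorAlgebra L B → ExteriorAlgebra L B := fun P =>
    dualLieDeriv d α (CliffordAlgebra.contractLeft β P) -
        CliffordAlgebra.contractLeft β (dualLieDeriv d α P) with hC
  have hadd (P Q) : C (P + Q) = C P + C Q := by simp only [hC, map_add]; abel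
  have hmul (P Q) : C (P * Q) = C P * Q + CliffordAlgebra.involute P * C Q := by
    simp only [hC, hd.dualLieDeriv_mul, contractLeft_mul', map_add, hd.involute_dualLieDeriv]
    noncomm_ring
  have h0 (f : L) : C (algebraMap L _ f) = 0 := by
    obtain ⟨g, hg⟩ := exists_contractLeft_eq_algebraMap α (hd.map_algebraMap f)
    simp only [hC]
    rw [hd.dualLieDeriv_algebraMap, hg, contractLeft_algebraMap', contractLeft_algebraMap',
      map_zero, sub_zero]
  have h1 (x : B) : ∃ g : L, C (ExteriorAlgebra.ι L x) = algebraMap L _ g := by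
    obtain ⟨f1, e1⟩ := exists_contractLeft_eq_algebraMap α (hd.map_algebraMap (β x))
    obtain ⟨f2, e2⟩ := exists_contractLeft_eq_algebraMap β (hd.map_algebraMap (α x))
    obtain ⟨Y, hY⟩ := exists_contractLeft_eq_ι α (hd.map_ι x)
    refine ⟨f1 - (β Y + f2), ?_⟩
    change dualLieDeriv d α _ - _ = _
    rw [contractLeft_ι', hd.dualLieDeriv_algebraMap, e1, dualLieDeriv_apply, contractLeft_ι', hY,
      map_add, e2, contractLeft_ι', map_sub, map_add]
  choose g hg using h1
  refine ⟨{ toFun := g, map_add' := ?_, map_smul' := ?_ }, ?_⟩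
  · intro x y; apply algebraMap_injective' (B := B); rw [map_add, ← hg, ← hg, ← hg, map_add, hadd]
  · intro f x
    apply algebraMap_injective' (B := B)
    rw [RingHom.id_apply, smul_eq_mul, map_mul, ← hg, ← hg, map_smul, Algebra.smul_def, hmul, h0,
      zero_mul, zero_add, AlgHom.commutes]
  · intro P
    refine oddDerivation_ext (D' := C) (map_add _) hadd (contractLeft_mul' _) hmul (fun f => ?_)
      (fun x => ?_) P
    · rw [h0, contractLeft_algebraMap']
    · rw [contractLeft_ι', hg]; rfl

omit hd in
theorem dual_ext {δ δ' : Module.Dual L B} (h : ∀ P : ExteriorAlgebra L B,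
    CliffordAlgebra.contractLeft δ P = CliffordAlgebra.contractLeft δ' P) : δ = δ' := by
  ext x
  apply algebraMap_injective' (B := B)
  rw [← contractLeft_ι', ← contractLeft_ι', h]

/-- A differential of square zero is dual to a Lie algebroid structure on the dual module. -/
theorem exists_dualLieAlgebroid (hsq : ∀ P, d (d P) = 0) :
    ∃ (ρ : Module.Dual L B →ₗ[L] Derivation k L L)
      (br : Module.Dual L B →ₗ[k] Module.Dual L B →ₗ[k] Module.Dual L B),
    IsLieAlgebroid ρ br ∧
    (∀ α f, CliffordAlgebra.contractLeft α (d (algebraMap L (ExteriorAlgebra L B) f)) =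
      algebraMap L (ExteriorAlgebra L B) (ρ α f)) ∧
    (∀ α β x, CliffordAlgebra.contractLeft β (CliffordAlgebra.contractLeft α
        (d (ExteriorAlgebra.ι L x))) =
      algebraMap L (ExteriorAlgebra L B) (ρ α (β x) - ρ β (α x) - br α β x)) := by
  obtain ⟨ρ, hρ⟩ := hd.exists_anchor
  choose b hb using hd.exists_bracket_value
  have hbx (α β : Module.Dual L B) (x : B) :
      CliffordAlgebra.contractLeft β (CliffordAlgebra.contractLeft α
        (d (ExteriorAlgebra.ι L x))) =
      algebraMap L (ExteriorAlgebra L B) (ρ α (β x) - ρ β (α x) - b α β x) := by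
    rw [map_sub, map_sub, ← contractLeft_ι' (b α β), hb, contractLeft_ι',
      hd.dualLieDeriv_algebraMap, hρ, dualLieDeriv_apply, contractLeft_ι', map_add, hρ]
    abel
  -- The only use of `d² = 0`: the Lie derivatives commute with `d`. Together with `ι_{[α, β]} =
  -- [L_α, ι_β]` this gives `L_{[α, β]} = [L_α, L_β]`.
  have hLd (α P) : dualLieDeriv d α (d P) = d (dualLieDeriv d α P) := by
    simp only [dualLieDeriv_apply, map_add, hsq, map_zero, add_zero, zero_add]
  have hbL (α β P) : dualLieDeriv d (b α β) P =
      dualLieDeriv d α (dualLieDeriv d β P) - dualLieDeriv d β (dualLieDeriv d α P) := by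
    rw [dualLieDeriv_apply d (b α β), hb, hb, map_sub, hLd α P, ← hLd α (CliffordAlgebra.contractLeft β P), dualLieDeriv_apply d β P,
      dualLieDeriv_apply d β (dualLieDeriv d α P), map_add]
    abel
  have ext' {δ δ' : Module.Dual L B} (h : ∀ P : ExteriorAlgebra L B,
      CliffordAlgebra.contractLeft δ P = CliffordAlgebra.contractLeft δ' P) : δ = δ' := dual_ext h
  have eb (α β : Module.Dual L B) (x : B) : algebraMap L (ExteriorAlgebra L B) (b α β x) =
      algebraMap L _ (ρ α (β x) - ρ β (α x)) - CliffordAlgebra.contractLeft β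
        (CliffordAlgebra.contractLeft α (d (ExteriorAlgebra.ι L x))) := by
    rw [hbx, ← map_sub, sub_sub_cancel]
  have kact (c : k) (α : Module.Dual L B) : c • α = algebraMap k L c • α :=
    (algebraMap_smul L c α).symm
  have hρk (α : Module.Dual L B) (c : k) (f : L) : ρ α (algebraMap k L c * f) =
      algebraMap k L c * ρ α f := by
    rw [← Algebra.smul_def, Derivation.map_smul, Algebra.smul_def]
  refine ⟨ρ, LinearMap.mk₂ k b ?_ ?_ ?_ ?_, ⟨?_, ?_, ?_, ?_⟩, hρ, hbx⟩
  · intro α α' β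
    ext x
    apply algebraMap_injective' (B := B)
    rw [LinearMap.add_apply, map_add, eb, eb, eb]
    simp only [map_add, map_sub, LinearMap.add_apply, Derivation.add_apply]
    abel
  · intro c α β
    ext x
    apply algebraMap_injective' (B := B)
    rw [kact, kact, LinearMap.smul_apply, smul_eq_mul, map_mul, eb, eb, ← Algebra.smul_def]
    simp only [map_smul, LinearMap.smul_apply, Derivation.smul_apply, smul_eq_mul, hρk, map_sub,
      map_mul, smul_sub]
    simp only [← Algebra.smul_def]
  · intro α β β'
    ext x
    apply algebraMap_injective' (B := B)
    rw [LinearMap.add_apply, map_add, eb, eb, eb]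
    simp only [map_add, map_sub, LinearMap.add_apply, Derivation.add_apply]
    abel
  · intro c α β
    ext x
    apply algebraMap_injective' (B := B)
    rw [kact, kact, LinearMap.smul_apply, smul_eq_mul, map_mul, eb, eb, ← Algebra.smul_def]
    simp only [map_smul, LinearMap.smul_apply, Derivation.smul_apply, smul_eq_mul, hρk, map_sub,
      map_mul, smul_sub]
    simp only [← Algebra.smul_def]
  · intro α
    ext x
    apply algebraMap_injective' (B := B)
    rw [LinearMap.mk₂_apply, eb, sub_self, CliffordAlgebra.contractLeft_contractLeft, map_zero,
      sub_zero, LinearMap.zero_apply, map_zero]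
  -- Dual sections are compared through their contractions, where the Jacobi identity is that of
  -- commutators of operators.
  · intro α β γ
    refine ext' fun P => ?_
    simp only [LinearMap.mk₂_apply, map_add, LinearMap.add_apply, hb, hbL, map_sub]
    abel
  · intro α β
    ext f
    apply algebraMap_injective' (B := B)
    rw [LinearMap.mk₂_apply, Derivation.commutator_apply, ← hρ, ← hd.dualLieDeriv_algebraMap, hbL]
    simp only [hd.dualLieDeriv_algebraMap, hρ, map_sub]
  · intro α β f
    ext x
    apply algebraMap_injective' (B := B)
    simp only [LinearMap.mk₂_apply, LinearMap.add_apply, LinearMap.smul_apply, smul_eq_mul,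
      map_add, map_mul, eb, map_smul, Derivation.leibniz, map_sub, Derivation.smul_apply, mul_sub,
      Algebra.smul_def]
    rw [Algebra.commutes (β x)]
    abel
end IsDifferential
end DualAlgebroid

/-! ### Calculus of the Schouten bracket. -/

section SchoutenRules
variable {k L B : Type*} [CommRing k] [CommRing L] [Algebra k L] [LieRing B]
  [LieAlgebra k B] [Module L B] [LieRingModule B L] [LieRinehartRing L B]
  [LieRinehartAlgebra k L B]

theorem anchorDiff_apply (f : L) (x : B) : anchorDiff B f x = ⁅x, f⁆ := rfl

theorem parityPart_zero_of_even {P : ExteriorAlgebra L B}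
    (hP : P ∈ CliffordAlgebra.evenOdd (0 : QuadraticForm L B) 0) : parityPart 0 P = P :=
  DirectSum.decompose_of_mem_same _ hP

theorem parityPart_one_of_even {P : ExteriorAlgebra L B}
    (hP : P ∈ CliffordAlgebra.evenOdd (0 : QuadraticForm L B) 0) : parityPart 1 P = 0 :=
  DirectSum.decompose_of_mem_ne _ hP (by decide)

theorem parityPart_zero_of_odd {P : ExteriorAlgebra L B}
    (hP : P ∈ CliffordAlgebra.evenOdd (0 : QuadraticForm L B) 1) : parityPart 0 P = 0 :=
  DirectSum.decompose_of_mem_ne _ hP (by decide)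

theorem parityPart_one_of_odd {P : ExteriorAlgebra L B}
    (hP : P ∈ CliffordAlgebra.evenOdd (0 : QuadraticForm L B) 1) : parityPart 1 P = P :=
  DirectSum.decompose_of_mem_same _ hP

section Even
variable {P : ExteriorAlgebra L B} (hP : P ∈ CliffordAlgebra.evenOdd (0 : QuadraticForm L B) 0)
include hP

/-- The odd part of `P` is zero, but `schoutenOdd` is known only by its values on generators and its
Leibniz rule; it vanishes by uniqueness of derivations. -/
theorem schoutenOdd_eq_zero_of_even (h) (Q : ExteriorAlgebra L B) :
    schoutenOdd k (parityPart 1 P) h Q = 0 := by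
  have e := parityPart_one_of_even hP
  refine evenDerivation_ext (D' := fun _ => 0) (map_add _) (by simp) (schoutenOdd_mul k _ h)
    (by simp) (fun f => ?_) (fun x => ?_) Q
  · rw [schoutenOdd_algebraMap, e, map_zero]
  · rw [schoutenOdd_ι, e, map_zero, neg_zero]

theorem schouten_even_algebraMap (f : L) : schouten k P (algebraMap L _ f) =
    -CliffordAlgebra.contractLeft (anchorDiff B f) P := by
  rw [schouten, LinearMap.add_apply, schoutenOdd_eq_zero_of_even hP, schoutenEven_algebraMap,
    parityPart_zero_of_even hP, add_zero]

theorem schouten_even_ι (x : B) : schouten k P (ExteriorAlgebra.ι L x) = -lieDeriv k x P := by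
  rw [schouten, LinearMap.add_apply, schoutenOdd_eq_zero_of_even hP, schoutenEven_ι,
    parityPart_zero_of_even hP, add_zero]

theorem schouten_even_mul (Q R : ExteriorAlgebra L B) : schouten k P (Q * R) =
    schouten k P Q * R + CliffordAlgebra.involute Q * schouten k P R := by
  simp only [schouten, LinearMap.add_apply, schoutenOdd_eq_zero_of_even hP, schoutenEven_mul,
    add_zero]

end Even

section Odd
variable {P : ExteriorAlgebra L B} (hP : P ∈ CliffordAlgebra.evenOdd (0 : QuadraticForm L B) 1)
include hP

theorem schoutenEven_eq_zero_of_odd (h) (Q : ExteriorAlgebra L B) :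
    schoutenEven k (parityPart 0 P) h Q = 0 := by
  have e := parityPart_zero_of_odd hP
  refine oddDerivation_ext (D' := fun _ => 0) (map_add _) (by simp) (schoutenEven_mul k _ h)
    (by simp) (fun f => ?_) (fun x => ?_) Q
  · rw [schoutenEven_algebraMap, e, map_zero, neg_zero]
  · rw [schoutenEven_ι, e, map_zero, neg_zero]

theorem schouten_odd_algebraMap (f : L) : schouten k P (algebraMap L _ f) =
    CliffordAlgebra.contractLeft (anchorDiff B f) P := by
  rw [schouten, LinearMap.add_apply, schoutenEven_eq_zero_of_odd hP, schoutenOdd_algebraMap,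
    parityPart_one_of_odd hP, zero_add]

theorem schouten_odd_ι (x : B) : schouten k P (ExteriorAlgebra.ι L x) = -lieDeriv k x P := by
  rw [schouten, LinearMap.add_apply, schoutenEven_eq_zero_of_odd hP, schoutenOdd_ι,
    parityPart_one_of_odd hP, zero_add]

theorem schouten_odd_mul (Q R : ExteriorAlgebra L B) : schouten k P (Q * R) =
    schouten k P Q * R + Q * schouten k P R := by
  simp only [schouten, LinearMap.add_apply, schoutenEven_eq_zero_of_odd hP, schoutenOdd_mul,
    zero_add]

end Odd

theorem schouten_ι_left (x : B) (Q : ExteriorAlgebra L B) :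
    schouten k (ExteriorAlgebra.ι L x) Q = lieDeriv k x Q := by
  have h := mem_odd_of_mem_one (ι_mem_pow_one (L := L) x)
  refine evenDerivation_ext (map_add _) (map_add _) (schouten_odd_mul h) (lieDeriv_mul k x)
    (fun f => ?_) (fun y => ?_) Q
  · rw [schouten_odd_algebraMap h, lieDeriv_algebraMap, contractLeft_ι', anchorDiff_apply]
  · rw [schouten_odd_ι h, lieDeriv_ι, lieDeriv_ι, ← lie_skew, map_neg, neg_neg]

/-- Both sides are even derivations. On functions the identity says that the anchor is a
representation, on sections it is the Jacobi identity. -/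
theorem lieDeriv_lie (x y : B) (Q : ExteriorAlgebra L B) :
    lieDeriv k ⁅x, y⁆ Q = lieDeriv k x (lieDeriv k y Q) - lieDeriv k y (lieDeriv k x Q) := by
  refine evenDerivation_ext
    (D' := fun Q => lieDeriv k x (lieDeriv k y Q) - lieDeriv k y (lieDeriv k x Q))
    (map_add _) (fun P Q => ?_) (lieDeriv_mul k _) (fun P Q => ?_)
    (fun f => ?_) (fun z => ?_) Q
  · simp only [map_add]; abel
  · simp only [map_add, lieDeriv_mul]; noncomm_ring
  · simp only [lieDeriv_algebraMap, ← map_sub, lie_lie]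
  · simp only [lieDeriv_ι, ← map_sub, lie_lie]

theorem lieDeriv_mem_two (x : B) {P : ExteriorAlgebra L B} (hP : P ∈ ⋀[L]^2 B) :
    lieDeriv k x P ∈ ⋀[L]^2 B := by
  refine exteriorPower_two_induction (p := fun P => lieDeriv k x P ∈ ⋀[L]^2 B) hP
    (fun y z => ?_) (fun P Q hP hQ => ?_)
  · rw [lieDeriv_mul, lieDeriv_ι, lieDeriv_ι]
    exact add_mem (ι_mul_ι_mem _ _) (ι_mul_ι_mem _ _)
  · rw [map_add]; exact add_mem hP hQ

section Bivector
variable {Λ : ExteriorAlgebra L B} (hΛ : Λ ∈ ⋀[L]^2 B)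
include hΛ

theorem schouten_algebraMap_mem (f : L) : schouten k Λ (algebraMap L _ f) ∈ ⋀[L]^1 B := by
  obtain ⟨X, hX⟩ := exists_contractLeft_eq_ι (anchorDiff B f) hΛ
  rw [schouten_even_algebraMap (mem_even_of_mem_two hΛ), hX]
  exact neg_mem (ι_mem_pow_one X)

theorem schouten_ι_mem (x : B) : schouten k Λ (ExteriorAlgebra.ι L x) ∈ ⋀[L]^2 B := by
  rw [schouten_even_ι (mem_even_of_mem_two hΛ)]
  exact neg_mem (lieDeriv_mem_two x hΛ)

theorem schouten_mem_pow (n : ℕ) (P : ExteriorAlgebra L B) (hP : P ∈ ⋀[L]^n B) :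
    schouten k Λ P ∈ ⋀[L]^(n + 1) B := by
  have hev := mem_even_of_mem_two hΛ
  induction n generalizing P with
  | zero =>
    rw [ExteriorAlgebra.exteriorPower, pow_zero] at hP
    obtain ⟨f, rfl⟩ := Submodule.mem_one.1 hP
    exact schouten_algebraMap_mem hΛ f
  | succ n ih =>
    rw [ExteriorAlgebra.exteriorPower, pow_succ'] at hP
    refine Submodule.mul_induction_on hP ?_ (fun P Q hP hQ => ?_)
    · rintro _ ⟨x, rfl⟩ Q hQ
      rw [schouten_even_mul hev, involute_ι', neg_mul]
      refine add_mem ?_ (neg_mem ?_)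
      · rw [ExteriorAlgebra.exteriorPower, show n + 1 + 1 = 2 + n by ring, pow_add]
        exact Submodule.mul_mem_mul (schouten_ι_mem hΛ x) hQ
      · rw [ExteriorAlgebra.exteriorPower, pow_succ']
        exact Submodule.mul_mem_mul ⟨x, rfl⟩ (ih Q hQ)
    · rw [map_add]; exact add_mem hP hQ

theorem schouten_add_left {M : ExteriorAlgebra L B} (hM : M ∈ ⋀[L]^2 B) (Q : ExteriorAlgebra L B) :
    schouten k (Λ + M) Q = schouten k Λ Q + schouten k M Q := by
  have h1 := mem_even_of_mem_two hΛ
  have h2 := mem_even_of_mem_two hM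
  have h3 := mem_even_of_mem_two (add_mem hΛ hM)
  refine oddDerivation_ext (D' := fun Q => schouten k Λ Q + schouten k M Q) (map_add _)
    (fun P Q => ?_) (schouten_even_mul h3) (fun P Q => ?_) (fun f => ?_) (fun z => ?_) Q
  · simp only [map_add]; abel
  · simp only [schouten_even_mul h1, schouten_even_mul h2]; noncomm_ring
  · simp only [schouten_even_algebraMap h1, schouten_even_algebraMap h2,
      schouten_even_algebraMap h3, map_add, neg_add]
  · simp only [schouten_even_ι h1, schouten_even_ι h2, schouten_even_ι h3, map_add, neg_add]

/-- The Schouten bracket is symmetric on bivectors. -/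
theorem schouten_comm {M : ExteriorAlgebra L B} (hM : M ∈ ⋀[L]^2 B) :
    schouten k Λ M = schouten k M Λ := by
  -- Decomposable bivectors suffice by additivity. For them both sides expand into four triple
  -- products, which match after transposing factors and using skew-symmetry of the bracket.
  have key (x y z w : B) :
      schouten k (ExteriorAlgebra.ι L x * ExteriorAlgebra.ι L y)
        (ExteriorAlgebra.ι L z * ExteriorAlgebra.ι L w) =
      schouten k (ExteriorAlgebra.ι L z * ExteriorAlgebra.ι L w)
        (ExteriorAlgebra.ι L x * ExteriorAlgebra.ι L y) := by
    have h1 := mem_even_of_mem_two (ι_mul_ι_mem (L := L) x y)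
    have h2 := mem_even_of_mem_two (ι_mul_ι_mem (L := L) z w)
    simp only [schouten_even_mul h1, schouten_even_mul h2, schouten_even_ι h1, schouten_even_ι h2,
      lieDeriv_mul, lieDeriv_ι, involute_ι']
    rw [← lie_skew x z, ← lie_skew x w, ← lie_skew y z, ← lie_skew y w]
    simp only [map_neg, neg_mul, mul_neg, neg_neg, neg_add, add_mul, mul_add]
    have a3 (u v t : B) : ExteriorAlgebra.ι L u * ExteriorAlgebra.ι L v * ExteriorAlgebra.ι L t =
        -(ExteriorAlgebra.ι L u * ExteriorAlgebra.ι L t * ExteriorAlgebra.ι L v) := by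
      rw [mul_assoc, ι_anticomm v t, mul_neg, mul_assoc]
    have a2 (u v t : B) : ExteriorAlgebra.ι L u * ExteriorAlgebra.ι L v * ExteriorAlgebra.ι L t =
        -(ExteriorAlgebra.ι L v * ExteriorAlgebra.ι L u * ExteriorAlgebra.ι L t) := by
      rw [ι_anticomm u v, neg_mul]
    simp only [← mul_assoc]
    rw [a3 _ w y, a2 x ⁅z, y⁆ w, a3 _ x w, a2 z ⁅w, x⁆ y, a2 x z]
    abel
  have key' (x y : B) : schouten k (ExteriorAlgebra.ι L x * ExteriorAlgebra.ι L y) M =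
      schouten k M (ExteriorAlgebra.ι L x * ExteriorAlgebra.ι L y) :=
    (exteriorPower_two_induction (p := fun M => M ∈ ⋀[L]^2 B ∧
      schouten k (ExteriorAlgebra.ι L x * ExteriorAlgebra.ι L y) M =
        schouten k M (ExteriorAlgebra.ι L x * ExteriorAlgebra.ι L y)) hM
      (fun z w => ⟨ι_mul_ι_mem z w, key x y z w⟩)
      (fun P Q hP hQ => ⟨add_mem hP.1 hQ.1, by
        rw [map_add, schouten_add_left hP.1 hQ.1, hP.2, hQ.2]⟩)).2
  exact (exteriorPower_two_induction (p := fun Λ => Λ ∈ ⋀[L]^2 B ∧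
    schouten k Λ M = schouten k M Λ) hΛ (fun x y => ⟨ι_mul_ι_mem x y, key' x y⟩)
    (fun P Q hP hQ => ⟨add_mem hP.1 hQ.1, by
      rw [map_add, schouten_add_left hP.1 hQ.1, hP.2, hQ.2]⟩)).2

-- The commutator of `L_x` with the odd derivation `ι_{df}` is an odd derivation. On a section `y`
-- it takes the value `⁅x, ⁅y, f⁆⁆ - ⁅⁅x, y⁆, f⁆ = ⁅y, ⁅x, f⁆⁆`.
omit hΛ in
theorem lieDeriv_contractLeft (x : B) (f : L) (P : ExteriorAlgebra L B) :
    lieDeriv k x (CliffordAlgebra.contractLeft (anchorDiff B f) P) =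
      CliffordAlgebra.contractLeft (anchorDiff B ⁅x, f⁆) P +
        CliffordAlgebra.contractLeft (anchorDiff B f) (lieDeriv k x P) := by
  rw [← sub_eq_iff_eq_add]
  refine oddDerivation_ext
    (D := fun P => lieDeriv k x (CliffordAlgebra.contractLeft (anchorDiff B f) P) -
      CliffordAlgebra.contractLeft (anchorDiff B f) (lieDeriv k x P))
    (fun P Q => ?_) (map_add _) (fun P Q => ?_) (contractLeft_mul' _) (fun g => ?_) (fun y => ?_) P
  · simp only [map_add]; abel
  · simp only [map_add, lieDeriv_mul, contractLeft_mul', involute_lieDeriv]; noncomm_ring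
  · simp only [lieDeriv_algebraMap, contractLeft_algebraMap', map_zero, sub_zero]
  · simp only [lieDeriv_ι, contractLeft_ι', lieDeriv_algebraMap, anchorDiff_apply, ← map_sub]
    rw [leibniz_lie x y f, add_sub_cancel_left]

/-- The Lie derivative is a derivation of the Schouten bracket. -/
theorem lieDeriv_schouten (x : B) (Q : ExteriorAlgebra L B) :
    lieDeriv k x (schouten k Λ Q) =
      schouten k (lieDeriv k x Λ) Q + schouten k Λ (lieDeriv k x Q) := by
  have h := mem_even_of_mem_two hΛ
  have h' := mem_even_of_mem_two (lieDeriv_mem_two (k := k) x hΛ)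
  rw [← sub_eq_iff_eq_add]
  refine oddDerivation_ext
    (D := fun Q => lieDeriv k x (schouten k Λ Q) - schouten k Λ (lieDeriv k x Q))
    (fun P Q => ?_) (map_add _) (fun P Q => ?_) (schouten_even_mul h') (fun f => ?_)
    (fun y => ?_) Q
  · simp only [map_add]; abel
  · simp only [map_add, lieDeriv_mul, schouten_even_mul h, involute_lieDeriv]; noncomm_ring
  · simp only [lieDeriv_algebraMap, schouten_even_algebraMap h, schouten_even_algebraMap h',
      map_neg, lieDeriv_contractLeft]
    abel
  · simp only [lieDeriv_ι, schouten_even_ι h, schouten_even_ι h', map_neg, lieDeriv_lie]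
    abel

/-- `L_x` differentiates both copies of `Λ`. The two terms agree by `schouten_comm`, and `L_x Λ =
-[Λ, x]`. -/
theorem lieDeriv_schouten_self (x : B) : lieDeriv k x (schouten k Λ Λ) =
    -(2 : k) • schouten k Λ (schouten k Λ (ExteriorAlgebra.ι L x)) := by
  rw [lieDeriv_schouten hΛ, schouten_comm (lieDeriv_mem_two x hΛ) hΛ,
    schouten_even_ι (mem_even_of_mem_two hΛ), map_neg, smul_neg, neg_smul, neg_neg, two_smul]

theorem isDifferential_schouten : IsDifferential (schouten k Λ) where
  map_algebraMap := schouten_algebraMap_mem hΛ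
  map_ι := schouten_ι_mem hΛ
  leibniz := schouten_even_mul (mem_even_of_mem_two hΛ)

theorem involute_schouten (Q : ExteriorAlgebra L B) : CliffordAlgebra.involute (schouten k Λ Q) =
    -schouten k Λ (CliffordAlgebra.involute Q) := (isDifferential_schouten hΛ).involute_comm Q

/-- Let `X = ι_{df} Λ`, so that `[Λ, f] = -X`. The graded commutator of `[Λ, ·]` with `ι_{df}` is
`L_X`; evaluate it at `Λ`, where `L_X Λ = -[Λ, X]`. -/
theorem contractLeft_schouten_self (f : L) :
    CliffordAlgebra.contractLeft (anchorDiff B f) (schouten k Λ Λ) =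
      (2 : k) • schouten k Λ (schouten k Λ (algebraMap L _ f)) := by
  have h := mem_even_of_mem_two hΛ
  obtain ⟨X, hX⟩ := exists_contractLeft_eq_ι (anchorDiff B f) hΛ
  have key (Q : ExteriorAlgebra L B) :
      schouten k Λ (CliffordAlgebra.contractLeft (anchorDiff B f) Q) +
        CliffordAlgebra.contractLeft (anchorDiff B f) (schouten k Λ Q) = lieDeriv k X Q := by
    refine evenDerivation_ext
      (D := fun Q => schouten k Λ (CliffordAlgebra.contractLeft (anchorDiff B f) Q) +
        CliffordAlgebra.contractLeft (anchorDiff B f) (schouten k Λ Q))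
      (fun P Q => ?_) (map_add _) (fun P Q => ?_) (lieDeriv_mul k X) (fun g => ?_) (fun y => ?_) Q
    · simp only [map_add]; abel
    · simp only [map_add, contractLeft_mul', schouten_even_mul h, involute_contractLeft,
        involute_schouten hΛ,
        involute_involute']
      noncomm_ring
    · rw [contractLeft_algebraMap', map_zero, zero_add, schouten_even_algebraMap h, map_neg,
        CliffordAlgebra.contractLeft_comm, neg_neg, hX, contractLeft_ι', lieDeriv_algebraMap,
        anchorDiff_apply]
    · rw [contractLeft_ι', schouten_even_ι h, schouten_even_algebraMap h, lieDeriv_ι, map_neg,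
        anchorDiff_apply, ← lie_skew X y, map_neg, ← lieDeriv_ι (k := k), ← hX,
        lieDeriv_contractLeft]
      abel
  have h1 := key Λ
  rw [hX] at h1
  rw [schouten_even_algebraMap h, hX, map_neg, schouten_even_ι h, neg_neg, two_smul]
  rw [schouten_even_ι h] at h1
  rw [← sub_eq_iff_eq_add'.2 h1.symm]
  abel

/-- The square of an odd derivation is an even derivation, so generators suffice. -/
theorem schouten_schouten_eq_zero
    (h₀ : ∀ f : L, schouten k Λ (schouten k Λ (algebraMap L _ f)) = 0)
    (h₁ : ∀ x : B, schouten k Λ (schouten k Λ (ExteriorAlgebra.ι L x)) = 0)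
    (Q : ExteriorAlgebra L B) : schouten k Λ (schouten k Λ Q) = 0 := by
  have h := mem_even_of_mem_two hΛ
  refine evenDerivation_ext (D := fun Q => schouten k Λ (schouten k Λ Q)) (D' := fun _ => 0)
    (fun P Q => by simp only [map_add]) (by simp) (fun P Q => ?_) (by simp) h₀ h₁ Q
  simp only [schouten_even_mul h, map_add, involute_schouten hΛ, involute_involute']
  noncomm_ring

/-- `[Λ, Λ]` has degree three, so its bracket is an even derivation. Its values on generators are
multiples of `[Λ, [Λ, ·]]`. -/
theorem schouten_schouten_self_eq_zero
    (hsq : ∀ Q : ExteriorAlgebra L B, schouten k Λ (schouten k Λ Q) = 0)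
    (Q : ExteriorAlgebra L B) : schouten k (schouten k Λ Λ) Q = 0 := by
  have h := mem_odd_of_mem_three (schouten_mem_pow (k := k) hΛ 2 Λ hΛ)
  refine evenDerivation_ext (D' := fun _ => 0) (map_add _) (by simp) (schouten_odd_mul h) (by simp)
    (fun f => ?_) (fun x => ?_) Q
  · rw [schouten_odd_algebraMap h, contractLeft_schouten_self hΛ, hsq, smul_zero]
  · rw [schouten_odd_ι h, lieDeriv_schouten_self hΛ, hsq, smul_zero, neg_zero]

/-- This is `L_{[x, y]} = [L_x, L_y]` applied to `Λ`. Compatibility with the bracket is thus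
automatic for every bivector. -/
theorem schouten_ι_lie (x y : B) : schouten k Λ (ExteriorAlgebra.ι L ⁅x, y⁆) =
    schouten k (schouten k Λ (ExteriorAlgebra.ι L x)) (ExteriorAlgebra.ι L y) +
      schouten k (ExteriorAlgebra.ι L x) (schouten k Λ (ExteriorAlgebra.ι L y)) := by
  have h := mem_even_of_mem_two hΛ
  rw [schouten_ι_left, schouten_even_ι (mem_even_of_mem_two (schouten_ι_mem hΛ x)),
    schouten_even_ι h, schouten_even_ι h, schouten_even_ι h, lieDeriv_lie, map_neg, map_neg]
  abel

/-- A bivector whose bracket has square zero defines a coboundary Lie bialgebroid. -/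
theorem isCoboundaryLieBialgebroid_of_sq_zero
    (hsq : ∀ Q : ExteriorAlgebra L B, schouten k Λ (schouten k Λ Q) = 0) :
    IsCoboundaryLieBialgebroid k Λ where
  mem := hΛ
  bracket_bracket := schouten_schouten_self_eq_zero hΛ hsq Λ
  isLieBialgebroid :=
    { degree := schouten_mem_pow hΛ
      leibniz := schouten_even_mul (mem_even_of_mem_two hΛ)
      sq_zero := hsq
      compat := schouten_ι_lie hΛ
      dual := (isDifferential_schouten hΛ).exists_dualLieAlgebroid hsq }

end Bivector

end SchoutenRules

/-! ### Sums over dual bases. -/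

section DualBasis
variable {k V A : Type*} [Field k] [AddCommGroup V] [Module k V] [FiniteDimensional k V]
  [Ring A] [Algebra k A]

/-- A linear map can be moved from one factor of the canonical tensor to the other one. -/
theorem sum_coord_comp_mul (Φ : Module.Dual k V →ₗ[k] A) (Ψ : V →ₗ[k] A) (T : V →ₗ[k] V) :
    ∑ i, Φ ((Module.finBasis k V).coord i ∘ₗ T) * Ψ (Module.finBasis k V i) =
      ∑ i, Φ ((Module.finBasis k V).coord i) * Ψ (T (Module.finBasis k V i)) := by
  set b := Module.finBasis k V
  have h1 (i) : T (b i) = ∑ j, b.coord j (T (b i)) • b j := by simp [b.sum_repr]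
  have h2 (j) : b.coord j ∘ₗ T = ∑ i, b.coord j (T (b i)) • b.coord i :=
    (b.sum_dual_apply_smul_coord (b.coord j ∘ₗ T)).symm
  simp_rw [h2]
  conv_rhs => enter [2, i]; rw [h1]
  simp only [map_sum, map_smul, Finset.sum_mul, Finset.mul_sum, smul_mul_assoc, mul_smul_comm]
  exact Finset.sum_comm

theorem sum_apply_smul_coord (ξ : Module.Dual k V) :
    ∑ i, ξ (Module.finBasis k V i) • (Module.finBasis k V).coord i = ξ :=
  (Module.finBasis k V).sum_dual_apply_smul_coord ξ

/-- The map `v ⊗ w ↦ Φ v * Ψ w`. -/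
noncomputable def prodMap {V W : Type*} [AddCommGroup V] [Module k V] [AddCommGroup W]
    [Module k W] (Φ : V →ₗ[k] A) (Ψ : W →ₗ[k] A) : V ⊗[k] W →ₗ[k] A :=
  LinearMap.mul' k A ∘ₗ TensorProduct.map Φ Ψ

theorem prodMap_tmul {V W : Type*} [AddCommGroup V] [Module k V] [AddCommGroup W]
    [Module k W] (Φ : V →ₗ[k] A) (Ψ : W →ₗ[k] A) (v : V) (w : W) :
    prodMap Φ Ψ (v ⊗ₜ w) = Φ v * Ψ w := rfl

theorem prodMap_comm {V : Type*} [AddCommGroup V] [Module k V] (Φ Ψ : V →ₗ[k] A)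
    (h : ∀ v w, Φ v * Ψ w = -(Ψ w * Φ v)) (t : V ⊗[k] V) :
    prodMap Φ Ψ (TensorProduct.comm k V V t) = -prodMap Ψ Φ t := by
  induction t with
  | zero => simp
  | tmul v w => rw [TensorProduct.comm_tmul, prodMap_tmul, prodMap_tmul, h]
  | add s t hs ht => simp only [map_add, hs, ht]; abel

variable [CharZero k] {𝔥 : Type*} [LieRing 𝔥] [LieAlgebra k 𝔥] [LieBialgebra k 𝔥]
  [FiniteDimensional k 𝔥]

/-- Contracting a leg with the dual basis and restoring it with the basis gives back the tensor.
This lemma and its two variants below remove bases from sums that involve a cobracket. -/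
theorem sum_mul_contractTensor (Φ Ψ : 𝔥 →ₗ[k] A) (t : 𝔥 ⊗[k] 𝔥) :
    ∑ i, Φ (Module.finBasis k 𝔥 i) * Ψ (contractTensor ((Module.finBasis k 𝔥).coord i) t) =
      prodMap Φ Ψ t := by
  induction t with
  | zero => simp
  | tmul x y =>
    simp only [contractTensor_tmul, map_smul, mul_smul_comm, prodMap_tmul]
    conv_rhs => rw [← (Module.finBasis k 𝔥).sum_repr x]
    simp only [map_sum, map_smul, Finset.sum_mul, smul_mul_assoc, Module.Basis.coord_apply]
  | add s t hs ht => simp only [map_add, mul_add, Finset.sum_add_distrib, hs, ht]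

theorem sum_contractTensor_mul (Φ Ψ : 𝔥 →ₗ[k] A) (t : 𝔥 ⊗[k] 𝔥) :
    ∑ i, Ψ (contractTensor ((Module.finBasis k 𝔥).coord i) t) * Φ (Module.finBasis k 𝔥 i) =
      prodMap Ψ Φ (TensorProduct.comm k 𝔥 𝔥 t) := by
  induction t with
  | zero => simp
  | tmul x y =>
    simp only [contractTensor_tmul, map_smul, smul_mul_assoc, TensorProduct.comm_tmul, prodMap_tmul]
    conv_rhs => rw [← (Module.finBasis k 𝔥).sum_repr x]
    simp only [map_sum, map_smul, Finset.mul_sum, mul_smul_comm, Module.Basis.coord_apply]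
  | add s t hs ht => simp only [map_add, add_mul, Finset.sum_add_distrib, hs, ht]

theorem sum_pairTensor_smul_mul (Φ Ψ : 𝔥 →ₗ[k] A) (t : 𝔥 ⊗[k] 𝔥) :
    ∑ i, ∑ j, pairTensor ((Module.finBasis k 𝔥).coord i) ((Module.finBasis k 𝔥).coord j) t •
      (Φ (Module.finBasis k 𝔥 i) * Ψ (Module.finBasis k 𝔥 j)) = prodMap Φ Ψ t := by
  rw [← sum_mul_contractTensor]
  refine Finset.sum_congr rfl fun i _ => ?_
  simp only [← apply_contractTensor, ← mul_smul_comm, ← Finset.mul_sum, ← map_smul, ← map_sum,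
    Module.Basis.coord_apply, (Module.finBasis k 𝔥).sum_repr]

/-- The coadjoint action, and below the bracket of `𝔥^*`, are written as composition with an
endomorphism of `𝔥`, the form required by `sum_coord_comp_mul`. -/
theorem lie_dual_eq (x : 𝔥) (ξ : Module.Dual k 𝔥) :
    ⁅x, ξ⁆ = -(ξ ∘ₗ (LieModule.toEnd k 𝔥 𝔥 x : 𝔥 →ₗ[k] 𝔥)) := by
  ext y; simp

theorem dualBracket_eq_comp (ξ ζ : Module.Dual k 𝔥) :
    dualBracket ξ ζ = ζ ∘ₗ (contractTensor ξ ∘ₗ LieBialgebra.cobracket) := by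
  ext y; exact (LieDouble.apply_contract ξ ζ y).symm

/-- The coadjoint action can be moved to the other factor of the canonical tensor. -/
theorem sum_lie_coord_mul (Φ : Module.Dual k 𝔥 →ₗ[k] A)
    (Ψ : 𝔥 →ₗ[k] A) (x : 𝔥) :
    ∑ i, Φ ⁅x, (Module.finBasis k 𝔥).coord i⁆ * Ψ (Module.finBasis k 𝔥 i) =
      -∑ i, Φ ((Module.finBasis k 𝔥).coord i) * Ψ ⁅x, Module.finBasis k 𝔥 i⁆ := by
  have h := sum_coord_comp_mul Φ Ψ (LieModule.toEnd k 𝔥 𝔥 x : 𝔥 →ₗ[k] 𝔥)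
  simp only [lie_dual_eq, map_neg, neg_mul, Finset.sum_neg_distrib]
  rw [h]
  rfl

theorem sum_dualBracket_coord_mul (Φ : Module.Dual k 𝔥 →ₗ[k] A)
    (Ψ : 𝔥 →ₗ[k] A) (ξ : Module.Dual k 𝔥) :
    ∑ i, Φ (dualBracket ξ ((Module.finBasis k 𝔥).coord i)) * Ψ (Module.finBasis k 𝔥 i) =
      ∑ i, Φ ((Module.finBasis k 𝔥).coord i) *
        Ψ (contractTensor ξ (LieBialgebra.cobracket (Module.finBasis k 𝔥 i))) := by
  simp only [dualBracket_eq_comp]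
  exact sum_coord_comp_mul Φ Ψ _

end DualBasis

/-! ### Jacobi and co-Jacobi identities as vanishing squares. -/

section AbstractJacobi

/-- The sum equals each of its two cyclic relabellings. As `E` is cyclically invariant, adding the
three produces the cyclic sums of `c`, and `3` is invertible. -/
theorem sum_cyclic_eq_zero {k M ι : Type*} [Field k] [CharZero k] [AddCommGroup M] [Module k M]
    [Fintype ι] (c : ι → ι → ι → k) (E : ι → ι → ι → M) (hE : ∀ i j m, E j m i = E i j m)
    (hc : ∀ i j m, c i j m + c j m i + c m i j = 0) : ∑ i, ∑ j, ∑ m, c i j m • E i j m = 0 := by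
  have hr (F : ι → ι → ι → M) : ∑ i, ∑ j, ∑ m, F j m i = ∑ i, ∑ j, ∑ m, F i j m := by
    rw [Finset.sum_comm]
    exact Finset.sum_congr rfl fun j _ => Finset.sum_comm
  have h1 := hr fun i j m => c i j m • E i j m
  have h2 := hr fun i j m => c j m i • E j m i
  have h3 : ∑ i, ∑ j, ∑ m, c i j m • E i j m + ∑ i, ∑ j, ∑ m, c j m i • E j m i +
      ∑ i, ∑ j, ∑ m, c m i j • E m i j = 0 := by
    simp only [← Finset.sum_add_distrib]
    refine Finset.sum_eq_zero fun i _ => Finset.sum_eq_zero fun j _ => Finset.sum_eq_zero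
      fun m _ => ?_
    rw [← hE m i j, hE i j m, ← add_smul, ← add_smul, hc, zero_smul]
  rw [h2, h1, ← two_smul k, ← one_smul k (∑ i, _), smul_smul, ← add_smul] at h3
  exact (smul_eq_zero_iff_right (by norm_num)).1 h3

variable {k A 𝔥 : Type*} [Field k] [CharZero k] [Ring A] [Algebra k A] [LieRing 𝔥] [LieAlgebra k 𝔥]
  [LieBialgebra k 𝔥] (D : A →ₗ[k] A)

/-- `D` extends the cobracket up to sign, so its value on `ν(h)` is a multiple of the image of `(ν ⊗
1) ν(h)` in products of anticommuting elements. There the three rotations in the co-Jacobi identity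
have the same image, so three times that image vanishes. -/
theorem apply_prodMap_cobracket_eq_zero (Φ : 𝔥 →ₗ[k] A) (hΦ : ∀ x y, Φ x * Φ y = -(Φ y * Φ x))
    (hD : ∀ x y, D (Φ x * Φ y) = D (Φ x) * Φ y - Φ x * D (Φ y))
    (h₁ : ∀ x, D (Φ x) = -prodMap Φ Φ (LieBialgebra.cobracket (k := k) x)) (h : 𝔥) :
    D (prodMap Φ Φ (LieBialgebra.cobracket (k := k) h)) = 0 := by
  let M : 𝔥 ⊗[k] (𝔥 ⊗[k] 𝔥) →ₗ[k] A :=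
    prodMap (Φ) (prodMap (Φ) (Φ))
  have hM (a b c : 𝔥) : M (a ⊗ₜ (b ⊗ₜ c)) = Φ a * (Φ b * Φ c) := rfl
  have hcyc (a b c : 𝔥) : Φ a * (Φ b * Φ c) = Φ c * (Φ a * Φ b) := by
    rw [hΦ b c, mul_neg, ← mul_assoc, hΦ a c, neg_mul, neg_neg, mul_assoc]
  have hM1 (t) : M (TensorProduct.assoc k 𝔥 𝔥 𝔥 (TensorProduct.comm k 𝔥 (𝔥 ⊗[k] 𝔥) t)) = M t := by
    induction t with
    | zero => simp
    | tmul a s =>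
      induction s with
      | zero => simp
      | tmul b c =>
        rw [TensorProduct.comm_tmul, TensorProduct.assoc_tmul, hM, hM, hcyc]
      | add s t hs ht => simp only [TensorProduct.tmul_add, map_add, hs, ht]
    | add s t hs ht => simp only [map_add, hs, ht]
  have hM2 (t) : M (TensorProduct.comm k (𝔥 ⊗[k] 𝔥) 𝔥
      ((TensorProduct.assoc k 𝔥 𝔥 𝔥).symm t)) = M t := by
    induction t with
    | zero => simp
    | tmul a s =>
      induction s with
      | zero => simp
      | tmul b c =>
        rw [TensorProduct.assoc_symm_tmul, TensorProduct.comm_tmul, hM, hM, ← hcyc]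
      | add s t hs ht => simp only [TensorProduct.tmul_add, map_add, hs, ht]
    | add s t hs ht => simp only [map_add, hs, ht]
  have h3 : M (TensorProduct.assoc k 𝔥 𝔥 𝔥
      ((LieBialgebra.cobracket (k := k)).rTensor 𝔥 (LieBialgebra.cobracket (k := k) h))) = 0 := by
    have h := congrArg M (LieBialgebra.coJacobi (k := k) h)
    simp only [map_add, hM1, hM2, map_zero] at h
    have e : ∀ Q : A, Q + Q + Q = (3 : k) • Q := fun Q => by
      rw [show (3 : k) = 1 + 1 + 1 by norm_num, add_smul, add_smul, one_smul]
    rw [e] at h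
    exact (smul_eq_zero_iff_right (by norm_num)).1 h
  let G : 𝔥 ⊗[k] 𝔥 →ₗ[k] A :=
    M ∘ₗ (TensorProduct.assoc k 𝔥 𝔥 𝔥).toLinearMap ∘ₗ
      (LieBialgebra.cobracket (k := k) (𝔥 := 𝔥)).rTensor 𝔥
  have ha (s : 𝔥 ⊗[k] 𝔥) (c : 𝔥) : M (TensorProduct.assoc k 𝔥 𝔥 𝔥 (s ⊗ₜ c)) =
      prodMap (Φ) (Φ) s * Φ c := by
    induction s with
    | zero => simp
    | tmul a b => rw [TensorProduct.assoc_tmul, hM, prodMap_tmul, mul_assoc]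
    | add s t hs ht => simp only [TensorProduct.add_tmul, map_add, hs, ht, add_mul]
  have hc (s : 𝔥 ⊗[k] 𝔥) (c : 𝔥) : Φ c * prodMap (Φ) (Φ) s =
      prodMap (Φ) (Φ) s * Φ c := by
    induction s with
    | zero => simp
    | tmul a b => rw [prodMap_tmul, ← hcyc, mul_assoc]
    | add s t hs ht => simp only [map_add, hs, ht, add_mul, mul_add]
  have hG (a b : 𝔥) : G (a ⊗ₜ b) =
    prodMap (Φ) (Φ) (LieBialgebra.cobracket (k := k) a) * Φ b := ha _ _
  -- For `t = ν(h)` skew-symmetry turns the right side into `-2 G(ν(h))`, and `G(ν(h))` is the image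
  -- of `(ν ⊗ 1) ν(h)`.
  have h4 (t : 𝔥 ⊗[k] 𝔥) : D (prodMap (Φ) (Φ) t) =
      G (TensorProduct.comm k 𝔥 𝔥 t) - G t := by
    induction t with
    | zero => simp
    | tmul a b =>
      rw [TensorProduct.comm_tmul, hG, hG, prodMap_tmul, hD, h₁, h₁, mul_neg, hc]
      noncomm_ring
    | add s t hs ht =>
      rw [map_add (prodMap _ _), map_add D, hs, ht, map_add (TensorProduct.comm k 𝔥 𝔥),
        map_add G, map_add G]
      abel
  have h5 : G (LieBialgebra.cobracket (k := k) h) = 0 := h3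
  rw [h4, LieBialgebra.skew, map_neg, h5, neg_zero, sub_zero]

/-- `D` behaves like a Chevalley-Eilenberg differential for the coadjoint action. Its square on `ξ`
is `X - Y`, where `X` collects the terms `⁅h_i, ⁅h_j, ξ⁆⁆` and `Y` the terms `⁅⁅h_i, h_j⁆, ξ⁆`.
Anticommutation gives `Y = 2 X`, and the Jacobi identity gives `Y = 0`. -/
theorem apply_apply_dual_eq_zero [FiniteDimensional k 𝔥] (Φ : Module.Dual k 𝔥 →ₗ[k] A)
    (hΦ : ∀ x y, Φ x * Φ y = -(Φ y * Φ x))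
    (hD : ∀ x y, D (Φ x * Φ y) = D (Φ x) * Φ y - Φ x * D (Φ y))
    (h₁ : ∀ ξ, D (Φ ξ) =
      ∑ i, Φ ((Module.finBasis k 𝔥).coord i) * Φ ⁅Module.finBasis k 𝔥 i, ξ⁆)
    (ξ : Module.Dual k 𝔥) : D (D (Φ ξ)) = 0 := by
  set b := Module.finBasis k 𝔥 with hb
  set X := ∑ i, ∑ j, Φ (b.coord i) * (Φ (b.coord j) * Φ ⁅b i, ⁅b j, ξ⁆⁆) with hX
  set Y := ∑ i, ∑ j, Φ (b.coord i) * (Φ (b.coord j) * Φ ⁅⁅b i, b j⁆, ξ⁆) with hY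
  have hX' : ∑ i, ∑ j, Φ (b.coord i) * (Φ (b.coord j) * Φ ⁅b j, ⁅b i, ξ⁆⁆) =
      -X := by
    rw [Finset.sum_comm, hX, ← Finset.sum_neg_distrib]
    refine Finset.sum_congr rfl fun i _ => ?_
    rw [← Finset.sum_neg_distrib]
    refine Finset.sum_congr rfl fun j _ => ?_
    rw [← mul_assoc, hΦ, neg_mul, mul_assoc]
  have hXY : Y = X + X := by
    rw [hY]
    simp only [lie_lie, map_sub, mul_sub, Finset.sum_sub_distrib]
    rw [hX', ← hX, sub_neg_eq_add]
  -- In the dual basis the coefficients of `Y` are `-ξ ⁅⁅h_i, h_j⁆, h_m⁆`, whose cyclic sums vanish.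
  have hY0 : Y = 0 := by
    have h1 (i j) : Φ (b.coord i) * (Φ (b.coord j) * Φ ⁅⁅b i, b j⁆, ξ⁆) =
        ∑ m, (⁅⁅b i, b j⁆, ξ⁆ : Module.Dual k 𝔥) (b m) •
          (Φ (b.coord i) * (Φ (b.coord j) * Φ (b.coord m))) := by
      conv_lhs => rw [← sum_apply_smul_coord ⁅⁅b i, b j⁆, ξ⁆]
      rw [map_sum, Finset.mul_sum, Finset.mul_sum]
      simp only [map_smul, mul_smul_comm]
      rfl
    rw [hY]
    simp only [h1]
    refine sum_cyclic_eq_zero (fun i j m => (⁅⁅b i, b j⁆, ξ⁆ : Module.Dual k 𝔥) (b m))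
      (fun i j m => Φ (b.coord i) * (Φ (b.coord j) * Φ (b.coord m))) (fun i j m => ?_) (fun i j m => ?_)
    · rw [hΦ (b.coord m), mul_neg, ← mul_assoc, hΦ (b.coord j), neg_mul,
        neg_neg, mul_assoc]
    · simp only [Module.Dual.lie_apply]
      have hj := congrArg ξ (lie_jacobi (b m) (b i) (b j))
      rw [← lie_skew ⁅b i, b j⁆ (b m), ← lie_skew ⁅b j, b m⁆ (b i), ← lie_skew ⁅b m, b i⁆ (b j),
        map_neg, map_neg, map_neg]
      simp only [map_add, map_zero] at hj
      linear_combination hj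
  have hsq : D (D (Φ ξ)) = -Y + X := by
    let Ψ : 𝔥 →ₗ[k] A :=
      { toFun := fun x => Φ ⁅x, ξ⁆
        map_add' := fun x y => by rw [add_lie, map_add]
        map_smul' := fun c x => by rw [smul_lie, map_smul, RingHom.id_apply] }
    have h1 (i) : ∑ j, Φ ⁅b i, b.coord j⁆ * Φ ⁅b j, ξ⁆ =
        -∑ j, Φ (b.coord j) * Φ ⁅⁅b i, b j⁆, ξ⁆ := sum_lie_coord_mul Φ Ψ (b i)
    have h2 : ∑ i, ∑ j, Φ (b.coord j) * Φ ⁅b j, b.coord i⁆ * Φ ⁅b i, ξ⁆ = -Y := by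
      rw [Finset.sum_comm, hY, ← Finset.sum_neg_distrib]
      refine Finset.sum_congr rfl fun i _ => ?_
      simp only [mul_assoc, ← Finset.mul_sum, h1, mul_neg]
    rw [h₁, map_sum]
    simp only [hD, h₁, ← hb, Finset.sum_sub_distrib,
      Finset.sum_mul, Finset.mul_sum, Finset.sum_add_distrib]
    rw [h2, hX', sub_neg_eq_add]
  have hX0 : X = 0 := by
    rw [hY0, ← two_smul k] at hXY
    exact (smul_eq_zero_iff_right (by norm_num)).1 hXY.symm
  rw [hsq, hY0, hX0]
  simp

end AbstractJacobi

/-! ### Constant sections and the relations imposed by `J₀`. -/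

section Sections
variable {k 𝔤 L : Type*} [Field k] [CharZero k] [LieRing 𝔤] [LieAlgebra k 𝔤] [CommRing L]
  [Algebra k L] {𝔥 : LieSubalgebra k 𝔤} [FiniteDimensional k 𝔥] [LieBialgebra k 𝔥]
  (P : PoissonBaseAlgebra k 𝔥 L)

/-- The constant section of `(𝔤 ⊕ 𝔇𝔥)_L` given by `ξ`. -/
noncomputable def constSec : 𝔤 × LieDouble k 𝔥 →ₗ[k] P.Algebroid 𝔤 :=
  (AlgebroidIdeal.Quotient.mk (P.J₀ 𝔤)).restrictScalars k ∘ₗ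
    ActionAlgebroid.const (P.totalAction 𝔤)

theorem sec_eq (ξ : 𝔤 × LieDouble k 𝔥) : P.sec 𝔤 ξ = ExteriorAlgebra.ι L (constSec P ξ) := rfl

theorem lie_constSec (ξ ζ : 𝔤 × LieDouble k 𝔥) :
    ⁅constSec P ξ, constSec P ζ⁆ = constSec P ⁅ξ, ζ⁆ := by
  change AlgebroidIdeal.Quotient.mk (P.J₀ 𝔤) (ActionAlgebroid.algBracket (P.totalAction 𝔤)
    ((1 : L) ⊗ₜ ξ) ((1 : L) ⊗ₜ ζ)) = AlgebroidIdeal.Quotient.mk (P.J₀ 𝔤) ((1 : L) ⊗ₜ ⁅ξ, ζ⁆)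
  rw [ActionAlgebroid.algBracket_tmul]
  simp

theorem constSec_anchor (ξ : 𝔤 × LieDouble k 𝔥) (f : L) : ⁅constSec P ξ, f⁆ = P.action ξ.2 f := by
  change ActionAlgebroid.anchor (P.totalAction 𝔤) ((1 : L) ⊗ₜ ξ) f = _
  rw [ActionAlgebroid.anchor_tmul, one_smul]
  rfl

theorem algebroid_induction {p : P.Algebroid 𝔤 → Prop} (x : P.Algebroid 𝔤) (zero : p 0)
    (add : ∀ x y, p x → p y → p (x + y)) (smul : ∀ (f : L) ξ, p (f • constSec P ξ)) : p x := by
  obtain ⟨y, rfl⟩ := AlgebroidIdeal.Quotient.mk_surjective _ x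
  induction y using ActionAlgebroid.induction_smul_const with
  | zero => rw [map_zero]; exact zero
  | add x y hx hy => rw [map_add]; exact add _ _ hx hy
  | smul_const f ξ => rw [map_smul]; exact smul f ξ

theorem sec_anticomm (ξ ζ : 𝔤 × LieDouble k 𝔥) :
    P.sec 𝔤 ξ * P.sec 𝔤 ζ = -(P.sec 𝔤 ζ * P.sec 𝔤 ξ) := ι_anticomm _ _

theorem lieDeriv_sec (ξ ζ : 𝔤 × LieDouble k 𝔥) :
    lieDeriv k (constSec P ξ) (P.sec 𝔤 ζ) = P.sec 𝔤 ⁅ξ, ζ⁆ := by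
  rw [sec_eq, lieDeriv_ι, lie_constSec, sec_eq]

theorem lieDeriv_smul_right {k L B : Type*} [CommRing k] [CommRing L] [Algebra k L] [LieRing B]
    [LieAlgebra k B] [Module L B] [LieRingModule B L] [LieRinehartRing L B]
    [LieRinehartAlgebra k L B] (x : B) (f : L) (Q : ExteriorAlgebra L B) :
    lieDeriv k x (f • Q) = ⁅x, f⁆ • Q + f • lieDeriv k x Q := by
  rw [Algebra.smul_def, lieDeriv_mul, lieDeriv_algebraMap, ← Algebra.smul_def, ← Algebra.smul_def]

/-- The sum is twice the image of the generator of `J₀` attached to `f`, which is zero in the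
quotient. Brackets are affected by `J₀` only through this relation. -/
theorem sum_action_smul_sec (f : L) :
    ∑ i, (P.action (LieDouble.ofLie k 𝔥 (Module.finBasis k 𝔥 i)) f •
        P.sec 𝔤 (0, LieDouble.ofDual k 𝔥 ((Module.finBasis k 𝔥).coord i)) +
      P.action (LieDouble.ofDual k 𝔥 ((Module.finBasis k 𝔥).coord i)) f •
        P.sec 𝔤 (0, LieDouble.ofLie k 𝔥 (Module.finBasis k 𝔥 i))) = 0 := by
  have h : AlgebroidIdeal.Quotient.mk (P.J₀ 𝔤)
      (P.section₀ 𝔤 f (LieDouble.canonicalTensor k 𝔥)) = 0 := by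
    rw [← map_zero (AlgebroidIdeal.Quotient.mk (P.J₀ 𝔤)), AlgebroidIdeal.Quotient.mk_eq_iff,
      sub_zero]
    exact Submodule.subset_span ⟨f, rfl⟩
  have e (u v : LieDouble k 𝔥) : ExteriorAlgebra.ι L (AlgebroidIdeal.Quotient.mk (P.J₀ 𝔤)
      (P.section₀ 𝔤 f (u ⊗ₜ v))) = P.action u f • P.sec 𝔤 (0, v) := by
    have e' : P.section₀ 𝔤 f (u ⊗ₜ v) =
        P.action u f • ActionAlgebroid.const (P.totalAction 𝔤) ((0 : 𝔤), v) := by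
      change (P.action u f) ⊗ₜ[k] ((0 : 𝔤), v) = P.action u f • ((1 : L) ⊗ₜ[k] ((0 : 𝔤), v))
      rw [TensorProduct.smul_tmul', smul_eq_mul, mul_one]
    rw [e', map_smul, map_smul]
    rfl
  rw [LieDouble.canonicalTensor, map_smul, AlgebroidIdeal.Quotient.mk_ksmul,
    smul_eq_zero_iff_right (by norm_num)] at h
  have h' := congrArg (ExteriorAlgebra.ι L) h
  simpa only [map_sum, map_add, map_zero, e] using h'

end Sections

/-! ### Lie derivatives and contractions of the components of `Λ`. -/

section Generators
variable {k 𝔤 L : Type*} [Field k] [CharZero k] [LieRing 𝔤] [LieAlgebra k 𝔤] [CommRing L]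
  [Algebra k L] {𝔥 : LieSubalgebra k 𝔤} [FiniteDimensional k 𝔥] [LieBialgebra k 𝔥]
  (P : PoissonBaseAlgebra k 𝔥 L)

/-- The section given by an element of `𝔤`. -/
noncomputable def gSec : 𝔤 →ₗ[k] ExteriorAlgebra L (P.Algebroid 𝔤) :=
  P.sec 𝔤 ∘ₗ LinearMap.inl k 𝔤 (LieDouble k 𝔥)

/-- The section given by an element of `𝔥 ⊆ 𝔇𝔥`. -/
noncomputable def hSec : 𝔥 →ₗ[k] ExteriorAlgebra L (P.Algebroid 𝔤) :=
  P.sec 𝔤 ∘ₗ LinearMap.inr k 𝔤 (LieDouble k 𝔥) ∘ₗ LieDouble.ofLie k 𝔥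

/-- The section given by an element of `𝔥^* ⊆ 𝔇𝔥`. -/
noncomputable def eSec : Module.Dual k 𝔥 →ₗ[k] ExteriorAlgebra L (P.Algebroid 𝔤) :=
  P.sec 𝔤 ∘ₗ LinearMap.inr k 𝔤 (LieDouble k 𝔥) ∘ₗ LieDouble.ofDual k 𝔥

/-- The section given by an element of `𝔥 ⊆ 𝔤`. -/
noncomputable def hgSec : 𝔥 →ₗ[k] ExteriorAlgebra L (P.Algebroid 𝔤) :=
  gSec P ∘ₗ 𝔥.subtype

/-- The section given by an element of the diagonal `𝔥 ⊆ 𝔤 ⊕ 𝔇𝔥`. -/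
noncomputable def diagSec : 𝔥 →ₗ[k] ExteriorAlgebra L (P.Algebroid 𝔤) := hSec P + hgSec P

theorem hgSec_apply (h : 𝔥) : hgSec P h = gSec P (h : 𝔤) := rfl

theorem gSec_eq (x : 𝔤) : gSec P x = ExteriorAlgebra.ι L (constSec P (x, 0)) := rfl
theorem hSec_eq (h : 𝔥) : hSec P h = ExteriorAlgebra.ι L (constSec P (0, LieDouble.ofLie k 𝔥 h)) :=
  rfl
theorem eSec_eq (ξ : Module.Dual k 𝔥) :
    eSec P ξ = ExteriorAlgebra.ι L (constSec P (0, LieDouble.ofDual k 𝔥 ξ)) := rfl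

theorem varpi_eq : varpi P = ∑ i, eSec P ((Module.finBasis k 𝔥).coord i) *
    hSec P (Module.finBasis k 𝔥 i) := rfl

theorem varpiPrime_eq : varpiPrime P = ∑ i, eSec P ((Module.finBasis k 𝔥).coord i) *
    hgSec P (Module.finBasis k 𝔥 i) := rfl

theorem gSec_anticomm (x y : 𝔤) : gSec P x * gSec P y = -(gSec P y * gSec P x) :=
  sec_anticomm P _ _
theorem gSec_eSec (x : 𝔤) (ξ : Module.Dual k 𝔥) : gSec P x * eSec P ξ = -(eSec P ξ * gSec P x) :=
  sec_anticomm P _ _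
theorem gSec_hSec (x : 𝔤) (h : 𝔥) : gSec P x * hSec P h = -(hSec P h * gSec P x) :=
  sec_anticomm P _ _
theorem hSec_anticomm (x y : 𝔥) : hSec P x * hSec P y = -(hSec P y * hSec P x) :=
  sec_anticomm P _ _
theorem eSec_anticomm (x y : Module.Dual k 𝔥) : eSec P x * eSec P y = -(eSec P y * eSec P x) :=
  sec_anticomm P _ _
theorem diagSec_anticomm (x y : 𝔥) : diagSec P x * diagSec P y = -(diagSec P y * diagSec P x) := by
  have h : ∀ z, diagSec P z = P.sec 𝔤 ((z : 𝔤), LieDouble.ofLie k 𝔥 z) := fun z => by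
    have e : ((z : 𝔤), LieDouble.ofLie k 𝔥 z) = (0, LieDouble.ofLie k 𝔥 z) + ((z : 𝔤), 0) := by
      simp
    rw [e, map_add]; rfl
  rw [h, h]; exact sec_anticomm P _ _

/-- The Lie derivative along the section given by `x : 𝔤`. -/
noncomputable abbrev lieG (x : 𝔤) : ExteriorAlgebra L (P.Algebroid 𝔤) →ₗ[k] ExteriorAlgebra L (P.Algebroid 𝔤) :=
  lieDeriv k (constSec P (x, 0))

/-- The Lie derivative along the section given by `u : 𝔇𝔥`. -/
noncomputable abbrev lieD (u : LieDouble k 𝔥) :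
    ExteriorAlgebra L (P.Algebroid 𝔤) →ₗ[k] ExteriorAlgebra L (P.Algebroid 𝔤) :=
  lieDeriv k (constSec P ((0 : 𝔤), u))

theorem lieG_gSec (x y : 𝔤) : lieG P x (gSec P y) = gSec P ⁅x, y⁆ := by
  refine (lieDeriv_sec P _ _).trans (congrArg (P.sec 𝔤) ?_)
  exact Prod.ext rfl (lie_zero _)

theorem lieG_sec_double (x : 𝔤) (u : LieDouble k 𝔥) : lieG P x (P.sec 𝔤 (0, u)) = 0 := by
  refine (lieDeriv_sec P _ _).trans ?_
  rw [show ⁅((x, 0) : 𝔤 × LieDouble k 𝔥), ((0, u) : 𝔤 × LieDouble k 𝔥)⁆ = 0 from Prod.ext (lie_zero _) (zero_lie _),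
    map_zero]

theorem lieG_hSec (x : 𝔤) (h : 𝔥) : lieG P x (hSec P h) = 0 := lieG_sec_double P x _
theorem lieG_eSec (x : 𝔤) (ξ : Module.Dual k 𝔥) : lieG P x (eSec P ξ) = 0 := lieG_sec_double P x _

theorem lieD_gSec (u : LieDouble k 𝔥) (x : 𝔤) : lieD P u (gSec P x) = 0 := by
  refine (lieDeriv_sec P (0, u) (x, 0)).trans ?_
  rw [show ⁅((0, u) : 𝔤 × LieDouble k 𝔥), ((x, 0) : 𝔤 × LieDouble k 𝔥)⁆ = 0 from Prod.ext (zero_lie _) (lie_zero _),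
    map_zero]

theorem lieD_sec_double (u v : LieDouble k 𝔥) :
    lieD P u (P.sec 𝔤 (0, v)) = P.sec 𝔤 (0, ⁅u, v⁆) := by
  refine (lieDeriv_sec P _ _).trans (congrArg (P.sec 𝔤) ?_)
  exact Prod.ext (lie_zero _) rfl

theorem sec_double_eq (u : LieDouble k 𝔥) : P.sec 𝔤 (0, u) = hSec P u.1 + eSec P u.2 := by
  rw [hSec, eSec]
  simp only [LinearMap.comp_apply, ← map_add]
  congr 2
  exact Prod.ext (add_zero _).symm (zero_add _).symm

theorem ofLie_fst (x : 𝔥) : (LieDouble.ofLie k 𝔥 x).1 = x := rfl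
theorem ofLie_snd (x : 𝔥) : (LieDouble.ofLie k 𝔥 x).2 = 0 := rfl
theorem ofDual_fst (ξ : Module.Dual k 𝔥) : (LieDouble.ofDual k 𝔥 ξ).1 = 0 := rfl
theorem ofDual_snd (ξ : Module.Dual k 𝔥) : (LieDouble.ofDual k 𝔥 ξ).2 = ξ := rfl

theorem lieD_ofLie_hSec (x y : 𝔥) :
    lieD P (LieDouble.ofLie k 𝔥 x) (hSec P y) = hSec P ⁅x, y⁆ := by
  refine (lieD_sec_double P _ _).trans ?_
  rw [sec_double_eq, LieDouble.bracket_fst, LieDouble.bracket_snd]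
  simp [ofLie_fst, ofLie_snd, ofDual_fst, ofDual_snd, contractTensor, dualBracket, pairTensor]

/-- In the double, `𝔥` and `𝔥^*_{op}` act on each other. The component in `𝔥` is what brings the
cobracket into the derivatives of `ϖ` and `ϖ'`. -/
theorem lieD_ofLie_eSec (x : 𝔥) (ξ : Module.Dual k 𝔥) :
    lieD P (LieDouble.ofLie k 𝔥 x) (eSec P ξ) =
      eSec P ⁅x, ξ⁆ - hSec P (contractTensor ξ (LieBialgebra.cobracket x)) := by
  refine (lieD_sec_double P _ _).trans ?_
  rw [sec_double_eq, LieDouble.bracket_fst, LieDouble.bracket_snd]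
  simp [ofLie_fst, ofLie_snd, ofDual_fst, ofDual_snd, contractTensor, dualBracket, pairTensor]
  abel

theorem lieD_ofDual_hSec (ξ : Module.Dual k 𝔥) (x : 𝔥) :
    lieD P (LieDouble.ofDual k 𝔥 ξ) (hSec P x) =
      hSec P (contractTensor ξ (LieBialgebra.cobracket x)) - eSec P ⁅x, ξ⁆ := by
  refine (lieD_sec_double P _ _).trans ?_
  rw [sec_double_eq, LieDouble.bracket_fst, LieDouble.bracket_snd]
  simp [ofLie_fst, ofLie_snd, ofDual_fst, ofDual_snd, contractTensor, dualBracket, pairTensor]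
  abel

theorem lieD_ofDual_eSec (ξ ζ : Module.Dual k 𝔥) :
    lieD P (LieDouble.ofDual k 𝔥 ξ) (eSec P ζ) = -eSec P (dualBracket ξ ζ) := by
  refine (lieD_sec_double P _ _).trans ?_
  rw [sec_double_eq, LieDouble.bracket_fst, LieDouble.bracket_snd]
  simp [ofLie_fst, ofLie_snd, ofDual_fst, ofDual_snd, contractTensor, dualBracket, pairTensor]

/-! #### Lie derivatives of `ϖ` and `ϖ'` -/

theorem lieG_varpi (x : 𝔤) : lieG P x (varpi P) = 0 := by
  simp only [varpi_eq, map_sum, lieDeriv_mul, lieG_hSec, lieG_eSec, zero_mul, mul_zero, add_zero,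
    Finset.sum_const_zero]

/-- The coadjoint terms cancel because `∑ η^i ⊗ h_i` is `𝔥`-invariant. Only the `𝔥`-components of
`[h, η^i]` survive, and they reassemble `ν(h)`. -/
theorem lieD_ofLie_varpi (h : 𝔥) : lieD P (LieDouble.ofLie k 𝔥 h) (varpi P) =
    prodMap (hSec P) (hSec P) (LieBialgebra.cobracket (k := k) h) := by
  simp only [varpi_eq, map_sum, lieDeriv_mul, lieD_ofLie_hSec, lieD_ofLie_eSec, sub_mul,
    Finset.sum_add_distrib, Finset.sum_sub_distrib, sum_lie_coord_mul, sum_contractTensor_mul]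
  rw [prodMap_comm _ _ (hSec_anticomm P)]
  abel

/-- The terms with the bracket of `𝔥^*` cancel by the same invariance; the `𝔥^*`-components of `[ξ,
h_i]` remain. -/
theorem lieD_ofDual_varpi (ξ : Module.Dual k 𝔥) : lieD P (LieDouble.ofDual k 𝔥 ξ) (varpi P) =
    -∑ i, eSec P ((Module.finBasis k 𝔥).coord i) * eSec P ⁅Module.finBasis k 𝔥 i, ξ⁆ := by
  simp only [varpi_eq, map_sum, lieDeriv_mul, lieD_ofDual_hSec, lieD_ofDual_eSec, neg_mul, mul_sub,
    Finset.sum_add_distrib, Finset.sum_sub_distrib, Finset.sum_neg_distrib,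
    sum_dualBracket_coord_mul]
  abel

theorem lieG_varpiPrime (x : 𝔤) : lieG P x (varpiPrime P) =
    ∑ i, eSec P ((Module.finBasis k 𝔥).coord i) * gSec P ⁅x, (Module.finBasis k 𝔥 i : 𝔤)⁆ := by
  simp only [varpiPrime_eq, map_sum, lieDeriv_mul, lieG_eSec, zero_mul, zero_add, hgSec_apply,
    lieG_gSec]

/-- The coadjoint term has no partner here, as `𝔇𝔥` commutes with `𝔤`. For the diagonal copy of `𝔥`
it cancels against `lieG_varpiPrime`. -/
theorem lieD_ofLie_varpiPrime (h : 𝔥) : lieD P (LieDouble.ofLie k 𝔥 h) (varpiPrime P) =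
    prodMap (hSec P) (hgSec P) (LieBialgebra.cobracket (k := k) h) -
      ∑ i, eSec P ((Module.finBasis k 𝔥).coord i) * hgSec P ⁅h, Module.finBasis k 𝔥 i⁆ := by
  simp only [varpiPrime_eq, map_sum, lieDeriv_mul, lieD_ofLie_eSec, hgSec_apply, lieD_gSec,
    mul_zero, add_zero, sub_mul, Finset.sum_sub_distrib]
  have h1 := sum_lie_coord_mul (eSec P) (hgSec P) h
  have h2 := sum_contractTensor_mul (hgSec P) (hSec P) (LieBialgebra.cobracket (k := k) h)
  simp only [hgSec_apply] at h1 h2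
  rw [h1, h2, LieBialgebra.skew, map_neg]
  abel

theorem lieD_ofDual_varpiPrime (ξ : Module.Dual k 𝔥) :
    lieD P (LieDouble.ofDual k 𝔥 ξ) (varpiPrime P) =
      -∑ i, eSec P (dualBracket ξ ((Module.finBasis k 𝔥).coord i)) *
        hgSec P (Module.finBasis k 𝔥 i) := by
  simp only [varpiPrime_eq, map_sum, lieDeriv_mul, lieD_ofDual_eSec, hgSec_apply, lieD_gSec,
    mul_zero, add_zero, neg_mul, Finset.sum_neg_distrib]

/-! #### Bivectors with values in `𝔤` -/

theorem tensor₃_induction {V W : Type*} [AddCommGroup V] [Module k V] [AddCommGroup W]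
    [Module k W] {p : L ⊗[k] (V ⊗[k] W) → Prop} (t : L ⊗[k] (V ⊗[k] W)) (zero : p 0)
    (tmul : ∀ f v w, p (f ⊗ₜ (v ⊗ₜ w))) (add : ∀ s t, p s → p t → p (s + t)) : p t := by
  induction t with
  | zero => exact zero
  | add s t hs ht => exact add s t hs ht
  | tmul f s =>
    induction s with
    | zero => rw [TensorProduct.tmul_zero]; exact zero
    | add s t hs ht => rw [TensorProduct.tmul_add]; exact add _ _ hs ht
    | tmul v w => exact tmul f v w

theorem toBivector_tmul' (f : L) (a b : 𝔤) :
    P.toBivector 𝔤 (f ⊗ₜ (a ⊗ₜ b)) = f • (gSec P a * gSec P b) := rfl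

theorem toBivector_one_tmul (t : 𝔥 ⊗[k] 𝔥) :
    P.toBivector 𝔤 (1 ⊗ₜ TensorProduct.map 𝔥.subtype 𝔥.subtype t) =
      prodMap (hgSec P) (hgSec P) t := by
  induction t with
  | zero => simp
  | tmul x y => rw [TensorProduct.map_tmul, toBivector_tmul', one_smul]; rfl
  | add s t hs ht => simp only [map_add, TensorProduct.tmul_add, hs, ht]

theorem toBivector_mem (r : L ⊗[k] (𝔤 ⊗[k] 𝔤)) :
    P.toBivector 𝔤 r ∈ ⋀[L]^2 (P.Algebroid 𝔤) := by
  induction r using tensor₃_induction with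
  | zero => rw [map_zero]; exact zero_mem _
  | tmul f a b => exact Submodule.smul_mem _ _ (ι_mul_ι_mem _ _)
  | add s t hs ht => rw [map_add]; exact add_mem hs ht

theorem varpi_mem : varpi P ∈ ⋀[L]^2 (P.Algebroid 𝔤) :=
  sum_mem fun _ _ => ι_mul_ι_mem _ _

theorem varpiPrime_mem : varpiPrime P ∈ ⋀[L]^2 (P.Algebroid 𝔤) :=
  sum_mem fun _ _ => ι_mul_ι_mem _ _

theorem ksmul_mem_two (c : k) {Q : ExteriorAlgebra L (P.Algebroid 𝔤)}
    (hQ : Q ∈ ⋀[L]^2 (P.Algebroid 𝔤)) : c • Q ∈ ⋀[L]^2 (P.Algebroid 𝔤) := by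
  rw [← algebraMap_smul L c Q]; exact Submodule.smul_mem _ _ hQ

theorem bivector_mem (r : L ⊗[k] (𝔤 ⊗[k] 𝔤)) : bivector P r ∈ ⋀[L]^2 (P.Algebroid 𝔤) :=
  add_mem (toBivector_mem P r) (add_mem (varpi_mem P) (ksmul_mem_two P _ (varpiPrime_mem P)))

theorem lieG_smul (x : 𝔤) (f : L) (Q : ExteriorAlgebra L (P.Algebroid 𝔤)) :
    lieG P x (f • Q) = f • lieG P x Q := by
  rw [lieG, lieDeriv_smul_right, constSec_anchor]
  simp

theorem lieD_smul (u : LieDouble k 𝔥) (f : L) (Q : ExteriorAlgebra L (P.Algebroid 𝔤)) :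
    lieD P u (f • Q) = P.action u f • Q + f • lieD P u Q := by
  rw [lieD, lieDeriv_smul_right, constSec_anchor]

theorem lieG_toBivector (x : 𝔤) (r : L ⊗[k] (𝔤 ⊗[k] 𝔤)) : lieG P x (P.toBivector 𝔤 r) =
    P.toBivector 𝔤 ((LieModule.toEnd k 𝔤 (𝔤 ⊗[k] 𝔤) x).lTensor L r) := by
  induction r using tensor₃_induction with
  | zero => simp
  | tmul f a b =>
    rw [LinearMap.lTensor_tmul, LieModule.toEnd_apply_apply,
      TensorProduct.LieModule.lie_tmul_right, TensorProduct.tmul_add, map_add, toBivector_tmul',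
      toBivector_tmul', toBivector_tmul', lieG_smul, lieDeriv_mul, lieG_gSec, lieG_gSec, smul_add]
  | add s t hs ht => simp only [map_add, hs, ht]

theorem lieD_toBivector (u : LieDouble k 𝔥) (r : L ⊗[k] (𝔤 ⊗[k] 𝔤)) :
    lieD P u (P.toBivector 𝔤 r) = P.toBivector 𝔤 (P.act u _ r) := by
  induction r using tensor₃_induction with
  | zero => simp
  | tmul f a b =>
    rw [PoissonBaseAlgebra.act, LinearMap.rTensor_tmul, toBivector_tmul', toBivector_tmul',
      lieD_smul, lieDeriv_mul, lieD_gSec, lieD_gSec, zero_mul, mul_zero, add_zero, smul_zero,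
      add_zero]
    rfl
  | add s t hs ht => simp only [map_add, hs, ht]

theorem contract_gSec (f : L) (x : 𝔤) :
    CliffordAlgebra.contractLeft (anchorDiff (P.Algebroid 𝔤) f) (gSec P x) = 0 := by
  rw [gSec_eq, contractLeft_ι', anchorDiff_apply, constSec_anchor]
  simp

theorem contract_hSec (f : L) (x : 𝔥) :
    CliffordAlgebra.contractLeft (anchorDiff (P.Algebroid 𝔤) f) (hSec P x) =
      algebraMap L _ (P.action (LieDouble.ofLie k 𝔥 x) f) := by
  rw [hSec_eq, contractLeft_ι', anchorDiff_apply, constSec_anchor]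

theorem contract_eSec (f : L) (ξ : Module.Dual k 𝔥) :
    CliffordAlgebra.contractLeft (anchorDiff (P.Algebroid 𝔤) f) (eSec P ξ) =
      algebraMap L _ (P.action (LieDouble.ofDual k 𝔥 ξ) f) := by
  rw [eSec_eq, contractLeft_ι', anchorDiff_apply, constSec_anchor]

/-- `𝔤` has zero anchor, so `r` does not contribute to `[Λ, f]`. -/
theorem contract_toBivector (f : L) (r : L ⊗[k] (𝔤 ⊗[k] 𝔤)) :
    CliffordAlgebra.contractLeft (anchorDiff (P.Algebroid 𝔤) f) (P.toBivector 𝔤 r) = 0 := by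
  induction r using tensor₃_induction with
  | zero => simp
  | tmul g a b =>
    rw [toBivector_tmul', map_smul, contractLeft_mul', contract_gSec, contract_gSec, zero_mul,
      mul_zero, add_zero, smul_zero]
  | add s t hs ht => simp only [map_add, hs, ht, add_zero]

theorem involute_eSec (ξ : Module.Dual k 𝔥) :
    CliffordAlgebra.involute (eSec P ξ) = -eSec P ξ := involute_ι' _
theorem involute_hSec (x : 𝔥) : CliffordAlgebra.involute (hSec P x) = -hSec P x := involute_ι' _
theorem involute_gSec (x : 𝔤) : CliffordAlgebra.involute (gSec P x) = -gSec P x := involute_ι' _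

/-- The relation `∑ (h_i ▹ f) η^i + (η^i ▹ f) h_i = 0`. -/
theorem sum_action_smul_eSec (f : L) :
    ∑ i, P.action (LieDouble.ofLie k 𝔥 (Module.finBasis k 𝔥 i)) f •
        eSec P ((Module.finBasis k 𝔥).coord i) =
      -∑ i, P.action (LieDouble.ofDual k 𝔥 ((Module.finBasis k 𝔥).coord i)) f •
        hSec P (Module.finBasis k 𝔥 i) := by
  have h := sum_action_smul_sec P f
  rw [Finset.sum_add_distrib] at h
  exact eq_neg_of_add_eq_zero_left h

/-- Contraction yields the terms `(η^i ▹ f) h_i` and `-(h_i ▹ f) η^i`. The relation from `J₀`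
identifies their sums, whence the factor `2`. -/
theorem contract_varpi (f : L) :
    CliffordAlgebra.contractLeft (anchorDiff (P.Algebroid 𝔤) f) (varpi P) =
      (2 : k) • ∑ i, P.action (LieDouble.ofDual k 𝔥 ((Module.finBasis k 𝔥).coord i)) f •
        hSec P (Module.finBasis k 𝔥 i) := by
  simp only [varpi_eq, map_sum, contractLeft_mul', contract_hSec, contract_eSec, involute_eSec,
    neg_mul, smul_neg, ← Algebra.commutes, ← Algebra.smul_def, Finset.sum_add_distrib,
    Finset.sum_neg_distrib, sum_action_smul_eSec, neg_neg, two_smul]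

theorem contract_varpiPrime (f : L) :
    CliffordAlgebra.contractLeft (anchorDiff (P.Algebroid 𝔤) f) (varpiPrime P) =
      ∑ i, P.action (LieDouble.ofDual k 𝔥 ((Module.finBasis k 𝔥).coord i)) f •
        hgSec P (Module.finBasis k 𝔥 i) := by
  simp only [varpiPrime_eq, map_sum, contractLeft_mul', hgSec_apply, contract_gSec, contract_eSec,
    involute_eSec, mul_zero, add_zero, ← Algebra.smul_def]

/-- The weight `2` of `ϖ'` in `Λ₀` matches the doubling in `contract_varpi`, so that only diagonal
sections appear. -/
theorem contract_bivector (r : L ⊗[k] (𝔤 ⊗[k] 𝔤)) (f : L) :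
    CliffordAlgebra.contractLeft (anchorDiff (P.Algebroid 𝔤) f) (bivector P r) =
      (2 : k) • ∑ i, P.action (LieDouble.ofDual k 𝔥 ((Module.finBasis k 𝔥).coord i)) f •
        diagSec P (Module.finBasis k 𝔥 i) := by
  have e : CliffordAlgebra.contractLeft (anchorDiff (P.Algebroid 𝔤) f) ((2 : k) • varpiPrime P) =
      (2 : k) • CliffordAlgebra.contractLeft (anchorDiff (P.Algebroid 𝔤) f) (varpiPrime P) := by
    simp only [two_smul, map_add]
  rw [bivector, bivector₀, map_add, map_add, contract_toBivector, e, contract_varpi,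
    contract_varpiPrime, zero_add, ← smul_add, ← Finset.sum_add_distrib]
  simp only [diagSec, LinearMap.add_apply, smul_add]

end Generators

/-! ### The square of `[Λ, ·]` on functions, and brackets of the components of `Λ`. -/

section Brackets
variable {k 𝔤 L : Type*} [Field k] [CharZero k] [LieRing 𝔤] [LieAlgebra k 𝔤] [CommRing L]
  [Algebra k L] {𝔥 : LieSubalgebra k 𝔤} [FiniteDimensional k 𝔥] [LieBialgebra k 𝔥]
  (P : PoissonBaseAlgebra k 𝔥 L)

/-- The defect of equivariance of `r`. -/
noncomputable def equivarianceDefect (r : L ⊗[k] (𝔤 ⊗[k] 𝔤)) (h : 𝔥) : L ⊗[k] (𝔤 ⊗[k] 𝔤) :=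
  P.act (LieDouble.ofLie k 𝔥 h) _ r +
    (LieModule.toEnd k 𝔤 (𝔤 ⊗[k] 𝔤) (h : 𝔤)).lTensor L r -
    1 ⊗ₜ TensorProduct.map 𝔥.subtype 𝔥.subtype (LieBialgebra.cobracket (k := k) h)

/-- The two mixed terms agree: exchanging the factors gives one sign from anticommutation and one
from skewness of `t`. -/
theorem prodMap_diagSec (t : 𝔥 ⊗[k] 𝔥) (ht : TensorProduct.comm k 𝔥 𝔥 t = -t) :
    prodMap (diagSec P) (diagSec P) t = prodMap (hSec P) (hSec P) t +
      (2 : k) • prodMap (hSec P) (hgSec P) t + prodMap (hgSec P) (hgSec P) t := by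
  have h1 : prodMap (hgSec P) (hSec P) t = prodMap (hSec P) (hgSec P) t := by
    have h := prodMap_comm (hgSec P) (hSec P) (fun v w => gSec_hSec P v w) t
    rw [ht, map_neg, neg_inj] at h
    exact h
  have h2 : prodMap (diagSec P) (diagSec P) t = prodMap (hSec P) (hSec P) t +
      prodMap (hSec P) (hgSec P) t + prodMap (hgSec P) (hSec P) t +
      prodMap (hgSec P) (hgSec P) t := by
    simp only [prodMap, diagSec, TensorProduct.map_add_left, TensorProduct.map_add_right,
      LinearMap.comp_apply, LinearMap.add_apply, map_add]
    abel
  rw [h2, h1, two_smul]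
  abel

/-- The `η^i`-terms of `ϖ'` cancel between the two derivatives. The remaining cobracket terms have
weight `1` in the double and weight `2` in the mixed part. The term `-ν(h)` of the defect
compensates for the part in `𝔤`, which completes them to the diagonal `ν(h)`. -/
theorem lie_diag_bivector (r : L ⊗[k] (𝔤 ⊗[k] 𝔤)) (h : 𝔥) :
    lieD P (LieDouble.ofLie k 𝔥 h) (bivector P r) + lieG P (h : 𝔤) (bivector P r) =
      P.toBivector 𝔤 (equivarianceDefect P r h) +
        prodMap (diagSec P) (diagSec P) (LieBialgebra.cobracket (k := k) h) := by
  have e : ∀ i, gSec P ⁅(h : 𝔤), (Module.finBasis k 𝔥 i : 𝔤)⁆ =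
    hgSec P ⁅h, Module.finBasis k 𝔥 i⁆ := fun i => rfl
  rw [prodMap_diagSec P _ (LieBialgebra.skew h)]
  simp only [bivector, bivector₀, map_add, map_smul, lieD_toBivector, lieG_toBivector,
    lieD_ofLie_varpi, lieG_varpi, lieD_ofLie_varpiPrime, lieG_varpiPrime, e, equivarianceDefect,
    map_sub, toBivector_one_tmul, smul_sub]
  abel

theorem schouten_diagSec (r : L ⊗[k] (𝔤 ⊗[k] 𝔤)) (h : 𝔥) :
    schouten k (bivector P r) (diagSec P h) = -(P.toBivector 𝔤 (equivarianceDefect P r h) +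
        prodMap (diagSec P) (diagSec P) (LieBialgebra.cobracket (k := k) h)) := by
  have hev := mem_even_of_mem_two (bivector_mem P r)
  rw [← lie_diag_bivector, diagSec, LinearMap.add_apply, hgSec_apply, map_add, hSec_eq, gSec_eq,
    schouten_even_ι hev, schouten_even_ι hev, neg_add]

theorem schouten_bivector_algebraMap (r : L ⊗[k] (𝔤 ⊗[k] 𝔤)) (f : L) :
    schouten k (bivector P r) (algebraMap L _ f) =
      -(2 : k) • ∑ i, P.action (LieDouble.ofDual k 𝔥 ((Module.finBasis k 𝔥).coord i)) f •
        diagSec P (Module.finBasis k 𝔥 i) := by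
  rw [schouten_even_algebraMap (mem_even_of_mem_two (bivector_mem P r)), contract_bivector,
    neg_smul]

theorem schouten_even_smul {k L B : Type*} [CommRing k] [CommRing L] [Algebra k L] [LieRing B]
    [LieAlgebra k B] [Module L B] [LieRingModule B L] [LieRinehartRing L B]
    [LieRinehartAlgebra k L B] {Λ : ExteriorAlgebra L B} (hΛ : Λ ∈ ⋀[L]^2 B) (f : L)
    (Q : ExteriorAlgebra L B) :
    schouten k Λ (f • Q) = schouten k Λ (algebraMap L _ f) * Q + f • schouten k Λ Q := by
  rw [Algebra.smul_def, schouten_even_mul (mem_even_of_mem_two hΛ), AlgHom.commutes,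
    ← Algebra.smul_def]

theorem action_ofDual_eq_sum (ξ : Module.Dual k 𝔥) (f : L) :
    P.action (LieDouble.ofDual k 𝔥 ξ) f = ∑ i, ξ (Module.finBasis k 𝔥 i) •
      P.action (LieDouble.ofDual k 𝔥 ((Module.finBasis k 𝔥).coord i)) f := by
  conv_lhs => rw [← sum_apply_smul_coord ξ]
  change evalAction P.action f _ = _
  simp only [map_sum, map_smul]
  rfl

theorem lie_ofDual (ξ ζ : Module.Dual k 𝔥) :
    ⁅LieDouble.ofDual k 𝔥 ξ, LieDouble.ofDual k 𝔥 ζ⁆ =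
      -LieDouble.ofDual k 𝔥 (dualBracket ξ ζ) := by
  refine Prod.ext ?_ ?_
  · change (⁅LieDouble.ofDual k 𝔥 ξ, LieDouble.ofDual k 𝔥 ζ⁆ : LieDouble k 𝔥).1 = -0
    rw [LieDouble.bracket_fst]
    simp [ofDual_fst]
  · change (⁅LieDouble.ofDual k 𝔥 ξ, LieDouble.ofDual k 𝔥 ζ⁆ : LieDouble k 𝔥).2 = -dualBracket ξ ζ
    rw [LieDouble.bracket_snd]
    simp [ofDual_fst, ofDual_snd]

/-- Diagonal sections anticommute, so only commutators of the actions of `η^j` and `η^i` contribute.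
They are actions of brackets in `𝔥^*_{op}`, whose structure constants are those of `ν` with the
opposite sign. -/
theorem sum_sum_action_smul (f : L) :
    (2 : k) • ∑ i, ∑ j, P.action (LieDouble.ofDual k 𝔥 ((Module.finBasis k 𝔥).coord j))
        (P.action (LieDouble.ofDual k 𝔥 ((Module.finBasis k 𝔥).coord i)) f) •
        (diagSec P (Module.finBasis k 𝔥 j) * diagSec P (Module.finBasis k 𝔥 i)) =
      -∑ l, P.action (LieDouble.ofDual k 𝔥 ((Module.finBasis k 𝔥).coord l)) f •
        prodMap (diagSec P) (diagSec P)
          (LieBialgebra.cobracket (k := k) (Module.finBasis k 𝔥 l)) := by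
  set b := Module.finBasis k 𝔥 with hb
  have h1 : ∑ i, ∑ j, P.action (LieDouble.ofDual k 𝔥 (b.coord j))
        (P.action (LieDouble.ofDual k 𝔥 (b.coord i)) f) •
        (diagSec P (b j) * diagSec P (b i)) =
      -∑ i, ∑ j, P.action (LieDouble.ofDual k 𝔥 (b.coord i))
        (P.action (LieDouble.ofDual k 𝔥 (b.coord j)) f) •
        (diagSec P (b j) * diagSec P (b i)) := by
    rw [Finset.sum_comm, ← Finset.sum_neg_distrib]
    refine Finset.sum_congr rfl fun i _ => ?_
    rw [← Finset.sum_neg_distrib]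
    refine Finset.sum_congr rfl fun j _ => ?_
    rw [diagSec_anticomm P (b j), smul_neg, neg_neg]
  have h2 (i j) : P.action (LieDouble.ofDual k 𝔥 (b.coord j))
        (P.action (LieDouble.ofDual k 𝔥 (b.coord i)) f) -
      P.action (LieDouble.ofDual k 𝔥 (b.coord i))
        (P.action (LieDouble.ofDual k 𝔥 (b.coord j)) f) =
      -∑ l, dualBracket (b.coord j) (b.coord i) (b l) •
        P.action (LieDouble.ofDual k 𝔥 (b.coord l)) f := by
    rw [← action_ofDual_eq_sum, ← Derivation.commutator_apply, ← LieHom.map_lie, lie_ofDual,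
      map_neg, Derivation.neg_apply]
  have h3 (c : k) (g : L) (Q : ExteriorAlgebra L (P.Algebroid 𝔤)) : (c • g) • Q = g • (c • Q) := by
    rw [smul_assoc, smul_comm]
  rw [two_smul]
  conv_lhs => enter [2]; rw [h1]
  simp only [← sub_eq_add_neg, ← Finset.sum_sub_distrib, ← sub_smul, h2, neg_smul,
    Finset.sum_neg_distrib, Finset.sum_smul, h3]
  rw [neg_inj]
  conv_lhs => enter [2, i]; rw [Finset.sum_comm]
  rw [Finset.sum_comm]
  refine Finset.sum_congr rfl fun l _ => ?_
  simp only [← Finset.smul_sum]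
  rw [← sum_pairTensor_smul_mul, Finset.sum_comm]
  rfl

/-- The square of `[Λ, ·]` on functions is given by the defect of equivariance. -/
theorem schouten_schouten_algebraMap (r : L ⊗[k] (𝔤 ⊗[k] 𝔤)) (f : L) :
    schouten k (bivector P r) (schouten k (bivector P r) (algebraMap L _ f)) =
      (2 : k) • ∑ i, P.action (LieDouble.ofDual k 𝔥 ((Module.finBasis k 𝔥).coord i)) f •
        P.toBivector 𝔤 (equivarianceDefect P r (Module.finBasis k 𝔥 i)) := by
  rw [schouten_bivector_algebraMap, map_smul, map_sum]
  simp only [schouten_even_smul (bivector_mem P r), schouten_bivector_algebraMap, schouten_diagSec,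
    Finset.sum_add_distrib, smul_mul_assoc, Finset.sum_mul, smul_add, smul_neg,
    Finset.sum_neg_distrib, neg_add]
  -- The second derivatives of `f` become cobracket terms, which cancel those of `schouten_diagSec`.
  -- Only the defects remain.
  rw [← Finset.smul_sum, neg_smul, neg_smul, sum_sum_action_smul]
  simp only [neg_smul, smul_neg, neg_neg]
  abel

/-! #### Brackets of the components of `Λ` -/

theorem schouten_varpi_gSec (x : 𝔤) : schouten k (varpi P) (gSec P x) = 0 := by
  rw [gSec_eq, schouten_even_ι (mem_even_of_mem_two (varpi_mem P))]
  exact neg_eq_zero.2 (lieG_varpi P x)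

theorem schouten_varpi_hSec (h : 𝔥) : schouten k (varpi P) (hSec P h) =
    -prodMap (hSec P) (hSec P) (LieBialgebra.cobracket (k := k) h) := by
  rw [hSec_eq, schouten_even_ι (mem_even_of_mem_two (varpi_mem P)), ← lieD_ofLie_varpi]

theorem schouten_varpi_eSec (ξ : Module.Dual k 𝔥) : schouten k (varpi P) (eSec P ξ) =
    ∑ i, eSec P ((Module.finBasis k 𝔥).coord i) * eSec P ⁅Module.finBasis k 𝔥 i, ξ⁆ := by
  rw [eSec_eq, schouten_even_ι (mem_even_of_mem_two (varpi_mem P)), lieD_ofDual_varpi, neg_neg]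

theorem schouten_varpiPrime_gSec (x : 𝔤) : schouten k (varpiPrime P) (gSec P x) =
    -∑ i, eSec P ((Module.finBasis k 𝔥).coord i) * gSec P ⁅x, (Module.finBasis k 𝔥 i : 𝔤)⁆ := by
  rw [gSec_eq, schouten_even_ι (mem_even_of_mem_two (varpiPrime_mem P)), lieG_varpiPrime]

theorem schouten_varpiPrime_eSec (ξ : Module.Dual k 𝔥) :
    schouten k (varpiPrime P) (eSec P ξ) =
      ∑ i, eSec P (dualBracket ξ ((Module.finBasis k 𝔥).coord i)) *
        hgSec P (Module.finBasis k 𝔥 i) := by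
  rw [eSec_eq, schouten_even_ι (mem_even_of_mem_two (varpiPrime_mem P)), lieD_ofDual_varpiPrime,
    neg_neg]

/-- `ϖ` commutes with `𝔤`, so only the coefficient functions are differentiated; the `2` is that of
`contract_varpi`. -/
theorem schouten_varpi_toBivector (r : L ⊗[k] (𝔤 ⊗[k] 𝔤)) :
    schouten k (varpi P) (P.toBivector 𝔤 r) =
      -(2 : k) • ∑ i, hSec P (Module.finBasis k 𝔥 i) * P.toBivector 𝔤
        (P.act (LieDouble.ofDual k 𝔥 ((Module.finBasis k 𝔥).coord i)) _ r) := by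
  have hev := mem_even_of_mem_two (varpi_mem P)
  induction r using tensor₃_induction with
  | zero => simp
  | tmul f a b =>
    simp only [PoissonBaseAlgebra.act, LinearMap.rTensor_tmul, toBivector_tmul']
    rw [schouten_even_smul (varpi_mem P), schouten_even_algebraMap hev, contract_varpi,
      schouten_even_mul hev, schouten_varpi_gSec, schouten_varpi_gSec]
    simp only [zero_mul, mul_zero, add_zero, smul_zero, neg_mul, smul_mul_assoc, Finset.sum_mul,
      mul_smul_comm, neg_smul]
    rfl
  | add s t hs ht => simp only [map_add, hs, ht, mul_add, Finset.sum_add_distrib, smul_add]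

/-- The first sum comes from the coefficient functions. The second comes from the legs in `𝔤`, on
which `h_i` acts by the adjoint action. -/
theorem schouten_varpiPrime_toBivector (r : L ⊗[k] (𝔤 ⊗[k] 𝔤)) :
    schouten k (varpiPrime P) (P.toBivector 𝔤 r) =
      -∑ i, hgSec P (Module.finBasis k 𝔥 i) * P.toBivector 𝔤
        (P.act (LieDouble.ofDual k 𝔥 ((Module.finBasis k 𝔥).coord i)) _ r) +
      ∑ i, eSec P ((Module.finBasis k 𝔥).coord i) * P.toBivector 𝔤
        ((LieModule.toEnd k 𝔤 (𝔤 ⊗[k] 𝔤) (Module.finBasis k 𝔥 i : 𝔤)).lTensor L r) := by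
  have hev := mem_even_of_mem_two (varpiPrime_mem P)
  induction r using tensor₃_induction with
  | zero => simp
  | tmul f a b =>
    simp only [PoissonBaseAlgebra.act, LinearMap.rTensor_tmul, LinearMap.lTensor_tmul,
      LieModule.toEnd_apply_apply, TensorProduct.LieModule.lie_tmul_right, TensorProduct.tmul_add,
      map_add, toBivector_tmul']
    rw [schouten_even_smul (varpiPrime_mem P), schouten_even_algebraMap hev, contract_varpiPrime,
      schouten_even_mul hev, schouten_varpiPrime_gSec, schouten_varpiPrime_gSec, involute_gSec]
    have h1 (i) : eSec P ((Module.finBasis k 𝔥).coord i) * gSec P ⁅a, (Module.finBasis k 𝔥 i : 𝔤)⁆ *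
        gSec P b = -(eSec P ((Module.finBasis k 𝔥).coord i) *
          (gSec P ⁅(Module.finBasis k 𝔥 i : 𝔤), a⁆ * gSec P b)) := by
      rw [← lie_skew, map_neg, mul_neg, neg_mul, mul_assoc]
    have h2 (i) : gSec P a * (eSec P ((Module.finBasis k 𝔥).coord i) *
        gSec P ⁅b, (Module.finBasis k 𝔥 i : 𝔤)⁆) = eSec P ((Module.finBasis k 𝔥).coord i) *
          (gSec P a * gSec P ⁅(Module.finBasis k 𝔥 i : 𝔤), b⁆) := by
      rw [← lie_skew, map_neg, ← mul_assoc, gSec_eSec]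
      noncomm_ring
    simp only [neg_mul, mul_neg, neg_neg, Finset.sum_mul, Finset.mul_sum, h1, h2,
      smul_mul_assoc, mul_smul_comm, mul_add, Finset.sum_add_distrib, Finset.sum_neg_distrib,
      smul_add, ← Finset.smul_sum]
    rfl
  | add s t hs ht => simp only [map_add, hs, ht, mul_add, Finset.sum_add_distrib]; abel

/-- The relation `∑ h_i (η^i ▹ r) = -∑ η^i (h_i ▹ r)`. -/
theorem sum_hSec_mul_act (r : L ⊗[k] (𝔤 ⊗[k] 𝔤)) :
    ∑ i, hSec P (Module.finBasis k 𝔥 i) * P.toBivector 𝔤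
        (P.act (LieDouble.ofDual k 𝔥 ((Module.finBasis k 𝔥).coord i)) _ r) =
      -∑ i, eSec P ((Module.finBasis k 𝔥).coord i) * P.toBivector 𝔤
        (P.act (LieDouble.ofLie k 𝔥 (Module.finBasis k 𝔥 i)) _ r) := by
  induction r using tensor₃_induction with
  | zero => simp
  | tmul f a b =>
    have e (x Q : ExteriorAlgebra L (P.Algebroid 𝔤)) (c : L) : x * (c • Q) = (c • x) * Q := by
      rw [mul_smul_comm, smul_mul_assoc]
    simp only [PoissonBaseAlgebra.act, LinearMap.rTensor_tmul, toBivector_tmul', e,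
      ← Finset.sum_mul]
    rw [← neg_mul]
    exact congrArg (· * _) (neg_eq_iff_eq_neg.1 (sum_action_smul_eSec P f).symm)
  | add s t hs ht =>
    simp only [map_add, hs, ht, mul_add, Finset.sum_add_distrib]
    abel

/-- Expanding the bracket of `𝔥^*` in the dual basis gives the components of `ν(h_l)`; the sign
comes from exchanging the two factors in `𝔥`. -/
theorem sum_eSec_dualBracket_mul :
    ∑ i, ∑ j, eSec P (dualBracket ((Module.finBasis k 𝔥).coord i) ((Module.finBasis k 𝔥).coord j)) *
        hgSec P (Module.finBasis k 𝔥 j) * hgSec P (Module.finBasis k 𝔥 i) =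
      -∑ l, eSec P ((Module.finBasis k 𝔥).coord l) * prodMap (hgSec P) (hgSec P)
        (LieBialgebra.cobracket (k := k) (Module.finBasis k 𝔥 l)) := by
  set b := Module.finBasis k 𝔥
  have h1 (i j) : eSec P (dualBracket (b.coord i) (b.coord j)) * hgSec P (b j) * hgSec P (b i) =
      -∑ l, eSec P (b.coord l) *
        pairTensor (b.coord i) (b.coord j) (LieBialgebra.cobracket (k := k) (b l)) •
          (hgSec P (b i) * hgSec P (b j)) := by
    conv_lhs => rw [← sum_apply_smul_coord (dualBracket (b.coord i) (b.coord j))]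
    rw [mul_assoc, hgSec_apply P (b j), hgSec_apply P (b i), gSec_anticomm P (b j), mul_neg,
      map_sum, Finset.sum_mul]
    simp only [map_smul, smul_mul_assoc, mul_smul_comm]
    rfl
  simp only [h1, Finset.sum_neg_distrib, ← sum_pairTensor_smul_mul, Finset.mul_sum]
  rw [neg_inj]
  conv_lhs => enter [2, i]; rw [Finset.sum_comm]
  rw [Finset.sum_comm]

theorem schouten_varpiPrime_self : schouten k (varpiPrime P) (varpiPrime P) =
    -∑ l, eSec P ((Module.finBasis k 𝔥).coord l) * prodMap (hgSec P) (hgSec P)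
        (LieBialgebra.cobracket (k := k) (Module.finBasis k 𝔥 l)) +
    ∑ i, ∑ j, eSec P ((Module.finBasis k 𝔥).coord i) * (eSec P ((Module.finBasis k 𝔥).coord j) *
      hgSec P ⁅Module.finBasis k 𝔥 i, Module.finBasis k 𝔥 j⁆) := by
  have hev := mem_even_of_mem_two (varpiPrime_mem P)
  rw [← sum_eSec_dualBracket_mul]
  refine (congrArg (schouten k (varpiPrime P)) (varpiPrime_eq P)).trans ?_
  rw [map_sum]
  simp only [schouten_even_mul hev, schouten_varpiPrime_eSec, hgSec_apply, involute_eSec,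
    schouten_varpiPrime_gSec, neg_mul_neg, Finset.sum_mul, Finset.mul_sum, Finset.sum_add_distrib]
  rfl

/-- This is the opposite of the double sum in `schouten_varpiPrime_self`. The two cancel in `[Λ,
Λ]`, where these brackets have equal weight. -/
theorem schouten_varpi_varpiPrime : schouten k (varpi P) (varpiPrime P) =
    -∑ i, ∑ j, eSec P ((Module.finBasis k 𝔥).coord i) * (eSec P ((Module.finBasis k 𝔥).coord j) *
      hgSec P ⁅Module.finBasis k 𝔥 i, Module.finBasis k 𝔥 j⁆) := by
  have hev := mem_even_of_mem_two (varpi_mem P)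
  rw [varpiPrime_eq P, map_sum]
  simp only [schouten_even_mul hev, schouten_varpi_eSec, hgSec_apply, schouten_varpi_gSec,
    mul_zero, add_zero, Finset.sum_mul]
  rw [Finset.sum_comm, ← Finset.sum_neg_distrib]
  refine Finset.sum_congr rfl fun i _ => ?_
  have h := sum_lie_coord_mul (eSec P) (hgSec P) (Module.finBasis k 𝔥 i)
  simp only [mul_assoc, ← Finset.mul_sum, ← mul_neg]
  exact congrArg (eSec P ((Module.finBasis k 𝔥).coord i) * ·) h

/-! #### `[ϖ, ·]` has square zero on the double -/

/-- On `𝔥` the identity is the co-Jacobi identity; on `𝔥^*`, in the next lemma, it is the Jacobi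
identity of `𝔥`. -/
theorem schouten_schouten_varpi_hSec (h : 𝔥) :
    schouten k (varpi P) (schouten k (varpi P) (hSec P h)) = 0 := by
  rw [schouten_varpi_hSec, map_neg, apply_prodMap_cobracket_eq_zero (schouten k (varpi P)) (hSec P)
    (hSec_anticomm P) (fun x y => ?_) (schouten_varpi_hSec P), neg_zero]
  rw [schouten_even_mul (mem_even_of_mem_two (varpi_mem P)), involute_hSec, neg_mul, sub_eq_add_neg]

theorem schouten_schouten_varpi_eSec (ξ : Module.Dual k 𝔥) :
    schouten k (varpi P) (schouten k (varpi P) (eSec P ξ)) = 0 := by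
  refine apply_apply_dual_eq_zero (schouten k (varpi P)) (eSec P) (eSec_anticomm P)
    (fun x y => ?_) (schouten_varpi_eSec P) ξ
  rw [schouten_even_mul (mem_even_of_mem_two (varpi_mem P)), involute_eSec, neg_mul, sub_eq_add_neg]

end Brackets

/-! ### The bracket `[Λ, Λ]` and the dynamical Yang-Baxter equation. -/

section Trivectors
variable {k 𝔤 L : Type*} [Field k] [CharZero k] [LieRing 𝔤] [LieAlgebra k 𝔤] [CommRing L]
  [Algebra k L] {𝔥 : LieSubalgebra k 𝔤} [FiniteDimensional k 𝔥] [LieBialgebra k 𝔥]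
  (P : PoissonBaseAlgebra k 𝔥 L)

/-- The map `f ⊗ (a ⊗ b ⊗ c) ↦ f • (a ∧ b ∧ c)` to the exterior algebra of `(𝔤 ⊕ 𝔇𝔥)_L`. -/
noncomputable def toTrivector :
    L ⊗[k] (𝔤 ⊗[k] (𝔤 ⊗[k] 𝔤)) →ₗ[k] ExteriorAlgebra L (P.Algebroid 𝔤) :=
  TensorProduct.lift
    ((Algebra.lsmul k k (ExteriorAlgebra L (P.Algebroid 𝔤))).toLinearMap.compl₂
      (prodMap (gSec P) (prodMap (gSec P) (gSec P))))

theorem toTrivector_tmul (f : L) (a b c : 𝔤) :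
    toTrivector P (f ⊗ₜ (a ⊗ₜ (b ⊗ₜ c))) = f • (gSec P a * (gSec P b * gSec P c)) := rfl

theorem tensor₄_induction {U V W : Type*} [AddCommGroup U] [Module k U] [AddCommGroup V]
    [Module k V] [AddCommGroup W] [Module k W] {p : L ⊗[k] (U ⊗[k] (V ⊗[k] W)) → Prop}
    (t : L ⊗[k] (U ⊗[k] (V ⊗[k] W))) (zero : p 0)
    (tmul : ∀ f u v w, p (f ⊗ₜ (u ⊗ₜ (v ⊗ₜ w)))) (add : ∀ s t, p s → p t → p (s + t)) : p t := by
  induction t using tensor₃_induction with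
  | zero => exact zero
  | add s t hs ht => exact add s t hs ht
  | tmul f u s =>
    induction s with
    | zero => rw [TensorProduct.tmul_zero, TensorProduct.tmul_zero]; exact zero
    | add s t hs ht => rw [TensorProduct.tmul_add, TensorProduct.tmul_add]; exact add _ _ hs ht
    | tmul v w => exact tmul f u v w

theorem lieG_toTrivector (x : 𝔤) (t : L ⊗[k] (𝔤 ⊗[k] (𝔤 ⊗[k] 𝔤))) :
    lieG P x (toTrivector P t) = toTrivector P
      ((LieModule.toEnd k 𝔤 (𝔤 ⊗[k] (𝔤 ⊗[k] 𝔤)) x).lTensor L t) := by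
  induction t using tensor₄_induction with
  | zero => simp
  | tmul f a b c =>
    rw [LinearMap.lTensor_tmul, LieModule.toEnd_apply_apply,
      TensorProduct.LieModule.lie_tmul_right, TensorProduct.LieModule.lie_tmul_right]
    simp only [TensorProduct.tmul_add, map_add, toTrivector_tmul]
    rw [lieG_smul, lieDeriv_mul, lieDeriv_mul, lieG_gSec, lieG_gSec, lieG_gSec]
    simp only [mul_add, smul_add]
  | add s t hs ht => simp only [map_add, hs, ht]

theorem lieD_toTrivector (u : LieDouble k 𝔥) (t : L ⊗[k] (𝔤 ⊗[k] (𝔤 ⊗[k] 𝔤))) :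
    lieD P u (toTrivector P t) = toTrivector P (P.act u _ t) := by
  induction t using tensor₄_induction with
  | zero => simp
  | tmul f a b c =>
    rw [PoissonBaseAlgebra.act, LinearMap.rTensor_tmul, toTrivector_tmul, toTrivector_tmul,
      lieD_smul, lieDeriv_mul, lieDeriv_mul, lieD_gSec, lieD_gSec, lieD_gSec]
    simp only [zero_mul, mul_zero, add_zero, smul_zero]
    rfl
  | add s t hs ht => simp only [map_add, hs, ht]

theorem gSec_cycle (a b c : 𝔤) :
    gSec P a * (gSec P b * gSec P c) = gSec P b * (gSec P c * gSec P a) := by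
  rw [gSec_anticomm P c, mul_neg, ← mul_assoc, gSec_anticomm P a, neg_mul, mul_assoc]

theorem gSec_swap (a b c : 𝔤) :
    gSec P a * (gSec P b * gSec P c) = -(gSec P b * (gSec P a * gSec P c)) := by
  rw [← mul_assoc, gSec_anticomm P a, neg_mul, mul_assoc]

/-- The three terms of `Alt` are rearrangements of one wedge product with the matching signs, hence
the factor `3`. -/
theorem toTrivector_alt (x : 𝔤) (s : L ⊗[k] (𝔤 ⊗[k] 𝔤)) :
    toTrivector P ((Alt k 𝔤 ∘ₗ TensorProduct.mk k 𝔤 (𝔤 ⊗[k] 𝔤) x).lTensor L s) =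
      (3 : k) • (gSec P x * P.toBivector 𝔤 s) := by
  have e : ∀ Q : ExteriorAlgebra L (P.Algebroid 𝔤), (3 : k) • Q = Q + Q + Q := fun Q => by
    rw [show (3 : k) = 1 + 1 + 1 by norm_num, add_smul, add_smul, one_smul]
  induction s using tensor₃_induction with
  | zero => simp
  | tmul f a b =>
    rw [LinearMap.lTensor_tmul, LinearMap.comp_apply, TensorProduct.mk_apply, Alt_tmul,
      TensorProduct.tmul_add, TensorProduct.tmul_sub, map_add, map_sub, toTrivector_tmul,
      toTrivector_tmul, toTrivector_tmul, toBivector_tmul', mul_smul_comm, gSec_swap P a x,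
      ← gSec_cycle P x a b, smul_neg, sub_neg_eq_add, e]
  | add s t hs ht => simp only [map_add, hs, ht, mul_add, smul_add]

theorem toTrivector_dynamicalTerm (r : L ⊗[k] (𝔤 ⊗[k] 𝔤)) :
    toTrivector P (dynamicalTerm P r) = (3 : k) • ∑ i, hgSec P (Module.finBasis k 𝔥 i) *
      P.toBivector 𝔤
        (P.act (LieDouble.ofDual k 𝔥 ((Module.finBasis k 𝔥).coord i)) _ r) := by
  simp only [dynamicalTerm, map_sum, toTrivector_alt, Finset.smul_sum, hgSec_apply]

/-- The product of functions, together with a bilinear map on tensors. -/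
noncomputable abbrev baseMul (F : 𝔤 ⊗[k] 𝔤 →ₗ[k] 𝔤 ⊗[k] 𝔤 →ₗ[k] 𝔤 ⊗[k] (𝔤 ⊗[k] 𝔤)) :
    L ⊗[k] (𝔤 ⊗[k] 𝔤) →ₗ[k] L ⊗[k] (𝔤 ⊗[k] 𝔤) →ₗ[k] L ⊗[k] (𝔤 ⊗[k] (𝔤 ⊗[k] 𝔤)) :=
  TensorProduct.map₂ (LinearMap.mul k L) F

variable (k 𝔤 L) in
/-- The flip of the two factors `𝔤`. -/
noncomputable abbrev flip : L ⊗[k] (𝔤 ⊗[k] 𝔤) →ₗ[k] L ⊗[k] (𝔤 ⊗[k] 𝔤) :=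
  (TensorProduct.comm k 𝔤 𝔤).toLinearMap.lTensor L

theorem tensor₃_induction₂ {p : L ⊗[k] (𝔤 ⊗[k] 𝔤) → L ⊗[k] (𝔤 ⊗[k] 𝔤) → Prop}
    (r s : L ⊗[k] (𝔤 ⊗[k] 𝔤)) (zero_left : ∀ s, p 0 s) (zero_right : ∀ r, p r 0)
    (tmul : ∀ f a b g c d, p (f ⊗ₜ (a ⊗ₜ b)) (g ⊗ₜ (c ⊗ₜ d)))
    (add_left : ∀ r r' s, p r s → p r' s → p (r + r') s)
    (add_right : ∀ r s s', p r s → p r s' → p r (s + s')) : p r s := by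
  induction r using tensor₃_induction with
  | zero => exact zero_left s
  | add r r' h h' => exact add_left r r' s h h'
  | tmul f a b =>
    induction s using tensor₃_induction with
    | zero => exact zero_right _
    | add s s' h h' => exact add_right _ s s' h h'
    | tmul g c d => exact tmul f a b g c d

/-- In the exterior algebra every term of `CYB` is expressed by `bracket₁₂₁₃`, at the price of
flipping arguments. For a skew `r` a flip is only a sign. -/
theorem toTrivector_bracket₁₂₂₃ (r s : L ⊗[k] (𝔤 ⊗[k] 𝔤)) :
    toTrivector P (baseMul (bracket₁₂₂₃ k 𝔤) r s) =
      -toTrivector P (baseMul (bracket₁₂₁₃ k 𝔤) (flip k 𝔤 L r) s) := by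
  induction r, s using tensor₃_induction₂ with
  | zero_left s => simp
  | zero_right r => simp
  | tmul f a b g c d =>
    change toTrivector P ((f * g) ⊗ₜ (a ⊗ₜ (⁅b, c⁆ ⊗ₜ d))) =
      -toTrivector P ((f * g) ⊗ₜ (⁅b, c⁆ ⊗ₜ (a ⊗ₜ d)))
    rw [toTrivector_tmul, toTrivector_tmul, gSec_swap, smul_neg]
  | add_left r r' s h h' => simp only [map_add, LinearMap.add_apply, h, h', neg_add]
  | add_right r s s' h h' => simp only [map_add, h, h', neg_add]

theorem toTrivector_bracket₁₃₂₃ (r s : L ⊗[k] (𝔤 ⊗[k] 𝔤)) :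
    toTrivector P (baseMul (bracket₁₃₂₃ k 𝔤) r s) =
      toTrivector P (baseMul (bracket₁₂₁₃ k 𝔤) (flip k 𝔤 L r) (flip k 𝔤 L s)) := by
  induction r, s using tensor₃_induction₂ with
  | zero_left s => simp
  | zero_right r => simp
  | tmul f a b g c d =>
    change toTrivector P ((f * g) ⊗ₜ (a ⊗ₜ (c ⊗ₜ ⁅b, d⁆))) =
      toTrivector P ((f * g) ⊗ₜ (⁅b, d⁆ ⊗ₜ (a ⊗ₜ c)))
    rw [toTrivector_tmul, toTrivector_tmul, gSec_cycle P ⁅b, d⁆]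
  | add_left r r' s h h' => simp only [map_add, LinearMap.add_apply, h, h']
  | add_right r s s' h h' => simp only [map_add, h, h']

theorem zero_mul_add_smul_smul {R A : Type*} [CommRing R] [Ring A] [Algebra R A] (f g : R)
    (Q a b c d : A) : 0 * Q + g • (f • (a - b - c + d)) =
      (f * g) • a - (f * g) • b - (f * g) • c + (f * g) • d := by
  rw [zero_mul, zero_add, smul_smul, mul_comm g, smul_add, smul_sub, smul_sub]

theorem smul_mul_add_mul_smul {R A : Type*} [CommRing R] [Ring A] [Algebra R A] (f : R)
    (a b c d : A) : f • a * b + c * f • d = f • (a * b + c * d) := by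
  rw [smul_mul_assoc, mul_smul_comm, smul_add]

/-- The bracket of `a ∧ b` with `c ∧ d`, normalised so that the Lie bracket is the first factor of
each term; this matches the shape of `bracket₁₂₁₃`. -/
theorem cross_terms {A : Type*} [Ring A] [Algebra k A] (Φ : 𝔤 →ₗ[k] A)
    (hΦ : ∀ x y, Φ x * Φ y = -(Φ y * Φ x)) (a b c d : 𝔤) :
    -(Φ ⁅c, a⁆ * Φ b + Φ a * Φ ⁅c, b⁆) * Φ d + -Φ c * -(Φ ⁅d, a⁆ * Φ b + Φ a * Φ ⁅d, b⁆) =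
      Φ ⁅a, c⁆ * (Φ b * Φ d) - Φ ⁅b, c⁆ * (Φ a * Φ d) - Φ ⁅a, d⁆ * (Φ b * Φ c) +
        Φ ⁅b, d⁆ * (Φ a * Φ c) := by
  have h1 (x y z : 𝔤) : Φ x * (Φ y * Φ z) = -(Φ y * (Φ x * Φ z)) := by
    rw [← mul_assoc, hΦ x, neg_mul, mul_assoc]
  have h2 : Φ c * (Φ ⁅d, a⁆ * Φ b) = Φ ⁅d, a⁆ * (Φ b * Φ c) := by
    rw [h1, hΦ c b, mul_neg, neg_neg]
  have h3 : Φ c * (Φ a * Φ ⁅d, b⁆) = -(Φ ⁅d, b⁆ * (Φ a * Φ c)) := by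
    rw [h1 ⁅d, b⁆, hΦ ⁅d, b⁆, mul_neg, neg_neg, h1]
  rw [neg_mul_neg, mul_add, neg_mul, add_mul, mul_assoc, mul_assoc, h1 a, h2, h3, ← lie_skew a c,
    ← lie_skew b c, ← lie_skew a d, ← lie_skew b d]
  simp only [map_neg, neg_mul]
  abel

theorem schouten_toBivector_gSec (r : L ⊗[k] (𝔤 ⊗[k] 𝔤)) (x : 𝔤) :
    schouten k (P.toBivector 𝔤 r) (gSec P x) = -lieG P x (P.toBivector 𝔤 r) := by
  rw [gSec_eq, schouten_even_ι (mem_even_of_mem_two (toBivector_mem P r))]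

theorem schouten_toBivector_toBivector (r s : L ⊗[k] (𝔤 ⊗[k] 𝔤)) :
    schouten k (P.toBivector 𝔤 r) (P.toBivector 𝔤 s) =
      toTrivector P (baseMul (bracket₁₂₁₃ k 𝔤) r s) -
      toTrivector P (baseMul (bracket₁₂₁₃ k 𝔤) (flip k 𝔤 L r) s) -
      toTrivector P (baseMul (bracket₁₂₁₃ k 𝔤) r (flip k 𝔤 L s)) +
      toTrivector P (baseMul (bracket₁₂₁₃ k 𝔤) (flip k 𝔤 L r) (flip k 𝔤 L s)) := by
  induction r, s using tensor₃_induction₂ with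
  | zero_left s =>
    -- Linearity of `schouten` in its left argument is available only as additivity on bivectors,
    -- which forces the value at zero.
    have e (Q) : schouten k (0 : ExteriorAlgebra L (P.Algebroid 𝔤)) Q = 0 := by
      have h := schouten_add_left (k := k) (zero_mem (⋀[L]^2 (P.Algebroid 𝔤))) (zero_mem _) Q
      rw [add_zero] at h
      exact left_eq_add.1 h
    simp [e]
  | zero_right r => simp
  | tmul f a b g c d =>
    have hm := toBivector_mem P (f ⊗ₜ[k] (a ⊗ₜ[k] b))
    have hx (x : 𝔤) : schouten k (P.toBivector 𝔤 (f ⊗ₜ[k] (a ⊗ₜ[k] b))) (gSec P x) =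
        f • -(gSec P ⁅x, a⁆ * gSec P b + gSec P a * gSec P ⁅x, b⁆) := by
      rw [schouten_toBivector_gSec, toBivector_tmul', lieG_smul, lieDeriv_mul, lieG_gSec,
        lieG_gSec, smul_neg]
    change _ = (f * g) • (gSec P ⁅a, c⁆ * (gSec P b * gSec P d)) -
      (f * g) • (gSec P ⁅b, c⁆ * (gSec P a * gSec P d)) -
      (f * g) • (gSec P ⁅a, d⁆ * (gSec P b * gSec P c)) +
      (f * g) • (gSec P ⁅b, d⁆ * (gSec P a * gSec P c))
    have h1 : schouten k (P.toBivector 𝔤 (f ⊗ₜ[k] (a ⊗ₜ[k] b))) (gSec P c * gSec P d) =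
        f • (gSec P ⁅a, c⁆ * (gSec P b * gSec P d) - gSec P ⁅b, c⁆ * (gSec P a * gSec P d) -
          gSec P ⁅a, d⁆ * (gSec P b * gSec P c) + gSec P ⁅b, d⁆ * (gSec P a * gSec P c)) := by
      rw [schouten_even_mul (mem_even_of_mem_two hm), involute_gSec, hx, hx,
        ← cross_terms (gSec P) (gSec_anticomm P) a b c d]
      exact smul_mul_add_mul_smul f _ _ _ _
    have h2 : schouten k (P.toBivector 𝔤 (f ⊗ₜ[k] (a ⊗ₜ[k] b))) (algebraMap L _ g) = 0 := by
      rw [schouten_even_algebraMap (mem_even_of_mem_two hm), contract_toBivector, neg_zero]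
    refine (congrArg (schouten k _) (toBivector_tmul' P g c d)).trans
      ((schouten_even_smul hm g _).trans ?_)
    refine (congrArg₂ (fun X Y => X * (gSec P c * gSec P d) + g • Y) h2 h1).trans ?_
    exact zero_mul_add_smul_smul f g _ _ _ _ _
  | add_left r r' s h h' =>
    rw [map_add, schouten_add_left (toBivector_mem P r) (toBivector_mem P r'), h, h']
    simp only [map_add, LinearMap.add_apply]
    abel
  | add_right r s s' h h' => simp only [map_add, h, h']; abel

theorem baseMul_add₃ (F G H : 𝔤 ⊗[k] 𝔤 →ₗ[k] 𝔤 ⊗[k] 𝔤 →ₗ[k] 𝔤 ⊗[k] (𝔤 ⊗[k] 𝔤))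
    (r s : L ⊗[k] (𝔤 ⊗[k] 𝔤)) :
    baseMul (F + G + H) r s = baseMul F r s + baseMul G r s + baseMul H r s := by
  induction r, s using tensor₃_induction₂ with
  | zero_left s => simp
  | zero_right r => simp
  | tmul f a b g c d =>
    change (f * g) ⊗ₜ (F (a ⊗ₜ b) (c ⊗ₜ d) + G (a ⊗ₜ b) (c ⊗ₜ d) + H (a ⊗ₜ b) (c ⊗ₜ d)) = _
    rw [TensorProduct.tmul_add, TensorProduct.tmul_add]
    rfl
  | add_left r r' s h h' => rw [map_add, LinearMap.add_apply, h, h']; simp only [map_add, LinearMap.add_apply]; abel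
  | add_right r s s' h h' => rw [map_add, h, h']; simp only [map_add]; abel

variable {P} in
theorem toTrivector_CYB {r : L ⊗[k] (𝔤 ⊗[k] 𝔤)} (hr : IsBivector r) :
    toTrivector P (CYB r) = (3 : k) • toTrivector P (baseMul (bracket₁₂₁₃ k 𝔤) r r) := by
  have e : CYB r = baseMul (bracket₁₂₁₃ k 𝔤) r r + baseMul (bracket₁₃₂₃ k 𝔤) r r +
      baseMul (bracket₁₂₂₃ k 𝔤) r r := by
    exact baseMul_add₃ _ _ _ _ _
  have hr' : flip k 𝔤 L r = -r := hr
  rw [e, map_add, map_add, toTrivector_bracket₁₂₂₃, toTrivector_bracket₁₃₂₃, hr']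
  simp only [map_neg, LinearMap.neg_apply, neg_neg]
  rw [show (3 : k) = 1 + 1 + 1 by norm_num, add_smul, add_smul, one_smul]

/-- For a skew `r` the four terms of the bracket coincide, and so do the three terms of `CYB`; hence
the constant `4 / 3`. -/
theorem schouten_toBivector_self {r : L ⊗[k] (𝔤 ⊗[k] 𝔤)} (hr : IsBivector r) :
    schouten k (P.toBivector 𝔤 r) (P.toBivector 𝔤 r) =
      (4 / 3 : k) • toTrivector P (CYB r) := by
  have hr' : flip k 𝔤 L r = -r := hr
  rw [toTrivector_CYB hr, schouten_toBivector_toBivector, hr', smul_smul,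
    show (4 / 3 * 3 : k) = 1 + 1 + 1 + 1 by norm_num]
  simp only [map_neg, LinearMap.neg_apply, neg_neg, add_smul, one_smul]
  abel

theorem schouten_self_expand {k L B : Type*} [CommRing k] [CommRing L] [Algebra k L] [LieRing B]
    [LieAlgebra k B] [Module L B] [LieRingModule B L] [LieRinehartRing L B]
    [LieRinehartAlgebra k L B] {R V W : ExteriorAlgebra L B} (hR : R ∈ ⋀[L]^2 B)
    (hV : V ∈ ⋀[L]^2 B) (hW : W ∈ ⋀[L]^2 B) :
    schouten k (R + (V + (W + W))) (R + (V + (W + W))) = schouten k R R + schouten k V V +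
      (2 : k) • (schouten k V R + (2 : k) • schouten k W R + (2 : k) • schouten k V W +
        (2 : k) • schouten k W W) := by
  have h0 := add_mem hW hW
  simp only [schouten_add_left hR (add_mem hV h0), schouten_add_left hV h0,
    schouten_add_left hW hW, map_add, schouten_comm hR hV, schouten_comm hR hW,
    schouten_comm hW hV, two_smul]
  generalize schouten k R R = a, schouten k V V = b, schouten k W W = c, schouten k V R = d,
    schouten k W R = e, schouten k V W = f
  abel

theorem four_thirds_smul {M : Type*} [AddCommGroup M] [Module k M] (a c d : M) :
    (4 / 3 : k) • c + a + (2 : k) • -((2 / 3 : k) • d) = a - (4 / 3 : k) • (d - c) := by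
  rw [smul_neg, smul_smul, show (2 * (2 / 3) : k) = 4 / 3 by norm_num, smul_sub]
  abel

/-- For an equivariant `r`, the bracket `[Λ, Λ]` is `[ϖ, ϖ]` up to a multiple of the left hand side
of the dynamical Yang-Baxter equation. -/
theorem schouten_bivector_self {r : L ⊗[k] (𝔤 ⊗[k] 𝔤)} (hr : IsBivector r)
    (heq : ∀ h, equivarianceDefect P r h = 0) :
    schouten k (bivector P r) (bivector P r) = schouten k (varpi P) (varpi P) -
      (4 / 3 : k) • toTrivector P (dynamicalTerm P r - CYB r) := by
  -- Equivariance, seen in the exterior algebra.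
  have h1 (i) : P.toBivector 𝔤 (P.act (LieDouble.ofLie k 𝔥 (Module.finBasis k 𝔥 i)) _ r) +
      P.toBivector 𝔤 ((LieModule.toEnd k 𝔤 (𝔤 ⊗[k] 𝔤) (Module.finBasis k 𝔥 i : 𝔤)).lTensor L r) =
      prodMap (hgSec P) (hgSec P) (LieBialgebra.cobracket (k := k) (Module.finBasis k 𝔥 i)) := by
    rw [← toBivector_one_tmul, ← map_add, ← sub_eq_zero, ← map_sub]
    exact (congrArg _ (heq _)).trans (map_zero _)
  -- The relation from `J₀` turns `[ϖ, r]` into the terms `η^i ∧ (h_i ▹ r)`. With the adjoint terms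
  -- of `[ϖ', r]` they add up to `η^i ∧ ν(h_i)`, which cancels against `[ϖ', ϖ']`. Only the terms
  -- `h_i ∧ (η^i ▹ r)` are left.
  have h2 : schouten k (varpi P) (P.toBivector 𝔤 r) +
      (2 : k) • schouten k (varpiPrime P) (P.toBivector 𝔤 r) +
      (2 : k) • schouten k (varpi P) (varpiPrime P) +
      (2 : k) • schouten k (varpiPrime P) (varpiPrime P) =
      -((2 / 3 : k) • toTrivector P (dynamicalTerm P r)) := by
    rw [schouten_varpi_toBivector, schouten_varpiPrime_toBivector, sum_hSec_mul_act,
      schouten_varpi_varpiPrime, schouten_varpiPrime_self, toTrivector_dynamicalTerm, smul_smul,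
      show (2 / 3 * 3 : k) = 2 by norm_num]
    simp only [← h1, mul_add, Finset.sum_add_distrib, smul_add, smul_neg, neg_smul, neg_add]
    abel
  have e : bivector P r = P.toBivector 𝔤 r + (varpi P + (varpiPrime P + varpiPrime P)) := by
    rw [bivector, bivector₀, two_smul]
  have h3 := schouten_self_expand (k := k) (toBivector_mem P r) (varpi_mem P) (varpiPrime_mem P)
  rw [← e] at h3
  rw [h3, h2, schouten_toBivector_self P hr, map_sub (toTrivector P)]
  exact four_thirds_smul _ _ _

/-- `[ϖ, ϖ]` itself need not be computed: here and for `𝔇𝔥` below, its Lie derivative along `ξ` is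
`-2 [ϖ, [ϖ, ξ]]`, which vanishes for constant `ξ`. -/
theorem lieG_schouten_varpi (x : 𝔤) : lieG P x (schouten k (varpi P) (varpi P)) = 0 := by
  rw [lieG, lieDeriv_schouten_self (varpi_mem P), ← gSec_eq, schouten_varpi_gSec, map_zero,
    smul_zero]

theorem lieD_schouten_varpi (u : LieDouble k 𝔥) :
    lieD P u (schouten k (varpi P) (varpi P)) = 0 := by
  rw [lieD, lieDeriv_schouten_self (varpi_mem P), ← sec_eq, sec_double_eq, map_add, map_add,
    schouten_schouten_varpi_hSec, schouten_schouten_varpi_eSec, add_zero, smul_zero]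

/-- The constant `2 / 3` for `d²ξ` arises from `-2 d²ξ = L_ξ [Λ, Λ]` and the coefficient `-4 / 3` in
`[Λ, Λ]`. -/
theorem eq_of_neg_two_smul {M : Type*} [AddCommGroup M] [Module k M] {X Y : M}
    (h : -((4 / 3 : k) • Y) = -(2 : k) • X) : X = (2 / 3 : k) • Y := by
  have h' := congrArg ((-(1 / 2) : k) • ·) h
  simp only [smul_neg, neg_smul, smul_smul, neg_neg] at h'
  norm_num at h'
  exact h'.symm

/-- The square of `[Λ, ·]` on constant sections of `𝔤`. -/
theorem schouten_schouten_gSec {r : L ⊗[k] (𝔤 ⊗[k] 𝔤)} (hr : IsBivector r)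
    (heq : ∀ h, equivarianceDefect P r h = 0) (x : 𝔤) :
    schouten k (bivector P r) (schouten k (bivector P r) (P.sec 𝔤 (x, 0))) =
      (2 / 3 : k) • toTrivector P ((LieModule.toEnd k 𝔤 (𝔤 ⊗[k] (𝔤 ⊗[k] 𝔤)) x).lTensor L
        (dynamicalTerm P r - CYB r)) := by
  refine eq_of_neg_two_smul ?_
  rw [sec_eq, ← lieDeriv_schouten_self (bivector_mem P r), schouten_bivector_self P hr heq,
    ← lieG_toTrivector]
  change _ = lieG P x _
  rw [map_sub (lieG P x), map_smul (lieG P x), lieG_schouten_varpi, zero_sub]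

/-- The square of `[Λ, ·]` on constant sections of `𝔇𝔥`. -/
theorem schouten_schouten_double {r : L ⊗[k] (𝔤 ⊗[k] 𝔤)} (hr : IsBivector r)
    (heq : ∀ h, equivarianceDefect P r h = 0) (u : LieDouble k 𝔥) :
    schouten k (bivector P r) (schouten k (bivector P r) (P.sec 𝔤 (0, u))) =
      (2 / 3 : k) • toTrivector P (P.act u _ (dynamicalTerm P r - CYB r)) := by
  refine eq_of_neg_two_smul ?_
  rw [sec_eq, ← lieDeriv_schouten_self (bivector_mem P r), schouten_bivector_self P hr heq,
    ← lieD_toTrivector]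
  change _ = lieD P u _
  rw [map_sub (lieD P u), map_smul (lieD P u), lieD_schouten_varpi, zero_sub]

end Trivectors

/-! ### Separating elements of `L ⊗ V` by functionals on `V`. -/

section Separation
variable {k L : Type*} [Field k] [CharZero k] [CommRing L] [Algebra k L] {V W : Type*} [AddCommGroup V]
  [Module k V] [AddCommGroup W] [Module k W]

variable (L) in
/-- The map `f ⊗ v ↦ lam v • f`. -/
noncomputable def evalRight (lam : Module.Dual k V) : L ⊗[k] V →ₗ[k] L :=
  (TensorProduct.rid k L).toLinearMap ∘ₗ lam.lTensor L

theorem evalRight_tmul (lam : Module.Dual k V) (f : L) (v : V) :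
    evalRight L lam (f ⊗ₜ v) = lam v • f := by
  simp [evalRight]

theorem evalRight_smul (lam : Module.Dual k V) (f : L) (t : L ⊗[k] V) :
    evalRight L lam (f • t) = f * evalRight L lam t := by
  induction t with
  | zero => simp
  | tmul g v => simp only [TensorProduct.smul_tmul', evalRight_tmul, smul_eq_mul, mul_smul_comm]
  | add s t hs ht => simp only [smul_add, map_add, hs, ht, mul_add]

/-- A basis of `V` over the field `k` makes `L ⊗ V` free over `L`, with these evaluations as
coordinates. -/
theorem eq_zero_of_evalRight_coord {ι : Type*} (b : Module.Basis ι k V) {t : L ⊗[k] V}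
    (h : ∀ i, evalRight L (b.coord i) t = 0) : t = 0 := by
  classical
  have e : ∀ t : L ⊗[k] V, ∀ i, TensorProduct.equivFinsuppOfBasisRight b t i =
      evalRight L (b.coord i) t := fun t i => by
    induction t with
    | zero => simp
    | tmul f v =>
      rw [TensorProduct.equivFinsuppOfBasisRight_apply_tmul_apply, evalRight_tmul]
      rfl
    | add s t hs ht => simp only [map_add, Finsupp.add_apply, hs, ht]
  rw [← (TensorProduct.equivFinsuppOfBasisRight b).map_eq_zero_iff]
  ext i
  rw [e, h, Finsupp.zero_apply]

theorem eq_zero_of_evalRight {t : L ⊗[k] V} (h : ∀ lam, evalRight L lam t = 0) : t = 0 :=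
  eq_zero_of_evalRight_coord (Module.Basis.ofVectorSpace k V) fun _ => h _

/-- The functional `lam ⊗ mu`. -/
noncomputable def tensorDual (lam : Module.Dual k V) (mu : Module.Dual k W) :
    Module.Dual k (V ⊗[k] W) := LinearMap.mul' k k ∘ₗ TensorProduct.map lam mu

/-- The coordinates of a tensor product basis are product functionals. -/
theorem eq_zero_of_evalRight_tensorDual {t : L ⊗[k] (V ⊗[k] W)}
    (h : ∀ lam mu, evalRight L (tensorDual lam mu) t = 0) : t = 0 := by
  refine eq_zero_of_evalRight_coord ((Module.Basis.ofVectorSpace k V).tensorProduct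
    (Module.Basis.ofVectorSpace k W)) fun i => ?_
  rw [← h ((Module.Basis.ofVectorSpace k V).coord i.1) ((Module.Basis.ofVectorSpace k W).coord i.2)]
  congr 2
  ext v w
  exact (Module.Basis.tensorProduct_repr_tmul_apply _ _ v w i.1 i.2).trans (mul_comm _ _)

variable (L) in
/-- The map `f ⊗ (v ⊗ w) ↦ lam v • (f ⊗ w)`. -/
noncomputable def evalMiddle (lam : Module.Dual k V) : L ⊗[k] (V ⊗[k] W) →ₗ[k] L ⊗[k] W :=
  ((TensorProduct.lid k W).toLinearMap ∘ₗ lam.rTensor W).lTensor L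

theorem evalMiddle_tmul (lam : Module.Dual k V) (f : L) (v : V) (w : W) :
    evalMiddle L lam (f ⊗ₜ (v ⊗ₜ w)) = lam v • (f ⊗ₜ w) := by
  simp [evalMiddle]

theorem evalRight_evalMiddle (lam : Module.Dual k V) (mu : Module.Dual k W)
    (t : L ⊗[k] (V ⊗[k] W)) :
    evalRight L mu (evalMiddle L lam t) = evalRight L (tensorDual lam mu) t := by
  induction t using tensor₃_induction with
  | zero => simp
  | tmul f v w =>
    rw [evalMiddle_tmul, map_smul, evalRight_tmul, evalRight_tmul, smul_smul]
    rfl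
  | add s t hs ht => simp only [map_add, hs, ht]

theorem eq_zero_of_evalMiddle {t : L ⊗[k] (V ⊗[k] W)} (h : ∀ lam, evalMiddle L lam t = 0) :
    t = 0 :=
  eq_zero_of_evalRight_tensorDual fun lam mu => by rw [← evalRight_evalMiddle, h, map_zero]

end Separation

/-! ### Skew tensors over `𝔤` embed in the exterior algebra of the algebroid. -/

section Injectivity
variable {k 𝔤 L : Type*} [Field k] [CharZero k] [LieRing 𝔤] [LieAlgebra k 𝔤] [CommRing L]
  [Algebra k L] {𝔥 : LieSubalgebra k 𝔤} [FiniteDimensional k 𝔥] [LieBialgebra k 𝔥]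
  (P : PoissonBaseAlgebra k 𝔥 L)

/-- `J₀` is generated by sections with values in `𝔇𝔥`. A functional on `𝔤`, extended by zero to
`𝔇𝔥`, therefore descends to the quotient. -/
theorem exists_dual (lam : Module.Dual k 𝔤) : ∃ α : Module.Dual L (P.Algebroid 𝔤),
    ∀ x, α (constSec P (x, 0)) = algebraMap k L (lam x) := by
  let g : L ⊗[k] (𝔤 × LieDouble k 𝔥) →ₗ[L] L := LinearMap.liftBaseChange L
    (Algebra.linearMap k L ∘ₗ lam ∘ₗ LinearMap.fst k 𝔤 (LieDouble k 𝔥))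
  have hg (f : L) (t : LieDouble k 𝔥 ⊗[k] LieDouble k 𝔥) : g (P.section₀ 𝔤 f t) = 0 := by
    induction t with
    | zero => rw [map_zero]; exact map_zero g
    | tmul u v =>
      change g ((P.action u f) ⊗ₜ[k] ((0 : 𝔤), v)) = 0
      simp [g]
    | add s t hs ht => rw [map_add]; exact (map_add g _ _).trans (by rw [hs, ht, add_zero])
  refine ⟨(P.J₀ 𝔤).toSubmodule.liftQ g (Submodule.span_le.2 ?_), fun x => ?_⟩
  · rintro _ ⟨f, rfl⟩
    exact hg f _
  · change g ((1 : L) ⊗ₜ[k] (x, 0)) = _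
    simp [g]

variable {P} {lam mu : Module.Dual k 𝔤} {α β : Module.Dual L (P.Algebroid 𝔤)}

theorem contractLeft_gSec (hα : ∀ x, α (constSec P (x, 0)) = algebraMap k L (lam x)) (x : 𝔤) :
    CliffordAlgebra.contractLeft α (gSec P x) = algebraMap L _ (algebraMap k L (lam x)) := by
  rw [gSec_eq, contractLeft_ι', hα]

theorem contractLeft_gSec_mul (hα : ∀ x, α (constSec P (x, 0)) = algebraMap k L (lam x)) (x : 𝔤)
    (Q : ExteriorAlgebra L (P.Algebroid 𝔤)) : CliffordAlgebra.contractLeft α (gSec P x * Q) =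
      lam x • Q - gSec P x * CliffordAlgebra.contractLeft α Q := by
  rw [gSec_eq, contractLeft_ι_mul', hα, algebraMap_smul]

variable (P) in
/-- The map `f ⊗ a ↦ f • a` to the exterior algebra of `(𝔤 ⊕ 𝔇𝔥)_L`. -/
noncomputable def toVector : L ⊗[k] 𝔤 →ₗ[k] ExteriorAlgebra L (P.Algebroid 𝔤) :=
  TensorProduct.lift
    ((Algebra.lsmul k k (ExteriorAlgebra L (P.Algebroid 𝔤))).toLinearMap.compl₂ (gSec P))

theorem toVector_tmul (f : L) (a : 𝔤) : toVector P (f ⊗ₜ a) = f • gSec P a := rfl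

theorem contractLeft_toVector (hα : ∀ x, α (constSec P (x, 0)) = algebraMap k L (lam x))
    (t : L ⊗[k] 𝔤) : CliffordAlgebra.contractLeft α (toVector P t) =
      algebraMap L _ (evalRight L lam t) := by
  induction t with
  | zero => simp
  | tmul f a =>
    rw [toVector_tmul, map_smul, contractLeft_gSec hα, evalRight_tmul, Algebra.smul_def,
      Algebra.smul_def, ← map_mul, mul_comm]
  | add s t hs ht => simp only [map_add, hs, ht]

/-- The wedge product sees only the antisymmetrisation of `r`, so the contraction is a slice of `r -
flip r`. -/
theorem contractLeft_toBivector (hα : ∀ x, α (constSec P (x, 0)) = algebraMap k L (lam x))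
    (r : L ⊗[k] (𝔤 ⊗[k] 𝔤)) : CliffordAlgebra.contractLeft α (P.toBivector 𝔤 r) =
      toVector P (evalMiddle L lam (r - flip k 𝔤 L r)) := by
  induction r using tensor₃_induction with
  | zero => simp
  | tmul f a b =>
    rw [map_sub (evalMiddle L lam), map_sub (toVector P)]
    change _ = toVector P (evalMiddle L lam (f ⊗ₜ (a ⊗ₜ b))) -
      toVector P (evalMiddle L lam (f ⊗ₜ (b ⊗ₜ a)))
    rw [toBivector_tmul', map_smul, contractLeft_gSec_mul hα, contractLeft_gSec hα,
      ← Algebra.commutes, ← Algebra.smul_def, algebraMap_smul, evalMiddle_tmul, evalMiddle_tmul,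
      map_smul, map_smul, toVector_tmul, toVector_tmul, smul_sub, smul_comm f, smul_comm f]
  | add s t hs ht =>
    rw [map_add (P.toBivector 𝔤), map_add, hs, ht, ← map_add, ← map_add, map_add (flip k 𝔤 L),
      add_sub_add_comm]

theorem contractLeft_gSec_mul_mul (hα : ∀ x, α (constSec P (x, 0)) = algebraMap k L (lam x))
    (a b c : 𝔤) : CliffordAlgebra.contractLeft α (gSec P a * (gSec P b * gSec P c)) =
      lam a • (gSec P b * gSec P c) - lam b • (gSec P a * gSec P c) +
        lam c • (gSec P a * gSec P b) := by
  rw [contractLeft_gSec_mul hα, contractLeft_gSec_mul hα, contractLeft_gSec hα, ← Algebra.commutes,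
    ← Algebra.smul_def, algebraMap_smul, mul_sub, mul_smul_comm, mul_smul_comm]
  abel

theorem smul_sub_add {R M : Type*} [Ring R] [AddCommGroup M] [Module R M] (f : R) (x y z : M) :
    f • (x - y + z) = f • x - f • y + f • z := by
  rw [smul_add, smul_sub]

/-- The transpositions bring each leg in turn to the front, with the sign of the contraction. -/
theorem contractLeft_toTrivector (hα : ∀ x, α (constSec P (x, 0)) = algebraMap k L (lam x))
    (t : L ⊗[k] (𝔤 ⊗[k] (𝔤 ⊗[k] 𝔤))) : CliffordAlgebra.contractLeft α (toTrivector P t) =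
      P.toBivector 𝔤 (evalMiddle L lam (t - (TensorProduct.leftComm k 𝔤 𝔤 𝔤).toLinearMap.lTensor L t +
        (TensorProduct.leftComm k 𝔤 𝔤 𝔤).toLinearMap.lTensor L
          (((TensorProduct.comm k 𝔤 𝔤).toLinearMap.lTensor 𝔤).lTensor L t))) := by
  induction t using tensor₄_induction with
  | zero => simp
  | tmul f a b c =>
    rw [map_add (evalMiddle L lam), map_add (P.toBivector 𝔤), map_sub (evalMiddle L lam),
      map_sub (P.toBivector 𝔤)]
    change _ = P.toBivector 𝔤 (evalMiddle L lam (f ⊗ₜ (a ⊗ₜ (b ⊗ₜ c)))) -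
      P.toBivector 𝔤 (evalMiddle L lam (f ⊗ₜ (b ⊗ₜ (a ⊗ₜ c)))) +
      P.toBivector 𝔤 (evalMiddle L lam (f ⊗ₜ (c ⊗ₜ (a ⊗ₜ b))))
    have e (x y z : 𝔤) : P.toBivector 𝔤 (evalMiddle L lam (f ⊗ₜ (x ⊗ₜ (y ⊗ₜ z)))) =
        f • (lam x • (gSec P y * gSec P z)) := by
      rw [evalMiddle_tmul, map_smul, toBivector_tmul', smul_comm]
    refine (congrArg (CliffordAlgebra.contractLeft α) (toTrivector_tmul P f a b c)).trans
      ((map_smul (CliffordAlgebra.contractLeft α) f _).trans ?_)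
    refine (congrArg (f • ·) (contractLeft_gSec_mul_mul hα a b c)).trans ?_
    refine Eq.trans ?_ (congrArg₂ (· + ·) (congrArg₂ (· - ·) (e a b c) (e b a c)) (e c a b)).symm
    exact smul_sub_add f _ _ _
  | add s t hs ht =>
    rw [map_add (toTrivector P), map_add, hs, ht]
    simp only [map_add, map_sub]
    abel

theorem eq_zero_of_add_self {M : Type*} [AddCommGroup M] [Module k M] {x : M} (h : x + x = 0) :
    x = 0 := by
  rw [← two_smul k] at h
  exact (smul_eq_zero_iff_right two_ne_zero).1 h

theorem eq_zero_of_add_self_add_self {M : Type*} [AddCommGroup M] [Module k M] {x : M}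
    (h : x + x + x = 0) : x = 0 := by
  rw [← one_smul k x, ← add_smul, ← add_smul] at h
  exact (smul_eq_zero_iff_right (by norm_num)).1 h

/-- Contracting with two functionals gives twice a coordinate of the skew tensor `r`, and `2` is
invertible. -/
theorem toBivector_injOn {r : L ⊗[k] (𝔤 ⊗[k] 𝔤)} (hr : IsBivector r)
    (h : P.toBivector 𝔤 r = 0) : r = 0 := by
  refine eq_zero_of_evalMiddle fun lam => eq_zero_of_evalRight fun mu => ?_
  obtain ⟨α, hα⟩ := exists_dual P lam
  obtain ⟨β, hβ⟩ := exists_dual P mu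
  have hr' : flip k 𝔤 L r = -r := hr
  have h1 := contractLeft_toBivector hα r
  rw [h, map_zero, hr', sub_neg_eq_add] at h1
  have h2 := contractLeft_toVector hβ (evalMiddle L lam (r + r))
  rw [← h1, map_zero, ← map_zero (algebraMap L (ExteriorAlgebra L (P.Algebroid 𝔤)))] at h2
  have h3 := algebraMap_injective' h2
  rw [map_add, map_add] at h3
  exact eq_zero_of_add_self (k := k) h3.symm

theorem isBivector_evalMiddle {t : L ⊗[k] (𝔤 ⊗[k] (𝔤 ⊗[k] 𝔤))} (ht : IsTrivector t)
    (lam : Module.Dual k 𝔤) : IsBivector (evalMiddle L lam t) := by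
  have e (t : L ⊗[k] (𝔤 ⊗[k] (𝔤 ⊗[k] 𝔤))) : flip k 𝔤 L (evalMiddle L lam t) = evalMiddle L lam
      (((TensorProduct.comm k 𝔤 𝔤).toLinearMap.lTensor 𝔤).lTensor L t) := by
    induction t using tensor₄_induction with
    | zero => simp
    | tmul f a b c =>
      rw [evalMiddle_tmul, map_smul]
      change _ = evalMiddle L lam (f ⊗ₜ (a ⊗ₜ (c ⊗ₜ b)))
      rw [evalMiddle_tmul]
      rfl
    | add s t hs ht => simp only [map_add, hs, ht]
  exact (e t).trans (by rw [ht.2, map_neg])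

/-- One contraction gives three times a slice of `t`. The slice is a skew bivector, so
`toBivector_injOn` applies. -/
theorem toTrivector_injOn {t : L ⊗[k] (𝔤 ⊗[k] (𝔤 ⊗[k] 𝔤))} (ht : IsTrivector t)
    (h : toTrivector P t = 0) : t = 0 := by
  refine eq_zero_of_evalMiddle fun lam => ?_
  obtain ⟨α, hα⟩ := exists_dual P lam
  have h1 := contractLeft_toTrivector hα t
  rw [h, map_zero, ht.2, map_neg, ht.1, sub_neg_eq_add, neg_neg] at h1
  have e : evalMiddle L lam (t + t + t) = evalMiddle L lam t + evalMiddle L lam t +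
    evalMiddle L lam t := by rw [map_add, map_add]
  rw [e, map_add, map_add] at h1
  exact toBivector_injOn (isBivector_evalMiddle ht lam) (eq_zero_of_add_self_add_self (k := k) h1.symm)

end Injectivity

/-! ### Skew-symmetry of the tensors in the r-matrix equations. -/

section Symmetry
variable {k 𝔤 L : Type*} [Field k] [CharZero k] [LieRing 𝔤] [LieAlgebra k 𝔤] [CommRing L]
  [Algebra k L]

variable (k 𝔤 L) in
/-- The transposition of the first two factors `𝔤`. -/
noncomputable abbrev swap₁₂ : L ⊗[k] (𝔤 ⊗[k] (𝔤 ⊗[k] 𝔤)) →ₗ[k] L ⊗[k] (𝔤 ⊗[k] (𝔤 ⊗[k] 𝔤)) :=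
  (TensorProduct.leftComm k 𝔤 𝔤 𝔤).toLinearMap.lTensor L

variable (k 𝔤 L) in
/-- The transposition of the last two factors `𝔤`. -/
noncomputable abbrev swap₂₃ : L ⊗[k] (𝔤 ⊗[k] (𝔤 ⊗[k] 𝔤)) →ₗ[k] L ⊗[k] (𝔤 ⊗[k] (𝔤 ⊗[k] 𝔤)) :=
  ((TensorProduct.comm k 𝔤 𝔤).toLinearMap.lTensor 𝔤).lTensor L

/-- Adjacent transpositions permute the three terms of `CYB` up to signs and flips of the arguments.
This lemma and the next five record the action, which gives `isTrivector_CYB`. -/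
theorem swap₁₂_bracket₁₂₁₃ (r s : L ⊗[k] (𝔤 ⊗[k] 𝔤)) :
    swap₁₂ k 𝔤 L (baseMul (bracket₁₂₁₃ k 𝔤) r s) =
      baseMul (bracket₁₂₂₃ k 𝔤) (flip k 𝔤 L r) s := by
  induction r, s using tensor₃_induction₂ with
  | zero_left s => simp
  | zero_right r => simp
  | tmul f a b g c d => rfl
  | add_left r r' s h h' => simp only [map_add, LinearMap.add_apply, h, h']
  | add_right r s s' h h' => simp only [map_add, h, h']

theorem swap₁₂_bracket₁₂₂₃ (r s : L ⊗[k] (𝔤 ⊗[k] 𝔤)) :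
    swap₁₂ k 𝔤 L (baseMul (bracket₁₂₂₃ k 𝔤) r s) =
      baseMul (bracket₁₂₁₃ k 𝔤) (flip k 𝔤 L r) s := by
  induction r, s using tensor₃_induction₂ with
  | zero_left s => simp
  | zero_right r => simp
  | tmul f a b g c d => rfl
  | add_left r r' s h h' => simp only [map_add, LinearMap.add_apply, h, h']
  | add_right r s s' h h' => simp only [map_add, h, h']

theorem swap₁₂_bracket₁₃₂₃ (r s : L ⊗[k] (𝔤 ⊗[k] 𝔤)) :
    swap₁₂ k 𝔤 L (baseMul (bracket₁₃₂₃ k 𝔤) r s) = -baseMul (bracket₁₃₂₃ k 𝔤) s r := by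
  induction r, s using tensor₃_induction₂ with
  | zero_left s => simp
  | zero_right r => simp
  | tmul f a b g c d =>
    change (f * g) ⊗ₜ[k] (c ⊗ₜ[k] (a ⊗ₜ[k] ⁅b, d⁆)) = -((g * f) ⊗ₜ[k] (c ⊗ₜ[k] (a ⊗ₜ[k] ⁅d, b⁆)))
    rw [← lie_skew b d, mul_comm, TensorProduct.tmul_neg, TensorProduct.tmul_neg,
      TensorProduct.tmul_neg]
  | add_left r r' s h h' => simp only [map_add, LinearMap.add_apply, h, h', neg_add]
  | add_right r s s' h h' => simp only [map_add, LinearMap.add_apply, h, h', neg_add]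

theorem swap₂₃_bracket₁₂₁₃ (r s : L ⊗[k] (𝔤 ⊗[k] 𝔤)) :
    swap₂₃ k 𝔤 L (baseMul (bracket₁₂₁₃ k 𝔤) r s) = -baseMul (bracket₁₂₁₃ k 𝔤) s r := by
  induction r, s using tensor₃_induction₂ with
  | zero_left s => simp
  | zero_right r => simp
  | tmul f a b g c d =>
    change (f * g) ⊗ₜ[k] (⁅a, c⁆ ⊗ₜ[k] (d ⊗ₜ[k] b)) = -((g * f) ⊗ₜ[k] (⁅c, a⁆ ⊗ₜ[k] (d ⊗ₜ[k] b)))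
    rw [← lie_skew a c, mul_comm, TensorProduct.neg_tmul, TensorProduct.tmul_neg]
  | add_left r r' s h h' => simp only [map_add, LinearMap.add_apply, h, h', neg_add]
  | add_right r s s' h h' => simp only [map_add, LinearMap.add_apply, h, h', neg_add]

theorem swap₂₃_bracket₁₃₂₃ (r s : L ⊗[k] (𝔤 ⊗[k] 𝔤)) :
    swap₂₃ k 𝔤 L (baseMul (bracket₁₃₂₃ k 𝔤) r s) =
      baseMul (bracket₁₂₂₃ k 𝔤) r (flip k 𝔤 L s) := by
  induction r, s using tensor₃_induction₂ with
  | zero_left s => simp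
  | zero_right r => simp
  | tmul f a b g c d => rfl
  | add_left r r' s h h' => simp only [map_add, LinearMap.add_apply, h, h']
  | add_right r s s' h h' => simp only [map_add, h, h']

theorem swap₂₃_bracket₁₂₂₃ (r s : L ⊗[k] (𝔤 ⊗[k] 𝔤)) :
    swap₂₃ k 𝔤 L (baseMul (bracket₁₂₂₃ k 𝔤) r s) =
      baseMul (bracket₁₃₂₃ k 𝔤) r (flip k 𝔤 L s) := by
  induction r, s using tensor₃_induction₂ with
  | zero_left s => simp
  | zero_right r => simp
  | tmul f a b g c d => rfl
  | add_left r r' s h h' => simp only [map_add, LinearMap.add_apply, h, h']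
  | add_right r s s' h h' => simp only [map_add, h, h']

theorem isTrivector_CYB {r : L ⊗[k] (𝔤 ⊗[k] 𝔤)} (hr : IsBivector r) : IsTrivector (CYB r) := by
  have hr' : flip k 𝔤 L r = -r := hr
  have e : CYB r = baseMul (bracket₁₂₁₃ k 𝔤) r r + baseMul (bracket₁₃₂₃ k 𝔤) r r +
      baseMul (bracket₁₂₂₃ k 𝔤) r r := baseMul_add₃ _ _ _ _ _
  constructor
  · change swap₁₂ k 𝔤 L (CYB r) = _
    rw [e, map_add, map_add, swap₁₂_bracket₁₂₁₃, swap₁₂_bracket₁₃₂₃, swap₁₂_bracket₁₂₂₃, hr']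
    simp only [map_neg, LinearMap.neg_apply]
    abel
  · change swap₂₃ k 𝔤 L (CYB r) = _
    rw [e, map_add, map_add, swap₂₃_bracket₁₂₁₃, swap₂₃_bracket₁₃₂₃, swap₂₃_bracket₁₂₂₃, hr']
    simp only [map_neg]
    abel

/-- Each adjacent transposition changes the sign of the alternation up to an error that depends only
on `s + flip s`, which is zero for a skew `s`. -/
theorem isTrivector_alt (x : 𝔤) {s : L ⊗[k] (𝔤 ⊗[k] 𝔤)} (hs : IsBivector s) :
    IsTrivector ((Alt k 𝔤 ∘ₗ TensorProduct.mk k 𝔤 (𝔤 ⊗[k] 𝔤) x).lTensor L s) := by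
  have hs' : flip k 𝔤 L s = -s := hs
  let A : L ⊗[k] (𝔤 ⊗[k] 𝔤) →ₗ[k] L ⊗[k] (𝔤 ⊗[k] (𝔤 ⊗[k] 𝔤)) :=
    (Alt k 𝔤 ∘ₗ TensorProduct.mk k 𝔤 (𝔤 ⊗[k] 𝔤) x).lTensor L
  let U : L ⊗[k] (𝔤 ⊗[k] 𝔤) →ₗ[k] L ⊗[k] (𝔤 ⊗[k] (𝔤 ⊗[k] 𝔤)) :=
    (TensorProduct.mk k 𝔤 (𝔤 ⊗[k] 𝔤) x).lTensor L
  let W : L ⊗[k] (𝔤 ⊗[k] 𝔤) →ₗ[k] L ⊗[k] (𝔤 ⊗[k] (𝔤 ⊗[k] 𝔤)) :=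
    ((TensorProduct.assoc k 𝔤 𝔤 𝔤).toLinearMap ∘ₗ
      (TensorProduct.comm k 𝔤 (𝔤 ⊗[k] 𝔤)).toLinearMap ∘ₗ
      TensorProduct.mk k 𝔤 (𝔤 ⊗[k] 𝔤) x).lTensor L
  have hA (f : L) (a b : 𝔤) : A (f ⊗ₜ (a ⊗ₜ b)) =
      f ⊗ₜ (x ⊗ₜ (a ⊗ₜ b)) - f ⊗ₜ (a ⊗ₜ (x ⊗ₜ b)) + f ⊗ₜ (a ⊗ₜ (b ⊗ₜ x)) := by
    rw [← TensorProduct.tmul_sub, ← TensorProduct.tmul_add]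
    rfl
  have h1 (s) : swap₁₂ k 𝔤 L (A s) = -A s + (W s + W (flip k 𝔤 L s)) := by
    induction s using tensor₃_induction with
    | zero => simp
    | tmul f a b =>
      rw [hA, map_add, map_sub]
      change f ⊗ₜ (a ⊗ₜ (x ⊗ₜ b)) - f ⊗ₜ (x ⊗ₜ (a ⊗ₜ b)) + f ⊗ₜ (b ⊗ₜ (a ⊗ₜ x)) =
        _ + (f ⊗ₜ (a ⊗ₜ (b ⊗ₜ x)) + f ⊗ₜ (b ⊗ₜ (a ⊗ₜ x)))
      abel
    | add s t hs ht => simp only [map_add, hs, ht]; abel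
  have h2 (s) : swap₂₃ k 𝔤 L (A s) = -A s + (U s + U (flip k 𝔤 L s)) := by
    induction s using tensor₃_induction with
    | zero => simp
    | tmul f a b =>
      rw [hA, map_add, map_sub]
      change f ⊗ₜ (x ⊗ₜ (b ⊗ₜ a)) - f ⊗ₜ (a ⊗ₜ (b ⊗ₜ x)) + f ⊗ₜ (a ⊗ₜ (x ⊗ₜ b)) =
        _ + (f ⊗ₜ (x ⊗ₜ (a ⊗ₜ b)) + f ⊗ₜ (x ⊗ₜ (b ⊗ₜ a)))
      abel
    | add s t hs ht => simp only [map_add, hs, ht]; abel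
  constructor
  · refine (h1 s).trans ?_
    rw [hs', map_neg, add_neg_cancel, add_zero]
  · refine (h2 s).trans ?_
    rw [hs', map_neg, add_neg_cancel, add_zero]

theorem IsTrivector.add {s t : L ⊗[k] (𝔤 ⊗[k] (𝔤 ⊗[k] 𝔤))} (hs : IsTrivector s)
    (ht : IsTrivector t) : IsTrivector (s + t) :=
  ⟨by rw [map_add, hs.1, ht.1, neg_add], by rw [map_add, hs.2, ht.2, neg_add]⟩

theorem IsTrivector.neg {s : L ⊗[k] (𝔤 ⊗[k] (𝔤 ⊗[k] 𝔤))} (hs : IsTrivector s) :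
    IsTrivector (-s) :=
  ⟨by rw [map_neg, hs.1], by rw [map_neg, hs.2]⟩

theorem isTrivector_sum {ι : Type*} (S : Finset ι) {t : ι → L ⊗[k] (𝔤 ⊗[k] (𝔤 ⊗[k] 𝔤))}
    (ht : ∀ i, IsTrivector (t i)) : IsTrivector (∑ i ∈ S, t i) := by
  classical
  induction S using Finset.induction_on with
  | empty => exact ⟨by simp, by simp⟩
  | insert i S hi h => rw [Finset.sum_insert hi]; exact (ht i).add h

theorem IsBivector.add {s t : L ⊗[k] (𝔤 ⊗[k] 𝔤)} (hs : IsBivector s) (ht : IsBivector t) :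
    IsBivector (s + t) := by
  rw [IsBivector, map_add, hs, ht, neg_add]

theorem IsBivector.neg {s : L ⊗[k] (𝔤 ⊗[k] 𝔤)} (hs : IsBivector s) : IsBivector (-s) := by
  rw [IsBivector, map_neg, hs]

theorem IsBivector.smul {s : L ⊗[k] (𝔤 ⊗[k] 𝔤)} (hs : IsBivector s) (f : L) :
    IsBivector (f • s) := by
  have e (s : L ⊗[k] (𝔤 ⊗[k] 𝔤)) : flip k 𝔤 L (f • s) = f • flip k 𝔤 L s := by
    induction s using tensor₃_induction with
    | zero => simp
    | tmul g a b => rfl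
    | add s t hs ht => simp only [smul_add, map_add, hs, ht]
  exact (e s).trans (by rw [show flip k 𝔤 L s = -s from hs, smul_neg])

theorem isBivector_sum {ι : Type*} (S : Finset ι) {t : ι → L ⊗[k] (𝔤 ⊗[k] 𝔤)}
    (ht : ∀ i, IsBivector (t i)) : IsBivector (∑ i ∈ S, t i) := by
  classical
  induction S using Finset.induction_on with
  | empty => rw [IsBivector]; simp
  | insert i S hi h => rw [Finset.sum_insert hi]; exact (ht i).add h

variable {𝔥 : LieSubalgebra k 𝔤} [FiniteDimensional k 𝔥] [LieBialgebra k 𝔥]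
  (P : PoissonBaseAlgebra k 𝔥 L)

theorem lTensor_act {M : Type*} [AddCommGroup M] [Module k M] (σ : M →ₗ[k] M)
    (u : LieDouble k 𝔥) (t : L ⊗[k] M) : σ.lTensor L (P.act u M t) = P.act u M (σ.lTensor L t) := by
  rw [PoissonBaseAlgebra.act, ← LinearMap.comp_apply, ← LinearMap.comp_apply,
    LinearMap.lTensor_comp_rTensor, LinearMap.rTensor_comp_lTensor]

theorem isBivector_act {r : L ⊗[k] (𝔤 ⊗[k] 𝔤)} (hr : IsBivector r) (u : LieDouble k 𝔥) :
    IsBivector (P.act u _ r) := by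
  rw [IsBivector, lTensor_act, hr, map_neg]

theorem isTrivector_act {t : L ⊗[k] (𝔤 ⊗[k] (𝔤 ⊗[k] 𝔤))} (ht : IsTrivector t)
    (u : LieDouble k 𝔥) : IsTrivector (P.act u _ t) :=
  ⟨by rw [lTensor_act, ht.1, map_neg], by rw [lTensor_act, ht.2, map_neg]⟩

theorem isBivector_lie {r : L ⊗[k] (𝔤 ⊗[k] 𝔤)} (hr : IsBivector r) (x : 𝔤) :
    IsBivector ((LieModule.toEnd k 𝔤 (𝔤 ⊗[k] 𝔤) x).lTensor L r) := by
  have e (r : L ⊗[k] (𝔤 ⊗[k] 𝔤)) : flip k 𝔤 L ((LieModule.toEnd k 𝔤 (𝔤 ⊗[k] 𝔤) x).lTensor L r) =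
      (LieModule.toEnd k 𝔤 (𝔤 ⊗[k] 𝔤) x).lTensor L (flip k 𝔤 L r) := by
    induction r using tensor₃_induction with
    | zero => simp
    | tmul f a b =>
      simp only [LinearMap.lTensor_tmul, LieModule.toEnd_apply_apply,
        TensorProduct.LieModule.lie_tmul_right, LinearEquiv.coe_coe, map_add,
        TensorProduct.comm_tmul, add_comm]
    | add s t hs ht => simp only [map_add, hs, ht]
  exact (e r).trans (by rw [show flip k 𝔤 L r = -r from hr, map_neg])

theorem isTrivector_lie {t : L ⊗[k] (𝔤 ⊗[k] (𝔤 ⊗[k] 𝔤))} (ht : IsTrivector t) (x : 𝔤) :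
    IsTrivector ((LieModule.toEnd k 𝔤 (𝔤 ⊗[k] (𝔤 ⊗[k] 𝔤)) x).lTensor L t) := by
  have e (f : L) (a b c : 𝔤) : (LieModule.toEnd k 𝔤 (𝔤 ⊗[k] (𝔤 ⊗[k] 𝔤)) x).lTensor L
      (f ⊗ₜ (a ⊗ₜ (b ⊗ₜ c))) = f ⊗ₜ (⁅x, a⁆ ⊗ₜ (b ⊗ₜ c)) + f ⊗ₜ (a ⊗ₜ (⁅x, b⁆ ⊗ₜ c)) +
      f ⊗ₜ (a ⊗ₜ (b ⊗ₜ ⁅x, c⁆)) := by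
    simp only [LinearMap.lTensor_tmul, LieModule.toEnd_apply_apply,
      TensorProduct.LieModule.lie_tmul_right, TensorProduct.tmul_add, add_assoc]
  have e₁ (t : L ⊗[k] (𝔤 ⊗[k] (𝔤 ⊗[k] 𝔤))) :
      swap₁₂ k 𝔤 L ((LieModule.toEnd k 𝔤 (𝔤 ⊗[k] (𝔤 ⊗[k] 𝔤)) x).lTensor L t) =
      (LieModule.toEnd k 𝔤 (𝔤 ⊗[k] (𝔤 ⊗[k] 𝔤)) x).lTensor L (swap₁₂ k 𝔤 L t) := by
    induction t using tensor₄_induction with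
    | zero => simp
    | tmul f a b c =>
      refine Eq.trans ?_ (e f b a c).symm
      rw [e, map_add, map_add]
      exact congrArg (· + _) (add_comm _ _)
    | add s t hs ht => simp only [map_add, hs, ht]
  have e₂ (t : L ⊗[k] (𝔤 ⊗[k] (𝔤 ⊗[k] 𝔤))) :
      swap₂₃ k 𝔤 L ((LieModule.toEnd k 𝔤 (𝔤 ⊗[k] (𝔤 ⊗[k] 𝔤)) x).lTensor L t) =
      (LieModule.toEnd k 𝔤 (𝔤 ⊗[k] (𝔤 ⊗[k] 𝔤)) x).lTensor L (swap₂₃ k 𝔤 L t) := by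
    induction t using tensor₄_induction with
    | zero => simp
    | tmul f a b c =>
      refine Eq.trans ?_ (e f a c b).symm
      rw [e, map_add, map_add]
      exact add_right_comm _ _ _
    | add s t hs ht => simp only [map_add, hs, ht]
  exact ⟨(e₁ t).trans (by rw [show swap₁₂ k 𝔤 L t = -t from ht.1, map_neg]),
    (e₂ t).trans (by rw [show swap₂₃ k 𝔤 L t = -t from ht.2, map_neg])⟩

theorem isTrivector_dynamicalTerm {r : L ⊗[k] (𝔤 ⊗[k] 𝔤)} (hr : IsBivector r) :
    IsTrivector (dynamicalTerm P r) :=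
  isTrivector_sum _ fun _ => isTrivector_alt _ (isBivector_act P hr _)

theorem isTrivector_dynamicalTerm_sub_CYB {r : L ⊗[k] (𝔤 ⊗[k] 𝔤)} (hr : IsBivector r) :
    IsTrivector (dynamicalTerm P r - CYB r) := by
  rw [sub_eq_add_neg]
  exact (isTrivector_dynamicalTerm P hr).add (isTrivector_CYB hr).neg

theorem isBivector_equivarianceDefect {r : L ⊗[k] (𝔤 ⊗[k] 𝔤)} (hr : IsBivector r) (h : 𝔥) :
    IsBivector (equivarianceDefect P r h) := by
  rw [equivarianceDefect, sub_eq_add_neg]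
  refine ((isBivector_act P hr _).add (isBivector_lie hr _)).add (IsBivector.neg ?_)
  have e (t : 𝔥 ⊗[k] 𝔥) : TensorProduct.comm k 𝔤 𝔤 (TensorProduct.map 𝔥.subtype 𝔥.subtype t) =
      TensorProduct.map 𝔥.subtype 𝔥.subtype (TensorProduct.comm k 𝔥 𝔥 t) := by
    induction t with
    | zero => simp
    | tmul a b => rfl
    | add s t hs ht => simp only [map_add, hs, ht]
  rw [IsBivector, LinearMap.lTensor_tmul, LinearEquiv.coe_coe, e, LieBialgebra.skew, map_neg,
    TensorProduct.tmul_neg]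

end Symmetry

/-! ### Vanishing of `d²` and the r-matrix equations. -/

section RMatrix
variable {k 𝔤 L : Type*} [Field k] [CharZero k] [LieRing 𝔤] [LieAlgebra k 𝔤] [CommRing L]
  [Algebra k L] {𝔥 : LieSubalgebra k 𝔤} [FiniteDimensional k 𝔥] [LieBialgebra k 𝔥]
  {P : PoissonBaseAlgebra k 𝔥 L} {r : L ⊗[k] (𝔤 ⊗[k] 𝔤)}

/-- Sections are sums of terms `f ξ` with `ξ` constant. In `d²(f ξ)` the two cross terms `df dξ`
cancel, since `df` is odd. -/
theorem schouten_schouten_ι_eq_zero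
    (h₀ : ∀ f : L, schouten k (bivector P r) (schouten k (bivector P r) (algebraMap L _ f)) = 0)
    (h₁ : ∀ ξ, schouten k (bivector P r) (schouten k (bivector P r) (P.sec 𝔤 ξ)) = 0)
    (x : P.Algebroid 𝔤) :
    schouten k (bivector P r) (schouten k (bivector P r) (ExteriorAlgebra.ι L x)) = 0 := by
  have hΛ := bivector_mem P r
  have hev := mem_even_of_mem_two hΛ
  induction x using algebroid_induction with
  | zero => simp
  | add x y hx hy => rw [map_add, map_add, map_add, hx, hy, add_zero]
  | smul f ξ =>
    rw [map_smul, ← sec_eq, schouten_even_smul hΛ, map_add, schouten_even_smul hΛ,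
      schouten_even_mul hev, h₀, h₁, involute_of_mem_one (schouten_algebraMap_mem hΛ f)]
    simp

theorem equivarianceDefect_eq_zero_iff (h : 𝔥) : equivarianceDefect P r h = 0 ↔
    P.act (LieDouble.ofLie k 𝔥 h) _ r + (LieModule.toEnd k 𝔤 (𝔤 ⊗[k] 𝔤) (h : 𝔤)).lTensor L r =
      1 ⊗ₜ TensorProduct.map 𝔥.subtype 𝔥.subtype (LieBialgebra.cobracket (k := k) h) :=
  sub_eq_zero

/-- Equivariance kills `d²` on functions, and invariance of `φ` kills it on constant sections. -/
theorem IsClassicalDynamicalRMatrix.schouten_schouten (hr : IsClassicalDynamicalRMatrix P r)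
    (Q : ExteriorAlgebra L (P.Algebroid 𝔤)) :
    schouten k (bivector P r) (schouten k (bivector P r) Q) = 0 := by
  have heq (h : 𝔥) : equivarianceDefect P r h = 0 :=
    (equivarianceDefect_eq_zero_iff h).2 (hr.equivariance h)
  obtain ⟨φ, hφ, e⟩ := hr.yangBaxter
  have h₀ (f : L) :
      schouten k (bivector P r) (schouten k (bivector P r) (algebraMap L _ f)) = 0 := by
    rw [schouten_schouten_algebraMap]
    simp only [heq, map_zero, smul_zero, Finset.sum_const_zero]
  have h₁ (ξ : 𝔤 × LieDouble k 𝔥) :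
      schouten k (bivector P r) (schouten k (bivector P r) (P.sec 𝔤 ξ)) = 0 := by
    have eξ : ξ = (ξ.1, 0) + (0, ξ.2) := by simp
    rw [eξ, map_add, map_add, map_add, schouten_schouten_gSec P hr.isBivector heq,
      schouten_schouten_double P hr.isBivector heq, e, hφ.lie_invariant, hφ.double_invariant,
      map_zero, smul_zero, add_zero]
  exact schouten_schouten_eq_zero (bivector_mem P r) h₀ (schouten_schouten_ι_eq_zero h₀ h₁) Q

theorem toBivector_smul (f : L) (t : L ⊗[k] (𝔤 ⊗[k] 𝔤)) :
    P.toBivector 𝔤 (f • t) = f • P.toBivector 𝔤 t := by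
  induction t using tensor₃_induction with
  | zero => simp
  | tmul g a b => rw [TensorProduct.smul_tmul', toBivector_tmul', toBivector_tmul', smul_smul]; rfl
  | add s t hs ht => simp only [smul_add, map_add, hs, ht]

/-- If `𝔥^*` acts effectively, elements of `L ⊗ V` that annihilate all functions vanish. -/
theorem PoissonBaseAlgebra.DualActsEffectively.eq_zero (hP : P.DualActsEffectively) {V : Type*}
    [AddCommGroup V] [Module k V] (d : Fin (Module.finrank k 𝔥) → L ⊗[k] V)
    (h : ∀ f, ∑ i, P.action (LieDouble.ofDual k 𝔥 ((Module.finBasis k 𝔥).coord i)) f • d i = 0)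
    (i : Fin (Module.finrank k 𝔥)) : d i = 0 := by
  refine eq_zero_of_evalRight fun lam => ?_
  -- Effectiveness concerns coefficients in `L`, so a functional on `V` is applied first. The
  -- resulting element of `L ⊗ 𝔥^*` acts by zero on functions.
  have h1 : ∑ j, evalRight L lam (d j) ⊗ₜ[k] (Module.finBasis k 𝔥).coord j = 0 := by
    refine hP ?_
    rw [map_zero]
    ext f
    have h2 := congrArg (evalRight L lam) (h f)
    rw [map_sum, map_zero] at h2
    simp only [evalRight_smul] at h2
    rw [map_sum, Derivation.coe_zero, Pi.zero_apply, ← h2, ← Derivation.coeFnAddMonoidHom_apply,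
      map_sum, Finset.sum_apply]
    refine Finset.sum_congr rfl fun j _ => ?_
    rw [LinearMap.liftBaseChange_tmul, Derivation.coeFnAddMonoidHom_apply, Derivation.smul_apply,
      smul_eq_mul, mul_comm]
    rfl
  -- Evaluation at `h_i` extracts the coefficient of `η^i`.
  have h2 := congrArg (evalRight L (Module.Dual.eval k 𝔥 (Module.finBasis k 𝔥 i))) h1
  rw [map_sum, map_zero] at h2
  simpa [evalRight_tmul, Finsupp.single_apply] using h2

theorem equivarianceDefect_eq_zero_of_basis
    (h : ∀ i, equivarianceDefect P r (Module.finBasis k 𝔥 i) = 0) (x : 𝔥) :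
    equivarianceDefect P r x = 0 := by
  have hadd (x y : 𝔥) : ((x + y : 𝔥) : 𝔤) = x + y := rfl
  have hsmul (c : k) (x : 𝔥) : ((c • x : 𝔥) : 𝔤) = c • (x : 𝔤) := rfl
  let D : 𝔥 →ₗ[k] L ⊗[k] (𝔤 ⊗[k] 𝔤) :=
    { toFun := equivarianceDefect P r
      map_add' := fun x y => by
        simp only [equivarianceDefect, PoissonBaseAlgebra.act, map_add, hadd,
          Derivation.coe_add_linearMap, LinearMap.rTensor_add, LinearMap.lTensor_add,
          LinearMap.add_apply, TensorProduct.tmul_add]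
        abel
      map_smul' := fun c x => by
        simp only [equivarianceDefect, PoissonBaseAlgebra.act, map_smul, hsmul,
          Derivation.coe_smul_linearMap, LinearMap.rTensor_smul, LinearMap.lTensor_smul,
          LinearMap.smul_apply, TensorProduct.tmul_smul, RingHom.id_apply, smul_add, smul_sub] }
  have hD : D = 0 := (Module.finBasis k 𝔥).ext h
  exact LinearMap.congr_fun hD x

/-- From `d²f = 0`, the embedding of bivectors gives `∑ (η^i ▹ f) defect(h_i) = 0` as a tensor, and
effectiveness separates the summands. With equivariance known, `d²ξ = 0` and the embedding of
trivectors give the invariance, with the left side of the Yang-Baxter equation itself as `φ`. -/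
theorem isClassicalDynamicalRMatrix_of_schouten_schouten (hP : P.DualActsEffectively)
    (hr : IsBivector r)
    (hsq : ∀ Q, schouten k (bivector P r) (schouten k (bivector P r) Q) = 0) :
    IsClassicalDynamicalRMatrix P r := by
  have heq : ∀ h, equivarianceDefect P r h = 0 := by
    refine equivarianceDefect_eq_zero_of_basis (hP.eq_zero _ fun f => ?_)
    have h := (schouten_schouten_algebraMap P r f).symm.trans (hsq _)
    rw [smul_eq_zero_iff_right two_ne_zero] at h
    simp only [← toBivector_smul, ← map_sum] at h
    exact toBivector_injOn (isBivector_sum _ fun i =>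
      (isBivector_equivarianceDefect P hr _).smul _) h
  have ht := isTrivector_dynamicalTerm_sub_CYB P hr
  have h23 : (2 / 3 : k) ≠ 0 := by norm_num
  refine ⟨hr, fun h => (equivarianceDefect_eq_zero_iff h).1 (heq h), _, ⟨ht, fun x => ?_, fun u => ?_⟩,
    rfl⟩
  · have h := (schouten_schouten_gSec P hr heq x).symm.trans (hsq _)
    rw [smul_eq_zero_iff_right h23] at h
    exact toTrivector_injOn (isTrivector_lie ht x) h
  · have h := (schouten_schouten_double P hr heq u).symm.trans (hsq _)
    rw [smul_eq_zero_iff_right h23] at h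
    exact toTrivector_injOn (isTrivector_act P ht u) h

theorem bivector_injOn {r s : L ⊗[k] (𝔤 ⊗[k] 𝔤)} (hr : IsBivector r) (hs : IsBivector s)
    (h : bivector P r = bivector P s) : r = s := by
  have h1 : P.toBivector 𝔤 r = P.toBivector 𝔤 s := add_right_cancel h
  rw [← sub_eq_zero, ← map_sub] at h1
  rw [sub_eq_add_neg] at h1
  exact sub_eq_zero.1 ((sub_eq_add_neg r s).trans (toBivector_injOn (hr.add hs.neg) h1))

end RMatrix
end DynR

theorem mainTheorem1 {k 𝔤 L : Type*} [Field k] [CharZero k] [LieRing 𝔤] [LieAlgebra k 𝔤]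
    [CommRing L] [Algebra k L] (𝔥 : LieSubalgebra k 𝔤) [FiniteDimensional k 𝔥] [LieBialgebra k 𝔥]
    (P : PoissonBaseAlgebra k 𝔥 L) :
    (∀ r : L ⊗[k] (𝔤 ⊗[k] 𝔤), IsClassicalDynamicalRMatrix P r →
      (∀ Q, schouten k (bivector P r) (schouten k (bivector P r) Q) = 0) ∧
      IsCoboundaryLieBialgebroid k (bivector P r)) ∧
    (P.DualActsEffectively →
      (∀ r : L ⊗[k] (𝔤 ⊗[k] 𝔤), IsBivector r →
        IsCoboundaryLieBialgebroid k (bivector P r) → IsClassicalDynamicalRMatrix P r) ∧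
      Set.BijOn (bivector P) {r | IsClassicalDynamicalRMatrix P r}
        {Λ | (∃ r, IsBivector r ∧ Λ = P.toBivector 𝔤 r + bivector₀ P) ∧
          IsCoboundaryLieBialgebroid k Λ}) := by
  have ha (r : L ⊗[k] (𝔤 ⊗[k] 𝔤)) (hr : IsClassicalDynamicalRMatrix P r) :
      IsCoboundaryLieBialgebroid k (bivector P r) :=
    isCoboundaryLieBialgebroid_of_sq_zero (bivector_mem P r) hr.schouten_schouten
  refine ⟨fun r hr => ⟨hr.schouten_schouten, ha r hr⟩, fun hP => ?_⟩
  -- Among the axioms of a coboundary Lie bialgebroid only `d² = 0` is needed.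
  have hb (r : L ⊗[k] (𝔤 ⊗[k] 𝔤)) (hr : IsBivector r)
      (h : IsCoboundaryLieBialgebroid k (bivector P r)) : IsClassicalDynamicalRMatrix P r :=
    isClassicalDynamicalRMatrix_of_schouten_schouten hP hr h.isLieBialgebroid.sq_zero
  refine ⟨hb, fun r hr => ⟨⟨r, hr.isBivector, rfl⟩, ha r hr⟩,
    fun r hr s hs h => bivector_injOn hr.isBivector hs.isBivector h, ?_⟩
  rintro _ ⟨⟨r, hr, rfl⟩, h⟩
  exact ⟨r, hb r hr h, rfl⟩
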